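/- **Setting.** Let $m,q\ge 0$, let $x_1,\dots,x_m,y_1,\dots,y_q$ be unknowns, and let $\mathfrak X$ be a connected open subset of $(\mathbb R^{\mathbb N})^m\times\mathbb R^q$ (product topology), with coordinates $x_i^{(k)}$ ($1\le i\le m$, $k\in\mathbb N$) and $y_j$ ($1\le j\le q$). The order of the coordinate $x_i^{(k)}$ is $k$ and that of $y_j$ is $0$. For $W\subseteq\mathfrak X$ open, $\mathcal O(W)$ is the ring of functions on $W$ that are analytic functions of finitely many coordinates. Let $f_1,\dots,f_q\in\mathcal O(\mathfrak X)$ depend only on coordinates of order $\le1$, and let $$\tau=\sum_{i,k}x_i^{(k+1)}\partial_{x_i^{(k)}}+\sum_j f_j\,\partial_{y_j}$$ be the Cartan field of the diffiety of the control system $\dot y_j=f_j(x,\dot x,y)$. A morphism from an open $U\subseteq\mathfrak X$ to an open $V\subseteq\mathfrak X$ is a map $\phi:U\to V$ with $\phi^*\mathcal O(V)\subseteq\mathcal O(U)$ and $\tau\circ\phi^*=\phi^*\circ\tau$ on $\mathcal O(V)$; an isomorphism is a bijective morphism whose inverse is a morphism. Let $\delta\ne0$ be an integrable infinitesimal symmetry: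 a vector field on $\mathfrak X$ with coefficients in $\mathcal O(\mathfrak X)$, commuting with $\tau$, such that for some $e$ all the functions $\delta^kz$ ($k\in\mathbb N$, $z$ among the unknowns) depend only on coordinates of order $\le e$. A *regular domain* is a dense open $\mathfrak U\subseteq\mathfrak X$ together with integers $r_z\ge0$, one for each unknown $z$, such that the functions $Y=(\delta^kz)_{z,\,0\le k<r_z}$ have linearly independent differentials at each point of $\mathfrak U$ and, near each point of $\mathfrak U$, $\delta^{r_z}z=\phi_z(Y)$ for all $z$, with $\phi_z$ analytic. For $\eta\in\mathfrak U$ let $]\epsilon_-(\eta),\epsilon_+(\eta)[$ be the union of the open intervals containing $0$ on which $\delta$ has an integral curve in $\mathfrak U$ that starts at $\eta$ at time $0$; $\mathfrak g(s)(\eta)$ denotes the value of such a curve at time $s$. For $U\subseteq\mathfrak U$ open, put $I(U)=\bigcap_{\eta\in U}]\epsilon_-(\eta),\epsilon_+(\eta)[$ (so $I(\emptyset)=\mathbb R$) and, for $s\in I(U)$, $\mathfrak g_U(s)=\mathfrak g(s)_{|U}$. **Theorem.** A regular domain exists. For every regular domain $(\mathfrak U,(r_z))$ the following hold. 1. (Flow.)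 For every $\eta\in\mathfrak U$, integral curves in $\mathfrak U$ starting at $\eta$ are unique, and $s\mapsto\mathfrak g(s)(\eta)$ is one on the whole open interval $]\epsilon_-(\eta),\epsilon_+(\eta)[$. Near each $s_0$ in this interval, the functions $\gamma_{z,k}(s)=(\delta^kz)(\mathfrak g(s)(\eta))$ solve the finite-dimensional analytic system $\gamma_{z,k}'=\gamma_{z,k+1}$ for $k<r_z-1$, $\gamma_{z,r_z-1}'=\phi_z(\gamma)$, for any $\phi_z$ as above near $\mathfrak g(s_0)(\eta)$. 2. (Morphisms.) For every open $U\subseteq\mathfrak U$ and $s\in I(U)$, $\mathfrak g_U(s):U\to\mathfrak U$ is a diffiety morphism. 3. (Pseudogroup.) Let $\mathfrak G_\delta=\{\mathfrak g_U(s): U\subseteq\mathfrak U\text{ open},\ s\in I(U)\}$. It is a one-parameter pseudogroup of local automorphisms of $\mathfrak U$: - every $\mathfrak g\in\mathfrak G_\delta$ is an isomorphism from its domain onto its image, both open in $\mathfrak U$; - (cover, neutral element, restriction, inverse) every point of $\mathfrak U$ is in the domain of an element; $\mathrm{Id}_{|U}\in\mathfrak G_\delta$ for all open $U\subseteq\mathfrak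 U$; restrictions of elements to open subsets of their domains, and inverses of elements, are in $\mathfrak G_\delta$; - (composition) if $\mathfrak g_1,\mathfrak g_2\in\mathfrak G_\delta$ and $\operatorname{Im}\mathfrak g_1\cap\operatorname{Dom}\mathfrak g_2\neq\emptyset$, then $\mathfrak g_2\circ\mathfrak g_1$, defined on $\operatorname{Dom}\mathfrak g_1\cap\mathfrak g_1^{-1}(\operatorname{Dom}\mathfrak g_2)$, is in $\mathfrak G_\delta$; - (existence) for every open $U\subseteq\mathfrak U$, $I(U)$ is connected and contains $0$, and $\mathfrak g_U(s)\in\mathfrak G_\delta$ for $s\in I(U)$; every $\eta\in\mathfrak U$ has an open neighbourhood $U\subseteq\mathfrak U$ such that $I(U)$ is a neighbourhood of $0$ and $s\mapsto\mathfrak g_U(s)$ is locally injective on $I(U)$; - (uniqueness) each $\mathfrak g\in\mathfrak G_\delta$ with domain $U$ equals $\mathfrak g_U(s)$ for some $s\in I(U)$, and $I(U)\ne\{0\}$ if $\mathfrak g\neq\mathrm{Id}_{|U}$; - (inverse, with parameter) if $s\in I(U)$ and $V=\operatorname{Im}\mathfrak g_U(s)$, then $I(V)=I(U)-s$, $-s\in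 I(V)$ and $\mathfrak g_V(-s)\circ\mathfrak g_U(s)=\mathrm{Id}_{|U}$; - (composition, with parameter) if $s_1\in I(U)$, $s_1+s_2\in I(U)$ and $V=\operatorname{Im}\mathfrak g_U(s_1)$, then $s_2\in I(V)$ and $\mathfrak g_V(s_2)\circ\mathfrak g_U(s_1)=\mathfrak g_U(s_1+s_2)$; - (local) let $U\subseteq\mathfrak U$ be open and connected, covered by open sets $U_\ell\subseteq U$, and let $\mathfrak g$ be a map on $U$ with $\mathfrak g_{|U_\ell}=\mathfrak g_{U_\ell}(s_\ell)$, $s_\ell\in I(U_\ell)$, for all $\ell$. If all $s_\ell\ge0$, or all $s_\ell\le0$, or if $\mathfrak g_W(t)\neq\mathrm{Id}_{|W}$ for all nonempty open $W\subseteq U$ and all $t\in I(W)\setminus\{0\}$, then $\mathfrak g\in\mathfrak G_\delta$. -/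

import Mathlib

open Set Filter Topology

namespace DiffietyFlow

/-- Indices of the coordinate functions of the diffiety of a control system whose unknowns are
`x_1, …, x_m` (differentially free) and `y_1, …, y_q`: `inl (i, k)` is the coordinate `x_i^{(k)}`
and `inr j` is the coordinate `y_j`. -/
abbrev Coord (m q : ℕ) : Type := (Fin m × ℕ) ⊕ Fin q

/-- Indices of the unknowns `x_1, …, x_m, y_1, …, y_q` themselves. -/
abbrev Var (m q : ℕ) : Type := Fin m ⊕ Fin q

/-- The coordinate space `(ℝ^ℕ)^m × ℝ^q`, with the product topology (the coarsest topology making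
all the coordinate functions continuous). -/
abbrev Space (m q : ℕ) : Type := Coord m q → ℝ

/-- A vector field `∑ a_v ∂_v`, given by the family of its coefficients. -/
abbrev VectorField (m q : ℕ) : Type := Coord m q → Space m q → ℝ

variable {m q : ℕ}

/-- The unknown `z`, seen as a coordinate function of order `0`. -/
def varCoord : Var m q → Coord m q
  | Sum.inl i => Sum.inl (i, 0)
  | Sum.inr j => Sum.inr j

/-- The order of a coordinate: `k` for `x_i^{(k)}` and `0` for `y_j`. -/
def coordOrder : Coord m q → ℕ
  | Sum.inl p => p.2
  | Sum.inr _ => 0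

/-- `F` belongs to the ring `𝒪(W)`: on `W` it is an analytic function of finitely many
coordinates. -/
def IsAnalyticFun (W : Set (Space m q)) (F : Space m q → ℝ) : Prop :=
  ∃ (S : Finset (Coord m q)) (h : (S → ℝ) → ℝ),
    AnalyticOnNhd ℝ h ((fun (η : Space m q) (v : S) => η v) '' W) ∧
    ∀ η ∈ W, F η = h (fun v : S => η v)

/-- On `W`, the function `F` has order at most `e`: it depends on no coordinate of order `> e`. -/
def HasOrderLE (W : Set (Space m q)) (e : ℕ) (F : Space m q → ℝ) : Prop :=
  ∀ η ∈ W, ∀ ζ ∈ W, (∀ v, coordOrder v ≤ e → η v = ζ v) → F η = F ζ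

/-- The partial derivative `∂F/∂v`. -/
noncomputable def partialDeriv (v : Coord m q) (F : Space m q → ℝ) (η : Space m q) : ℝ :=
  deriv (fun t : ℝ => F (Function.update η v t)) (η v)

/-- The derivation `F ↦ ∑ a_v ∂F/∂v`. The sum is finite when `F` depends on finitely many
coordinates near `η`. -/
noncomputable def lieD (a : VectorField m q) (F : Space m q → ℝ) (η : Space m q) : ℝ :=
  ∑ᶠ v, a v η * partialDeriv v F η

/-- The iterate `δ^k z` for an unknown `z`. -/
noncomputable def iter (δ : VectorField m q) (z : Var m q) (k : ℕ) : Space m q → ℝ :=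
  (lieD δ)^[k] (fun η => η (varCoord z))

/-- The map `η ↦ (δ^k z (η))`, where `z` runs over the unknowns and `0 ≤ k < r z`. -/
noncomputable def iterTuple (δ : VectorField m q) (r : Var m q → ℕ) (η : Space m q) :
    (Σ z : Var m q, Fin (r z)) → ℝ :=
  fun p => iter δ p.1 p.2 η

variable (m q) in
/-- The diffiety of an autonomous analytic control system `y_j' = f_j(x, x', y)`, on a connected
open subset of the coordinate space. Systems `x' = f(x, u)` are of this form (the `u_i` are the
differentially free unknowns, and `f` does not depend on `u'`), and so are systems in which the
controls are the derivatives of the first state variables. -/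
structure Diffiety where
  carrier : Set (Space m q)
  isOpen_carrier : IsOpen carrier
  isConnected_carrier : IsConnected carrier
  f : Fin q → Space m q → ℝ
  f_analytic : ∀ j, IsAnalyticFun carrier (f j)
  f_order : ∀ j, HasOrderLE carrier 1 (f j)

/-- The Cartan field `τ = ∑ x_i^{(k+1)} ∂_{x_i^{(k)}} + ∑ f_j ∂_{y_j}`. -/
def Diffiety.cartan (X : Diffiety m q) : VectorField m q
  | Sum.inl p => fun η => η (Sum.inl (p.1, p.2 + 1))
  | Sum.inr j => X.f j

/-- `δ` is an infinitesimal symmetry: a vector field with coefficients in `𝒪(𝔛)` that commutes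
with the Cartan field. -/
def Diffiety.IsSymmetry (X : Diffiety m q) (δ : VectorField m q) : Prop :=
  (∀ v, IsAnalyticFun X.carrier (δ v)) ∧
  ∀ F, IsAnalyticFun X.carrier F → ∀ η ∈ X.carrier,
    lieD δ (lieD X.cartan F) η = lieD X.cartan (lieD δ F) η

/-- `δ` is an integrable infinitesimal symmetry: the iterates `δ^k z` of all the unknowns have
bounded order. -/
def Diffiety.IsIntegrable (X : Diffiety m q) (δ : VectorField m q) : Prop :=
  X.IsSymmetry δ ∧ ∃ e : ℕ, ∀ (z : Var m q) (k : ℕ), HasOrderLE X.carrier e (iter δ z k)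

/-- Near `η`, one has `δ^{r z} z = φ_z(Y)` for every unknown `z`, with `φ_z` analytic, where
`Y` is the tuple of the `δ^k z`, `k < r z`. -/
def IsReduction (δ : VectorField m q) (r : Var m q → ℕ) (η : Space m q)
    (φ : Var m q → ((Σ z : Var m q, Fin (r z)) → ℝ) → ℝ) : Prop :=
  ∀ z, AnalyticAt ℝ (φ z) (iterTuple δ r η) ∧
    ∀ᶠ ζ in 𝓝 η, iter δ z (r z) ζ = φ z (iterTuple δ r ζ)

/-- `𝔘` is a dense open subset of the diffiety on which the functions `δ^k z`, `k < r z`, are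
functionally independent (independent differentials), and locally express all the `δ^{r z} z`. -/
structure Diffiety.IsRegularDomain (X : Diffiety m q) (δ : VectorField m q)
    (𝔘 : Set (Space m q)) (r : Var m q → ℕ) : Prop where
  isOpen : IsOpen 𝔘
  subset : 𝔘 ⊆ X.carrier
  dense : X.carrier ⊆ closure 𝔘
  independent : ∀ η ∈ 𝔘, LinearIndependent ℝ
    (fun (p : Σ z : Var m q, Fin (r z)) (v : Coord m q) => partialDeriv v (iter δ p.1 p.2) η)
  reduction : ∀ η ∈ 𝔘, ∃ φ, IsReduction δ r η φ

/-- `c` is an integral curve of `δ` in `𝔘` on the open interval `J ∋ 0`, starting from `η`. -/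
structure IsFlowCurve (𝔘 : Set (Space m q)) (δ : VectorField m q) (η : Space m q)
    (J : Set ℝ) (c : ℝ → Space m q) : Prop where
  isOpen : IsOpen J
  ordConnected : J.OrdConnected
  zero_mem : 0 ∈ J
  start : c 0 = η
  mem : ∀ s ∈ J, c s ∈ 𝔘
  hasDerivAt : ∀ s ∈ J, ∀ v, HasDerivAt (fun t => c t v) (δ v (c s)) s

/-- The maximal interval `]ε₋(η), ε₊(η)[` of existence of the integral curve from `η`. -/
def maxInterval (𝔘 : Set (Space m q)) (δ : VectorField m q) (η : Space m q) : Set ℝ :=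
  {s | ∃ J c, IsFlowCurve 𝔘 δ η J c ∧ s ∈ J}

/-- `I(U)`, the intersection of the maximal intervals of the points of `U`. -/
def flowDom (𝔘 : Set (Space m q)) (δ : VectorField m q) (U : Set (Space m q)) : Set ℝ :=
  {s | ∀ η ∈ U, s ∈ maxInterval 𝔘 δ η}

open Classical in
/-- The point at time `s` of the integral curve from `η` (and `η` itself, as a junk value, when
`s` is not in the maximal interval). The flow mapping `𝔤_U(s)` is the restriction to `U` of this
map, for `s ∈ I(U)`. -/
noncomputable def flowMap (𝔘 : Set (Space m q)) (δ : VectorField m q) (s : ℝ) (η : Space m q) :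
    Space m q :=
  if h : ∃ (x : Space m q) (J : Set ℝ) (c : ℝ → Space m q),
      IsFlowCurve 𝔘 δ η J c ∧ s ∈ J ∧ c s = x
  then h.choose else η

/-- The curve `c` projects, near the time `s₀`, to a solution of the finite-dimensional system
`γ_{z,k}' = γ_{z,k+1}` for `k < r_z - 1`, `γ_{z,r_z-1}' = φ_z(γ)`. -/
def SolvesReducedSystem (δ : VectorField m q) (r : Var m q → ℕ)
    (φ : Var m q → ((Σ z : Var m q, Fin (r z)) → ℝ) → ℝ)
    (c : ℝ → Space m q) (s₀ : ℝ) : Prop :=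
  ∀ᶠ s in 𝓝 s₀, ∀ (z : Var m q) (k : Fin (r z)),
    HasDerivAt (fun t => iterTuple δ r (c t) ⟨z, k⟩)
      (if h : (k : ℕ) + 1 < r z then iterTuple δ r (c s) ⟨z, ⟨k + 1, h⟩⟩
        else φ z (iterTuple δ r (c s))) s

/-- `φ` is a diffiety (Lie–Bäcklund) morphism from the open set `U` to the open set `V`. -/
structure Diffiety.IsMorphism (X : Diffiety m q) (U V : Set (Space m q))
    (φ : Space m q → Space m q) : Prop where
  mapsTo : MapsTo φ U V
  pullback : ∀ F, IsAnalyticFun V F → IsAnalyticFun U (F ∘ φ)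
  commutes : ∀ F, IsAnalyticFun V F → ∀ η ∈ U,
    lieD X.cartan (F ∘ φ) η = lieD X.cartan F (φ η)

/-- `φ` restricts to an isomorphism of diffieties from the open set `U` onto the open set `V`. -/
def Diffiety.IsIso (X : Diffiety m q) (U V : Set (Space m q)) (φ : Space m q → Space m q) : Prop :=
  IsOpen U ∧ IsOpen V ∧ X.IsMorphism U V φ ∧
    ∃ ψ, X.IsMorphism V U ψ ∧ LeftInvOn ψ φ U ∧ RightInvOn ψ φ V

/-- A set of isomorphisms between open subsets of `𝔙`, closed under restriction, composition and
inverse, containing the identities and covering `𝔙`. A local map is a pair of a domain `U` and a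
map, of which only the restriction to `U` matters (`congr`); `G U φ` says that it is in the set. -/
structure Diffiety.IsPseudogroup (X : Diffiety m q) (𝔙 : Set (Space m q))
    (G : Set (Space m q) → (Space m q → Space m q) → Prop) : Prop where
  congr : ∀ U φ ψ, G U φ → EqOn φ ψ U → G U ψ
  iso : ∀ U φ, G U φ → U ⊆ 𝔙 ∧ φ '' U ⊆ 𝔙 ∧ X.IsIso U (φ '' U) φ
  cover : ∀ η ∈ 𝔙, ∃ W φ, η ∈ W ∧ G W φ
  restriction : ∀ U φ W, G U φ → IsOpen W → W ⊆ U → G W φ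
  composition : ∀ U φ V ψ, G U φ → G V ψ → (φ '' U ∩ V).Nonempty → G (U ∩ φ ⁻¹' V) (ψ ∘ φ)
  identity : ∀ U, IsOpen U → U ⊆ 𝔙 → G U id
  inverse : ∀ U φ ψ, G U φ → LeftInvOn ψ φ U → G (φ '' U) ψ

/-- A one-parameter pseudogroup acting on `𝔙`, with parameter domains `Dom U` and elements
`g U s` (`s ∈ Dom U`). -/
structure Diffiety.IsOneParameterPseudogroup (X : Diffiety m q) (𝔙 : Set (Space m q))
    (G : Set (Space m q) → (Space m q → Space m q) → Prop)
    (Dom : Set (Space m q) → Set ℝ) (g : Set (Space m q) → ℝ → Space m q → Space m q) : Prop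
    extends X.IsPseudogroup 𝔙 G where
  dom_connected : ∀ U, IsOpen U → U ⊆ 𝔙 → 0 ∈ Dom U ∧ IsConnected (Dom U)
  existence : ∀ U, IsOpen U → U ⊆ 𝔙 → ∀ s ∈ Dom U, G U (g U s)
  /-- Around each point the parameter domain is a neighbourhood of `0`, and `s ↦ g U s` is locally
  injective. -/
  existence_local : ∀ η ∈ 𝔙, ∃ U, IsOpen U ∧ U ⊆ 𝔙 ∧ η ∈ U ∧ Dom U ∈ 𝓝 (0 : ℝ) ∧
    ∀ s₀ ∈ Dom U, ∃ N ∈ 𝓝 s₀, ∀ s ∈ N ∩ Dom U, ∀ s' ∈ N ∩ Dom U,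
      EqOn (g U s) (g U s') U → s = s'
  unicity : ∀ U φ, G U φ →
    (∃ s ∈ Dom U, EqOn φ (g U s) U) ∧ (¬ EqOn φ id U → Dom U ≠ {0})
  inverse_param : ∀ U, IsOpen U → U ⊆ 𝔙 → ∀ s ∈ Dom U,
    Dom (g U s '' U) = {t | s + t ∈ Dom U} ∧ -s ∈ Dom (g U s '' U) ∧
    EqOn (g (g U s '' U) (-s) ∘ g U s) id U
  composition_param : ∀ U, IsOpen U → U ⊆ 𝔙 → ∀ s₁ ∈ Dom U, ∀ s₂, s₁ + s₂ ∈ Dom U →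
    s₂ ∈ Dom (g U s₁ '' U) ∧ EqOn (g (g U s₁ '' U) s₂ ∘ g U s₁) (g U (s₁ + s₂)) U
  /-- Gluing on a connected domain of local pieces `g W s`, where either all the parameters `s`
  are `≥ 0`, or all are `≤ 0`, or no piece with a nonzero parameter is the identity on a nonempty
  open subset. -/
  gluing : ∀ U φ, IsOpen U → U ⊆ 𝔙 → IsPreconnected U →
    ((∀ η ∈ U, ∃ W ⊆ U, IsOpen W ∧ η ∈ W ∧ ∃ s ∈ Dom W, 0 ≤ s ∧ EqOn φ (g W s) W) ∨
      (∀ η ∈ U, ∃ W ⊆ U, IsOpen W ∧ η ∈ W ∧ ∃ s ∈ Dom W, s ≤ 0 ∧ EqOn φ (g W s) W) ∨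
      ((∀ η ∈ U, ∃ W ⊆ U, IsOpen W ∧ η ∈ W ∧ G W φ) ∧
        ∀ W ⊆ U, IsOpen W → W.Nonempty → ∀ t ∈ Dom W, EqOn (g W t) id W → t = 0)) →
    G U φ

/-- The set `𝔊_δ` of all flow mappings `𝔤_U(s)`, `U ⊆ 𝔘` open and `s ∈ I(U)`. -/
def flowPseudogroup (𝔘 : Set (Space m q)) (δ : VectorField m q) (U : Set (Space m q))
    (φ : Space m q → Space m q) : Prop :=
  IsOpen U ∧ U ⊆ 𝔘 ∧ ∃ s ∈ flowDom 𝔘 δ U, EqOn φ (flowMap 𝔘 δ s) U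

end DiffietyFlow

/-! All calculus takes place on germs that are analytic in finitely many coordinates
(`FinAnalyticAt`), so the chain rule, the symmetry of second derivatives and the identity theorem
come from finite dimension.

Regular domain. Integrability confines every `δ^k z` to the finitely many coordinates of order at
most `e`. Choose orders `r` of maximal sum for which the `δ^k z`, `k < r z`, are independent
somewhere. Independence means that a Gram determinant does not vanish; this determinant is analytic
on a connected set and not identically zero, so independence holds on a dense open set. By
maximality the differential of `δ^{r z} z` there is a combination of those of the tuple `Y`, and a
constant-rank argument (`exists_analytic_factorization`) makes `δ^{r z} z` an analytic function of
`Y`. This is `exists_isRegularDomain`.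

Flow. In infinitely many coordinates, existence and uniqueness of integral curves are not automatic.
But `Y` intertwines `δ` with a finite-dimensional analytic field, whose flow is analytic
(`exists_analytic_flow`). Pulled back by `Y`, it provides functions `H z` of time and position with
initial value `z` and `∂H/∂t = δ H`. Since `δ` commutes with the Cartan field `τ`, applying `τ`
preserves this transport equation, and `τ^k (H x_i)` is the component `x_i^{(k)}` of the flow
(`exists_local_flow`). A solution `A` of the transport equation has Taylor coefficients `δ^k A₀` at
time `0`, hence is determined by its initial value (`Transport.eqOn`). This one principle yields
both the integral curve equation and the commutation of the flow with `τ`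
(`HasLocalFlows.lie_cartan_flowMap`). Uniqueness of integral curves follows from the constancy of `s
↦ G (t - s, c s)`.

Morphisms. The Taylor coefficients in time of the component `v` of the flow are the `δ^k v`, of
order bounded independently of `k`. So on the whole domain each component depends on finitely many
coordinates (`HasLocalFlows.flowMap_eq_of_agree`), as membership in the ring of analytic functions
requires.

Pseudogroup. The group laws are formal consequences of uniqueness. Gluing rests on the identity
theorem: flow mappings with a common germ agree on a connected set where both exist. For parameters
of one sign, the infimum of the usable parameters works everywhere; without periods, the parameter
is locally constant. -/

namespace DiffietyFlow

/-! ### Germs of analytic functions of finitely many coordinates. -/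

section FinAnalytic

variable {ι κ : Type*}

/-- `F` is, near `η`, an analytic function of finitely many coordinates. -/
def FinAnalyticAt (F : (ι → ℝ) → ℝ) (η : ι → ℝ) : Prop :=
  ∃ (S : Finset ι) (h : (S → ℝ) → ℝ), AnalyticAt ℝ h (S.restrict η) ∧
    F =ᶠ[𝓝 η] fun ζ => h (S.restrict ζ)

theorem continuous_restrict (S : Finset ι) :
    Continuous (fun ζ : ι → ℝ => S.restrict ζ) :=
  continuous_pi fun v => continuous_apply (v : ι)

theorem FinAnalyticAt.congr {F G : (ι → ℝ) → ℝ} {η : ι → ℝ} (hF : FinAnalyticAt F η)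
    (h : F =ᶠ[𝓝 η] G) : FinAnalyticAt G η := by
  obtain ⟨S, f, hf, hFf⟩ := hF
  exact ⟨S, f, hf, h.symm.trans hFf⟩

theorem FinAnalyticAt.exists_of_subset {F : (ι → ℝ) → ℝ} {η : ι → ℝ} {S T : Finset ι}
    (hST : S ⊆ T) {h : (S → ℝ) → ℝ} (hh : AnalyticAt ℝ h (S.restrict η))
    (hF : F =ᶠ[𝓝 η] fun ζ => h (S.restrict ζ)) :
    ∃ h' : (T → ℝ) → ℝ, AnalyticAt ℝ h' (T.restrict η) ∧ F =ᶠ[𝓝 η] fun ζ => h' (T.restrict ζ) := by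
  let L : (T → ℝ) →L[ℝ] (S → ℝ) :=
    ContinuousLinearMap.pi fun v : S => ContinuousLinearMap.proj (⟨v, hST v.2⟩ : T)
  exact ⟨h ∘ L, AnalyticAt.comp (x := T.restrict η) (g := h) hh (L.analyticAt _), hF⟩

theorem FinAnalyticAt.continuousAt {F : (ι → ℝ) → ℝ} {η : ι → ℝ} (hF : FinAnalyticAt F η) :
    ContinuousAt F η := by
  obtain ⟨S, h, hh, hFh⟩ := hF
  have h1 : ContinuousAt (fun ζ => h (S.restrict ζ)) η :=
    ContinuousAt.comp (f := fun ζ : ι → ℝ => S.restrict ζ) hh.continuousAt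
      (continuous_restrict S).continuousAt
  exact h1.congr hFh.symm

/-- Finitely many germs of functions are functions of common finitely many coordinates. -/
theorem FinAnalyticAt.exists_common [Fintype κ] {F : κ → (ι → ℝ) → ℝ} {η : ι → ℝ}
    (hF : ∀ i, FinAnalyticAt (F i) η) :
    ∃ (S : Finset ι) (h : κ → (S → ℝ) → ℝ), ∀ i, AnalyticAt ℝ (h i) (S.restrict η) ∧
      F i =ᶠ[𝓝 η] fun ζ => h i (S.restrict ζ) := by
  classical
  choose S h hh hF using hF
  have := fun i => FinAnalyticAt.exists_of_subset
    (Finset.subset_biUnion_of_mem S (Finset.mem_univ i)) (hh i) (hF i)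
  choose h' hh' using this
  exact ⟨_, h', hh'⟩

/-- Once the finitely many inner germs are written in a common finite set of coordinates, the
composite is one of analytic maps between finite-dimensional spaces. -/
theorem FinAnalyticAt.analytic_comp [Fintype κ] {F : κ → (ι → ℝ) → ℝ} {η : ι → ℝ}
    (hF : ∀ i, FinAnalyticAt (F i) η) {H : (κ → ℝ) → ℝ} (hH : AnalyticAt ℝ H (fun i => F i η)) :
    FinAnalyticAt (fun ζ => H (fun i => F i ζ)) η := by
  classical
  obtain ⟨S, h, hh⟩ := FinAnalyticAt.exists_common hF
  have h0 : (fun i => F i η) = (fun i => h i (S.restrict η)) :=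
    funext fun i => (hh i).2.self_of_nhds
  refine ⟨S, fun p => H (fun i => h i p), ?_, ?_⟩
  · rw [h0] at hH
    exact AnalyticAt.comp (f := fun p : S → ℝ => fun i => h i p) hH
      (AnalyticAt.pi fun i => (hh i).1)
  · filter_upwards [eventually_all.2 fun i => (hh i).2] with ζ hζ
    simp only [hζ]

/-- The outer germ reads only finitely many components of `Φ`, so infinitely many components do no
harm. Continuity of `Φ` for the product topology pulls back the neighbourhood on which the outer
expression is valid. -/
theorem FinAnalyticAt.comp {F : (κ → ℝ) → ℝ} {Φ : (ι → ℝ) → κ → ℝ} {η : ι → ℝ}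
    (hF : FinAnalyticAt F (Φ η)) (hΦ : ∀ v, FinAnalyticAt (fun ζ => Φ ζ v) η) :
    FinAnalyticAt (fun ζ => F (Φ ζ)) η := by
  obtain ⟨S, h, hh, hFh⟩ := hF
  have hc : ContinuousAt Φ η := continuousAt_pi.2 fun v => (hΦ v).continuousAt
  have h1 : FinAnalyticAt (fun ζ => h (fun i : S => Φ ζ i)) η :=
    FinAnalyticAt.analytic_comp (fun i : S => hΦ i) hh
  exact h1.congr (EventuallyEq.symm (hc.eventually hFh))

theorem finAnalyticAt_const (r : ℝ) (η : ι → ℝ) : FinAnalyticAt (fun _ => r) η :=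
  ⟨∅, fun _ => r, analyticAt_const, .rfl⟩

theorem finAnalyticAt_coord (v : ι) (η : ι → ℝ) : FinAnalyticAt (fun ζ => ζ v) η :=
  ⟨{v}, fun p => p ⟨v, by simp⟩,
    (ContinuousLinearMap.proj (R := ℝ) (φ := fun _ : ({v} : Finset ι) => ℝ) ⟨v, by simp⟩).analyticAt _,
    .rfl⟩

theorem finAnalyticAt_of_analyticAt [Fintype ι] {F : (ι → ℝ) → ℝ} {η : ι → ℝ}
    (hF : AnalyticAt ℝ F η) : FinAnalyticAt F η := by
  classical
  exact FinAnalyticAt.analytic_comp (F := fun i ζ => ζ i) (fun i => finAnalyticAt_coord i η) hF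

theorem FinAnalyticAt.analyticAt [Fintype ι] {F : (ι → ℝ) → ℝ} {η : ι → ℝ}
    (hF : FinAnalyticAt F η) : AnalyticAt ℝ F η := by
  obtain ⟨S, h, hh, hFh⟩ := hF
  let L : (ι → ℝ) →L[ℝ] (S → ℝ) :=
    ContinuousLinearMap.pi fun v : S => ContinuousLinearMap.proj (v : ι)
  exact (AnalyticAt.comp (g := h) (f := L) hh (L.analyticAt _)).congr hFh.symm

theorem FinAnalyticAt.add {F G : (ι → ℝ) → ℝ} {η : ι → ℝ} (hF : FinAnalyticAt F η)
    (hG : FinAnalyticAt G η) : FinAnalyticAt (fun ζ => F ζ + G ζ) η := by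
  let P : Bool → (ι → ℝ) → ℝ := fun b => if b then F else G
  have := FinAnalyticAt.analytic_comp (F := P) (η := η) (fun b => by cases b <;> simpa [P])
    (H := fun p => p true + p false)
    (((ContinuousLinearMap.proj (R := ℝ) (φ := fun _ : Bool => ℝ) true).analyticAt _).add
      ((ContinuousLinearMap.proj (R := ℝ) (φ := fun _ : Bool => ℝ) false).analyticAt _))
  simpa [P] using this

theorem FinAnalyticAt.mul {F G : (ι → ℝ) → ℝ} {η : ι → ℝ} (hF : FinAnalyticAt F η)
    (hG : FinAnalyticAt G η) : FinAnalyticAt (fun ζ => F ζ * G ζ) η := by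
  let P : Bool → (ι → ℝ) → ℝ := fun b => if b then F else G
  have := FinAnalyticAt.analytic_comp (F := P) (η := η) (fun b => by cases b <;> simpa [P])
    (H := fun p => p true * p false)
    (((ContinuousLinearMap.proj (R := ℝ) (φ := fun _ : Bool => ℝ) true).analyticAt _).mul
      ((ContinuousLinearMap.proj (R := ℝ) (φ := fun _ : Bool => ℝ) false).analyticAt _))
  simpa [P] using this

theorem FinAnalyticAt.sum {α : Type*} {s : Finset α} {F : α → (ι → ℝ) → ℝ} {η : ι → ℝ}
    (hF : ∀ i ∈ s, FinAnalyticAt (F i) η) : FinAnalyticAt (fun ζ => ∑ i ∈ s, F i ζ) η := by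
  classical
  induction s using Finset.induction_on with
  | empty => simpa using finAnalyticAt_const 0 η
  | insert i s hi ih =>
    simp only [Finset.sum_insert hi]
    exact (hF i (by simp)).add (ih fun j hj => hF j (by simp [hj]))

end FinAnalytic

/-! ### Partial derivatives, derivations and their commutation. -/

section Derivations

variable {ι κ : Type*} [DecidableEq ι] [DecidableEq κ]

/-- The partial derivative along the coordinate `v`. -/
noncomputable def pderiv (v : ι) (F : (ι → ℝ) → ℝ) (η : ι → ℝ) : ℝ :=
  deriv (fun t : ℝ => F (Function.update η v t)) (η v)

/-- The derivation `F ↦ ∑ a_v ∂F/∂v`. -/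
noncomputable def lie (a : ι → (ι → ℝ) → ℝ) (F : (ι → ℝ) → ℝ) (η : ι → ℝ) : ℝ :=
  ∑ᶠ v, a v η * pderiv v F η

/-- The derivative of `F` in the direction `w`. -/
noncomputable def dir (w : ι → ℝ) (F : (ι → ℝ) → ℝ) (η : ι → ℝ) : ℝ :=
  ∑ᶠ v, w v * pderiv v F η

theorem lie_eq_dir (a : ι → (ι → ℝ) → ℝ) (F : (ι → ℝ) → ℝ) (η : ι → ℝ) :
    lie a F η = dir (fun v => a v η) F η := rfl

theorem pderiv_congr {F G : (ι → ℝ) → ℝ} {η : ι → ℝ} (h : F =ᶠ[𝓝 η] G) (v : ι) :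
    pderiv v F η = pderiv v G η := by
  apply Filter.EventuallyEq.deriv_eq
  have : Tendsto (fun t : ℝ => Function.update η v t) (𝓝 (η v)) (𝓝 η) := by
    have hc : Continuous (fun t : ℝ => Function.update η v t) :=
      continuous_const.update v continuous_id
    simpa using hc.tendsto (η v)
  exact this.eventually h

theorem dir_congr {F G : (ι → ℝ) → ℝ} {η : ι → ℝ} (h : F =ᶠ[𝓝 η] G) (w : ι → ℝ) :
    dir w F η = dir w G η := by
  simp only [dir, pderiv_congr h]

theorem lie_congr {F G : (ι → ℝ) → ℝ} {η : ι → ℝ} (h : F =ᶠ[𝓝 η] G)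
    (a : ι → (ι → ℝ) → ℝ) : lie a F η = lie a G η := dir_congr h _

theorem lie_eventuallyEq {F G : (ι → ℝ) → ℝ} {η : ι → ℝ} (h : F =ᶠ[𝓝 η] G)
    (a : ι → (ι → ℝ) → ℝ) : lie a F =ᶠ[𝓝 η] lie a G :=
  h.eventuallyEq_nhds.mono fun _ hζ => lie_congr hζ a

/-- A derivation sees only germs, so iterates can be rewritten only under equality near the point,
not at it. -/
theorem iterate_lie_eventuallyEq {F G : (ι → ℝ) → ℝ} {η : ι → ℝ} (h : F =ᶠ[𝓝 η] G)
    (a : ι → (ι → ℝ) → ℝ) (k : ℕ) : (lie a)^[k] F =ᶠ[𝓝 η] (lie a)^[k] G := by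
  induction k generalizing F G with
  | zero => exact h
  | succ k ih => exact ih (lie_eventuallyEq h a)

/-- A function of finitely many coordinates has the partial derivatives of its finite-dimensional
expression. -/
theorem pderiv_eq {S : Finset ι} {h : (S → ℝ) → ℝ} {F : (ι → ℝ) → ℝ} {η : ι → ℝ}
    (hh : DifferentiableAt ℝ h (S.restrict η)) (hF : F =ᶠ[𝓝 η] fun ζ => h (S.restrict ζ)) (v : ι) :
    pderiv v F η = fderiv ℝ h (S.restrict η) (fun u => if (u : ι) = v then 1 else 0) := by
  rw [pderiv_congr hF]
  have hc : HasDerivAt (fun t : ℝ => S.restrict (Function.update η v t))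
      (fun u : S => if (u : ι) = v then (1 : ℝ) else 0) (η v) := by
    rw [hasDerivAt_pi]
    intro u
    by_cases hu : (u : ι) = v
    · simp only [hu, Finset.restrict, Function.update_self, if_true]
      exact hasDerivAt_id _
    · simp only [hu, Finset.restrict, Function.update, dite_false, if_false]
      exact hasDerivAt_const _ _
  have h0 : S.restrict (Function.update η v (η v)) = S.restrict η := by simp
  have := HasFDerivAt.comp_hasDerivAt (x := η v) (f := fun t : ℝ => S.restrict (Function.update η v t))
    (l := h) (l' := fderiv ℝ h (S.restrict η)) (by rw [h0]; exact hh.hasFDerivAt) hc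
  exact this.deriv

theorem pderiv_eq_zero {S : Finset ι} {h : (S → ℝ) → ℝ} {F : (ι → ℝ) → ℝ} {η : ι → ℝ}
    (hh : DifferentiableAt ℝ h (S.restrict η)) (hF : F =ᶠ[𝓝 η] fun ζ => h (S.restrict ζ)) {v : ι}
    (hv : v ∉ S) : pderiv v F η = 0 := by
  rw [pderiv_eq hh hF]
  have : (fun u : S => if (u : ι) = v then (1 : ℝ) else 0) = 0 := by
    ext u
    have : (u : ι) ≠ v := fun h => hv (h ▸ u.2)
    simp [this]
  rw [this, map_zero]

theorem dir_eq_sum {S : Finset ι} {h : (S → ℝ) → ℝ} {F : (ι → ℝ) → ℝ} {η : ι → ℝ}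
    (hh : DifferentiableAt ℝ h (S.restrict η)) (hF : F =ᶠ[𝓝 η] fun ζ => h (S.restrict ζ))
    (w : ι → ℝ) : dir w F η = ∑ v ∈ S, w v * pderiv v F η := by
  apply finsum_eq_sum_of_support_subset
  intro v hv
  by_contra hvS
  exact hv (by simp [pderiv_eq_zero hh hF (by simpa using hvS)])

theorem dir_eq_fderiv {S : Finset ι} {h : (S → ℝ) → ℝ} {F : (ι → ℝ) → ℝ} {η : ι → ℝ}
    (hh : DifferentiableAt ℝ h (S.restrict η)) (hF : F =ᶠ[𝓝 η] fun ζ => h (S.restrict ζ))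
    (w : ι → ℝ) : dir w F η = fderiv ℝ h (S.restrict η) (S.restrict w) := by
  rw [dir_eq_sum hh hF, ← Finset.sum_coe_sort S]
  have : S.restrict w = ∑ u : S, w u • (fun x : S => if (x : ι) = u then (1 : ℝ) else 0) := by
    ext x
    simp [Finset.sum_apply]
  rw [this, map_sum]
  exact Finset.sum_congr rfl fun u _ => by rw [pderiv_eq hh hF, map_smul, smul_eq_mul]

/-- Chain rule along a curve. -/
theorem FinAnalyticAt.hasDerivAt_comp {F : (ι → ℝ) → ℝ} {c : ℝ → ι → ℝ} {s : ℝ}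
    (hF : FinAnalyticAt F (c s)) {w : ι → ℝ} (hc : ∀ v, HasDerivAt (fun t => c t v) (w v) s) :
    HasDerivAt (fun t => F (c t)) (dir w F (c s)) s := by
  obtain ⟨S, h, hh, hFh⟩ := hF
  rw [dir_eq_fderiv hh.differentiableAt hFh]
  have hcS : HasDerivAt (fun t => S.restrict (c t)) (S.restrict w) s :=
    hasDerivAt_pi.2 fun v => hc v
  have hcc : ContinuousAt c s := continuousAt_pi.2 fun v => (hc v).continuousAt
  have := HasFDerivAt.comp_hasDerivAt (x := s) (f := fun t : ℝ => S.restrict (c t))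
    (l := h) (l' := fderiv ℝ h (S.restrict (c s))) hh.differentiableAt.hasFDerivAt hcS
  exact this.congr_of_eventuallyEq (hcc.eventually hFh)

/-- Since `dir w F η` is the derivative of `F` along the line through `η` with direction `w`, the
rules for products, sums and composites reduce to those of one real variable. -/
theorem dir_eq_of_hasDerivAt {F : (ι → ℝ) → ℝ} {η w : ι → ℝ} (hF : FinAnalyticAt F η) {d : ℝ}
    (h : HasDerivAt (fun t : ℝ => F (fun v => η v + t * w v)) d 0) : dir w F η = d := by
  have h1 : FinAnalyticAt F ((fun (t : ℝ) (v : ι) => η v + t * w v) 0) := by simpa using hF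
  have := FinAnalyticAt.hasDerivAt_comp (c := fun (t : ℝ) (v : ι) => η v + t * w v) h1 (w := w) fun v => by
    simpa using ((hasDerivAt_id (0 : ℝ)).mul_const (w v)).const_add (η v)
  simpa using this.unique h

theorem FinAnalyticAt.hasDerivAt_line {F : (ι → ℝ) → ℝ} {η : ι → ℝ} (hF : FinAnalyticAt F η)
    (w : ι → ℝ) : HasDerivAt (fun t : ℝ => F (fun v => η v + t * w v)) (dir w F η) 0 := by
  have h1 : FinAnalyticAt F ((fun (t : ℝ) (v : ι) => η v + t * w v) 0) := by simpa using hF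
  simpa using FinAnalyticAt.hasDerivAt_comp (c := fun (t : ℝ) (v : ι) => η v + t * w v) h1 (w := w) fun v => by
    simpa using ((hasDerivAt_id (0 : ℝ)).mul_const (w v)).const_add (η v)

theorem dir_add {F : (ι → ℝ) → ℝ} {η : ι → ℝ} (hF : FinAnalyticAt F η) (w w' : ι → ℝ) :
    dir (w + w') F η = dir w F η + dir w' F η := by
  obtain ⟨S, h, hh, hFh⟩ := hF
  simp only [dir_eq_fderiv hh.differentiableAt hFh]
  rw [← map_add]; rfl

theorem dir_smul {F : (ι → ℝ) → ℝ} {η : ι → ℝ} (hF : FinAnalyticAt F η) (r : ℝ) (w : ι → ℝ) :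
    dir (r • w) F η = r * dir w F η := by
  obtain ⟨S, h, hh, hFh⟩ := hF
  simp only [dir_eq_fderiv hh.differentiableAt hFh]
  rw [← smul_eq_mul, ← map_smul]; rfl

/-- Chain rule. -/
theorem dir_comp {F : (κ → ℝ) → ℝ} {Φ : (ι → ℝ) → κ → ℝ} {η : ι → ℝ}
    (hF : FinAnalyticAt F (Φ η)) (hΦ : ∀ v, FinAnalyticAt (fun ζ => Φ ζ v) η) (w : ι → ℝ) :
    dir w (fun ζ => F (Φ ζ)) η = dir (fun v => dir w (fun ζ => Φ ζ v) η) F (Φ η) := by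
  apply dir_eq_of_hasDerivAt (hF.comp hΦ)
  have h1 : FinAnalyticAt F ((fun t : ℝ => Φ (fun v => η v + t * w v)) 0) := by simpa using hF
  simpa using h1.hasDerivAt_comp fun v => (hΦ v).hasDerivAt_line w

theorem pderiv_eventuallyEq {S : Finset ι} {h : (S → ℝ) → ℝ} {F : (ι → ℝ) → ℝ} {η : ι → ℝ}
    (hh : AnalyticAt ℝ h (S.restrict η)) (hF : F =ᶠ[𝓝 η] fun ζ => h (S.restrict ζ)) (v : ι) :
    pderiv v F =ᶠ[𝓝 η] fun ζ =>
      fderiv ℝ h (S.restrict ζ) (fun u => if (u : ι) = v then 1 else 0) := by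
  filter_upwards [(continuous_restrict S).continuousAt.eventually hh.eventually_analyticAt,
    hF.eventuallyEq_nhds] with ζ h1 h2
  exact pderiv_eq h1.differentiableAt h2 v

theorem analyticAt_fderiv_apply {E : Type*} [NormedAddCommGroup E] [NormedSpace ℝ E]
    {h : E → ℝ} {p : E} (hh : AnalyticAt ℝ h p) (w : E) :
    AnalyticAt ℝ (fun x => fderiv ℝ h x w) p :=
  AnalyticAt.comp (g := fun l : E →L[ℝ] ℝ => l w) (f := fderiv ℝ h)
    ((ContinuousLinearMap.apply ℝ ℝ w).analyticAt _) hh.fderiv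

theorem FinAnalyticAt.pderiv {F : (ι → ℝ) → ℝ} {η : ι → ℝ} (hF : FinAnalyticAt F η) (v : ι) :
    FinAnalyticAt (pderiv v F) η := by
  obtain ⟨S, h, hh, hFh⟩ := hF
  exact ⟨S, _, analyticAt_fderiv_apply hh _, pderiv_eventuallyEq hh hFh v⟩

theorem lie_eventuallyEq_sum {S : Finset ι} {h : (S → ℝ) → ℝ} {F : (ι → ℝ) → ℝ} {η : ι → ℝ}
    (hh : AnalyticAt ℝ h (S.restrict η)) (hF : F =ᶠ[𝓝 η] fun ζ => h (S.restrict ζ))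
    (a : ι → (ι → ℝ) → ℝ) : lie a F =ᶠ[𝓝 η] fun ζ => ∑ v ∈ S, a v ζ * DiffietyFlow.pderiv v F ζ := by
  filter_upwards [(continuous_restrict S).continuousAt.eventually hh.eventually_analyticAt,
    hF.eventuallyEq_nhds] with ζ h1 h2
  exact dir_eq_sum h1.differentiableAt h2 _

theorem FinAnalyticAt.lie {F : (ι → ℝ) → ℝ} {η : ι → ℝ} {a : ι → (ι → ℝ) → ℝ}
    (hF : FinAnalyticAt F η) (ha : ∀ v, FinAnalyticAt (a v) η) : FinAnalyticAt (lie a F) η := by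
  obtain ⟨S, h, hh, hFh⟩ := id hF
  exact (FinAnalyticAt.sum fun v _ => (ha v).mul (hF.pderiv v)).congr
    (lie_eventuallyEq_sum hh hFh a).symm

theorem dir_coord (w : ι → ℝ) (v : ι) (η : ι → ℝ) : dir w (fun ζ => ζ v) η = w v := by
  apply dir_eq_of_hasDerivAt (finAnalyticAt_coord v η)
  simpa using ((hasDerivAt_id (0 : ℝ)).mul_const (w v)).const_add (η v)

theorem dir_const (w : ι → ℝ) (r : ℝ) (η : ι → ℝ) : dir w (fun _ => r) η = 0 :=
  dir_eq_of_hasDerivAt (finAnalyticAt_const r η) (hasDerivAt_const _ _)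

theorem dir_mul {F G : (ι → ℝ) → ℝ} {η : ι → ℝ} (hF : FinAnalyticAt F η)
    (hG : FinAnalyticAt G η) (w : ι → ℝ) :
    dir w (fun ζ => F ζ * G ζ) η = dir w F η * G η + F η * dir w G η := by
  apply dir_eq_of_hasDerivAt (hF.mul hG)
  simpa using (hF.hasDerivAt_line w).fun_mul (hG.hasDerivAt_line w)

theorem dir_sum {α : Type*} {s : Finset α} {F : α → (ι → ℝ) → ℝ} {η : ι → ℝ}
    (hF : ∀ i ∈ s, FinAnalyticAt (F i) η) (w : ι → ℝ) :
    dir w (fun ζ => ∑ i ∈ s, F i ζ) η = ∑ i ∈ s, dir w (F i) η := by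
  apply dir_eq_of_hasDerivAt (FinAnalyticAt.sum hF)
  exact HasDerivAt.fun_sum fun i hi => (hF i hi).hasDerivAt_line w

theorem pderiv_comm {S : Finset ι} {h : (S → ℝ) → ℝ} {F : (ι → ℝ) → ℝ} {η : ι → ℝ}
    (hh : AnalyticAt ℝ h (S.restrict η)) (hF : F =ᶠ[𝓝 η] fun ζ => h (S.restrict ζ)) (u v : ι) :
    pderiv u (pderiv v F) η = pderiv v (pderiv u F) η := by
  rw [pderiv_eq (analyticAt_fderiv_apply hh _).differentiableAt (pderiv_eventuallyEq hh hF v),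
    pderiv_eq (analyticAt_fderiv_apply hh _).differentiableAt (pderiv_eventuallyEq hh hF u)]
  have hs : IsSymmSndFDerivAt ℝ h (S.restrict η) :=
    (hh.contDiffAt (n := 2)).isSymmSndFDerivAt (by simp)
  have hd : DifferentiableAt ℝ (fderiv ℝ h) (S.restrict η) := hh.fderiv.differentiableAt
  rw [fderiv_clm_apply hd (differentiableAt_const _), fderiv_clm_apply hd (differentiableAt_const _)]
  simpa using hs.eq _ _

/-- Two derivations that commute on the coordinates commute. -/
theorem lie_comm {F : (ι → ℝ) → ℝ} {η : ι → ℝ} {a b : ι → (ι → ℝ) → ℝ}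
    (hF : FinAnalyticAt F η) (ha : ∀ v, FinAnalyticAt (a v) η) (hb : ∀ v, FinAnalyticAt (b v) η)
    (hab : ∀ v, lie a (b v) η = lie b (a v) η) : lie a (lie b F) η = lie b (lie a F) η := by
  obtain ⟨S, h, hh, hFh⟩ := id hF
  -- The second-order part has coefficients `b_v a_u` and involves `∂_u ∂_v F`; it is unchanged when
  -- `a` and `b` are exchanged, by symmetry of second derivatives. Only the brackets on coordinates
  -- remain to be compared.
  have key : ∀ a b : ι → (ι → ℝ) → ℝ, (∀ v, FinAnalyticAt (b v) η) →
      lie a (lie b F) η = ∑ v ∈ S, lie a (b v) η * DiffietyFlow.pderiv v F η +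
        ∑ v ∈ S, ∑ u ∈ S, b v η * (a u η * DiffietyFlow.pderiv u (DiffietyFlow.pderiv v F) η) := by
    intro a b hb
    rw [lie_congr (lie_eventuallyEq_sum hh hFh b), lie_eq_dir,
      dir_sum fun v _ => (hb v).mul (hF.pderiv v), ← Finset.sum_add_distrib]
    refine Finset.sum_congr rfl fun v _ => ?_
    rw [dir_mul (hb v) (hF.pderiv v), lie_eq_dir, ← Finset.mul_sum]
    congr 2
    exact dir_eq_sum (analyticAt_fderiv_apply hh _).differentiableAt
      (pderiv_eventuallyEq hh hFh v) _
  rw [key a b hb, key b a ha]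
  congr 1
  · exact Finset.sum_congr rfl fun v _ => by rw [hab v]
  · rw [Finset.sum_comm]
    refine Finset.sum_congr rfl fun v _ => Finset.sum_congr rfl fun u _ => ?_
    rw [pderiv_comm hh hFh v u]
    ring

theorem FinAnalyticAt.iterate_lie {F : (ι → ℝ) → ℝ} {η : ι → ℝ} {a : ι → (ι → ℝ) → ℝ}
    (hF : FinAnalyticAt F η) (ha : ∀ v, FinAnalyticAt (a v) η) (k : ℕ) :
    FinAnalyticAt ((DiffietyFlow.lie a)^[k] F) η := by
  induction k generalizing F with
  | zero => exact hF
  | succ k ih => exact ih (hF.lie ha)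

end Derivations

end DiffietyFlow

namespace DiffietyFlow

/-! ### Taylor series on an interval. -/

section OneVariable

/-- Analytic functions on an interval with the same derivatives at a point are equal. -/
theorem eqOn_of_iteratedDeriv_eq {u w : ℝ → ℝ} {J : Set ℝ} {t : ℝ} (hJ : IsPreconnected J)
    (ht : t ∈ J) (hu : AnalyticOnNhd ℝ u J) (hw : AnalyticOnNhd ℝ w J)
    (h : ∀ k, iteratedDeriv k u t = iteratedDeriv k w t) : EqOn u w J := by
  have h1 : AnalyticAt ℝ (u - w) t := (hu t ht).sub (hw t ht)
  have h2 : analyticOrderAt (u - w) t = ⊤ := by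
    rw [ENat.eq_top_iff_forall_ge]
    intro n
    rw [natCast_le_analyticOrderAt_iff_iteratedDeriv_eq_zero h1]
    intro i _
    rw [iteratedDeriv_sub (hu t ht).contDiffAt (hw t ht).contDiffAt, h, sub_self]
  rw [analyticOrderAt_eq_top] at h2
  exact hu.eqOn_of_preconnected_of_eventuallyEq hw hJ ht (h2.mono fun z hz => sub_eq_zero.1 hz)

end OneVariable

/-! ### The product with the time axis and the transport equation. -/

section Time

variable {ι : Type*}

/-- The point of `ℝ × ℝ^ι` with time `s` and position `η`. -/
def cons (s : ℝ) (η : ι → ℝ) : Option ι → ℝ := fun o => o.elim s η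

@[simp] theorem cons_none (s : ℝ) (η : ι → ℝ) : cons s η none = s := rfl

@[simp] theorem cons_some (s : ℝ) (η : ι → ℝ) (v : ι) : cons s η (some v) = η v := rfl

theorem cons_eta (e : Option ι → ℝ) : cons (e none) (fun v => e (some v)) = e := by
  ext o; cases o <;> rfl

theorem continuous_cons : Continuous fun p : ℝ × (ι → ℝ) => cons p.1 p.2 := by
  refine continuous_pi fun o => ?_
  cases o with
  | none => exact continuous_fst
  | some v => exact (continuous_apply v).comp continuous_snd

theorem continuous_tail : Continuous fun e : Option ι → ℝ => fun v => e (some v) :=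
  continuous_pi fun v => continuous_apply (some v)

/-- The time derivation. -/
def dt : Option ι → (Option ι → ℝ) → ℝ := fun o _ => cons 1 (fun _ => 0) o

/-- A vector field, seen as a field on the product with the time axis. -/
def lift (a : ι → (ι → ℝ) → ℝ) : Option ι → (Option ι → ℝ) → ℝ :=
  fun o e => cons 0 (fun v => a v fun u => e (some u)) o

theorem finAnalyticAt_dt (o : Option ι) (e : Option ι → ℝ) : FinAnalyticAt (dt o) e :=
  finAnalyticAt_const _ _

theorem FinAnalyticAt.tail {F : (ι → ℝ) → ℝ} {e : Option ι → ℝ}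
    (hF : FinAnalyticAt F fun v => e (some v)) :
    FinAnalyticAt (fun e : Option ι → ℝ => F fun v => e (some v)) e :=
  FinAnalyticAt.comp (Φ := fun (e : Option ι → ℝ) v => e (some v)) hF
    fun v => finAnalyticAt_coord (some v) e

theorem finAnalyticAt_lift {a : ι → (ι → ℝ) → ℝ} {e : Option ι → ℝ}
    (ha : ∀ v, FinAnalyticAt (a v) fun v => e (some v)) (o : Option ι) :
    FinAnalyticAt (lift a o) e := by
  cases o with
  | none => exact finAnalyticAt_const _ _
  | some v => exact (ha v).tail

theorem FinAnalyticAt.slice {F : (Option ι → ℝ) → ℝ} {s : ℝ} {η : ι → ℝ}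
    (hF : FinAnalyticAt F (cons s η)) : FinAnalyticAt (fun ζ => F (cons s ζ)) η := by
  refine FinAnalyticAt.comp (Φ := fun ζ => cons s ζ) hF fun o => ?_
  cases o with
  | none => exact finAnalyticAt_const _ _
  | some v => exact finAnalyticAt_coord v η

theorem FinAnalyticAt.analyticAt_time {F : (Option ι → ℝ) → ℝ} {s : ℝ} {η : ι → ℝ}
    (hF : FinAnalyticAt F (cons s η)) : AnalyticAt ℝ (fun t => F (cons t η)) s := by
  obtain ⟨S, h, hh, hFh⟩ := hF
  have h1 : AnalyticAt ℝ (fun t : ℝ => S.restrict (cons t η)) s := by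
    refine AnalyticAt.pi fun o => ?_
    obtain ⟨o, ho⟩ := o
    cases o with
    | none => exact analyticAt_id
    | some v => exact analyticAt_const
  have h2 : ContinuousAt (fun t : ℝ => cons t η) s :=
    (continuous_cons.comp (Continuous.prodMk_left η)).continuousAt
  exact (AnalyticAt.comp (f := fun t : ℝ => S.restrict (cons t η)) hh h1).congr
    (EventuallyEq.symm (h2.eventually hFh))

/-- An open set of `ℝ × M` that is fibred over `M` in intervals containing `0`, on which the vector
field `a` is analytic. -/
structure IsFlowBox (a : ι → (ι → ℝ) → ℝ) (Ω : Set (Option ι → ℝ)) : Prop where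
  isOpen : IsOpen Ω
  analytic : ∀ e ∈ Ω, ∀ v, FinAnalyticAt (a v) fun v => e (some v)
  preconnected : ∀ η : ι → ℝ, IsPreconnected {s | cons s η ∈ Ω}
  zero_mem : ∀ s η, cons s η ∈ Ω → cons 0 η ∈ Ω

variable {a : ι → (ι → ℝ) → ℝ} {Ω : Set (Option ι → ℝ)} {A B : (Option ι → ℝ) → ℝ}

theorem IsFlowBox.isOpen_slice (hΩ : IsFlowBox a Ω) (η : ι → ℝ) : IsOpen {s | cons s η ∈ Ω} :=
  hΩ.isOpen.preimage (continuous_cons.comp (Continuous.prodMk_left η))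

theorem IsFlowBox.eventually_zero (hΩ : IsFlowBox a Ω) {η : ι → ℝ} (h : cons 0 η ∈ Ω) :
    ∀ᶠ ζ in 𝓝 η, cons 0 ζ ∈ Ω :=
  (continuous_cons.comp (Continuous.prodMk_right (0 : ℝ))).continuousAt.eventually
    (hΩ.isOpen.mem_nhds h)

variable [DecidableEq ι]

/-- The lifted field has no time component, so it differentiates only the slice at fixed time. -/
theorem lie_lift {F : (Option ι → ℝ) → ℝ} {s : ℝ} {η : ι → ℝ}
    (hF : FinAnalyticAt F (cons s η)) (a : ι → (ι → ℝ) → ℝ) :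
    lie (lift a) F (cons s η) = lie a (fun ζ => F (cons s ζ)) η := by
  rw [lie_eq_dir a, dir_comp (Φ := fun ζ => cons s ζ) hF]
  · rw [lie_eq_dir]
    congr 1
    ext o
    cases o with
    | none => simp [lift, dir_const]
    | some v => simp [lift, dir_coord]
  · intro o
    cases o with
    | none => exact finAnalyticAt_const _ _
    | some v => exact finAnalyticAt_coord v η

theorem hasDerivAt_time {F : (Option ι → ℝ) → ℝ} {s : ℝ} {η : ι → ℝ}
    (hF : FinAnalyticAt F (cons s η)) :
    HasDerivAt (fun t => F (cons t η)) (lie dt F (cons s η)) s := by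
  refine FinAnalyticAt.hasDerivAt_comp (c := fun t => cons t η) hF fun o => ?_
  cases o with
  | none => exact hasDerivAt_id s
  | some v => exact hasDerivAt_const _ _

theorem iteratedDeriv_time {F : (Option ι → ℝ) → ℝ} {η : ι → ℝ} {J : Set ℝ} (hJ : IsOpen J)
    (hF : ∀ s ∈ J, FinAnalyticAt F (cons s η)) (k : ℕ) :
    ∀ s ∈ J, iteratedDeriv k (fun t => F (cons t η)) s = (lie dt)^[k] F (cons s η) := by
  induction k with
  | zero => intro s _; simp
  | succ k ih =>
    intro s hs
    rw [iteratedDeriv_succ, Function.iterate_succ_apply']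
    have h1 : iteratedDeriv k (fun t => F (cons t η)) =ᶠ[𝓝 s]
        fun t => (lie dt)^[k] F (cons t η) := by
      filter_upwards [hJ.mem_nhds hs] with t ht using ih t ht
    rw [h1.deriv_eq]
    exact (hasDerivAt_time ((hF s hs).iterate_lie (fun o => finAnalyticAt_dt o _) k)).deriv

/-- The lifted coefficients do not involve time and `dt` has constant coefficients, so all brackets
on coordinates vanish and `lie_comm` applies. -/
theorem lie_dt_lift_comm {F : (Option ι → ℝ) → ℝ} {e : Option ι → ℝ} {a : ι → (ι → ℝ) → ℝ}
    (hF : FinAnalyticAt F e) (ha : ∀ v, FinAnalyticAt (a v) fun v => e (some v)) :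
    lie dt (lie (lift a) F) e = lie (lift a) (lie dt F) e := by
  refine lie_comm hF (fun o => finAnalyticAt_dt o e) (finAnalyticAt_lift ha) fun o => ?_
  have h1 : lie (lift a) (dt o) e = 0 := dir_const _ _ _
  rw [h1]
  cases o with
  | none => exact dir_const _ _ _
  | some v =>
    rw [lie_eq_dir]
    change dir _ (fun e : Option ι → ℝ => a v fun u => e (some u)) e = 0
    rw [dir_comp (Φ := fun (e : Option ι → ℝ) u => e (some u)) (ha v)
      fun u => finAnalyticAt_coord (some u) e]
    have : (fun u : ι => dir (fun o => dt o e) (fun ζ : Option ι → ℝ => ζ (some u)) e) = fun _ => 0 := by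
      ext u
      rw [dir_coord]; rfl
    rw [this]
    simp [dir]

/-- `A` is transported by the flow of `a`: `∂A/∂s = a A`. -/
def Transport (a : ι → (ι → ℝ) → ℝ) (Ω : Set (Option ι → ℝ)) (A : (Option ι → ℝ) → ℝ) : Prop :=
  ∀ e ∈ Ω, FinAnalyticAt A e ∧ lie dt A e = lie (lift a) A e

/-- Functions with the same Taylor expansion in time are equal. -/
theorem IsFlowBox.eqOn_of_iterate (hΩ : IsFlowBox a Ω) (hA : ∀ e ∈ Ω, FinAnalyticAt A e)
    (hB : ∀ e ∈ Ω, FinAnalyticAt B e)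
    (h : ∀ η, cons 0 η ∈ Ω → ∀ k, (lie dt)^[k] A (cons 0 η) = (lie dt)^[k] B (cons 0 η)) :
    EqOn A B Ω := by
  intro e he
  rw [← cons_eta e] at he ⊢
  set s := e none
  set η : ι → ℝ := fun v => e (some v)
  have h0 := hΩ.zero_mem _ _ he
  refine eqOn_of_iteratedDeriv_eq (u := fun t => A (cons t η)) (w := fun t => B (cons t η))
    (hΩ.preconnected η) (t := 0) h0 (fun t ht => (hA _ ht).analyticAt_time)
    (fun t ht => (hB _ ht).analyticAt_time) (fun k => ?_) he
  rw [iteratedDeriv_time (hΩ.isOpen_slice η) (fun t ht => hA _ ht) k 0 h0,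
    iteratedDeriv_time (hΩ.isOpen_slice η) (fun t ht => hB _ ht) k 0 h0, h η h0 k]

theorem Transport.dt (hΩ : IsFlowBox a Ω) (hA : Transport a Ω A) : Transport a Ω (lie dt A) := by
  intro e he
  refine ⟨(hA e he).1.lie fun o => finAnalyticAt_dt o e, ?_⟩
  rw [← lie_dt_lift_comm (hA e he).1 (hΩ.analytic e he)]
  exact lie_congr (EqOn.eventuallyEq_of_mem (fun _ he => (hA _ he).2) (hΩ.isOpen.mem_nhds he)) _

/-- Fields that commute with `a` preserve the transport equation. -/
theorem Transport.lie_lift (hΩ : IsFlowBox a Ω) {b : ι → (ι → ℝ) → ℝ}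
    (hb : ∀ e ∈ Ω, ∀ v, FinAnalyticAt (b v) fun v => e (some v))
    (hab : ∀ e ∈ Ω, ∀ v, lie a (b v) (fun v => e (some v)) = lie b (a v) fun v => e (some v))
    (hA : Transport a Ω A) : Transport a Ω (lie (lift b) A) := by
  intro e he
  refine ⟨(hA e he).1.lie (finAnalyticAt_lift (hb e he)), ?_⟩
  rw [lie_dt_lift_comm (hA e he).1 (hb e he), lie_comm (a := lift a) (b := lift b) (hA e he).1
    (finAnalyticAt_lift (hΩ.analytic e he)) (finAnalyticAt_lift (hb e he))]
  · exact lie_congr (EqOn.eventuallyEq_of_mem (fun _ he => (hA _ he).2) (hΩ.isOpen.mem_nhds he)) _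
  · have key : ∀ a b : ι → (ι → ℝ) → ℝ, (∀ v, FinAnalyticAt (b v) fun v => e (some v)) → ∀ v,
        lie (lift a) (lift b (some v)) e = lie a (b v) fun v => e (some v) := by
      intro a b hb v
      rw [lie_eq_dir]
      change dir _ (fun e : Option ι → ℝ => b v fun u => e (some u)) e = _
      rw [dir_comp (Φ := fun (e : Option ι → ℝ) u => e (some u)) (hb v)
        fun u => finAnalyticAt_coord (some u) e, lie_eq_dir]
      congr 1
      ext u
      rw [dir_coord]; rfl
    intro o
    cases o with
    | none => exact (dir_const _ _ _).trans (dir_const _ _ _).symm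
    | some v => rw [key a b (hb e he), key b a (hΩ.analytic e he), hab e he]

theorem Transport.comp {κ : Type*} [DecidableEq κ] {Φ : (Option ι → ℝ) → κ → ℝ} {F : (κ → ℝ) → ℝ}
    (hΦ : ∀ v, Transport a Ω fun e => Φ e v) (hF : ∀ e ∈ Ω, FinAnalyticAt F (Φ e)) :
    Transport a Ω fun e => F (Φ e) := by
  intro e he
  have h1 := fun v => (hΦ v e he).1
  refine ⟨(hF e he).comp h1, ?_⟩
  rw [lie_eq_dir, lie_eq_dir, dir_comp (hF e he) h1, dir_comp (hF e he) h1]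
  congr 1
  ext v
  exact (hΦ v e he).2

/-- At time `0` one time derivative can be traded for one application of `a`. The trade can be
repeated because the time derivative of a transported function is again transported. -/
theorem Transport.iterate_dt (hΩ : IsFlowBox a Ω) (hA : Transport a Ω A) (k : ℕ) :
    ∀ η, cons 0 η ∈ Ω → (lie DiffietyFlow.dt)^[k] A (cons 0 η) = (lie a)^[k] (fun ζ => A (cons 0 ζ)) η := by
  induction k generalizing A with
  | zero => intro η _; rfl
  | succ k ih =>
    intro η hη
    rw [Function.iterate_succ_apply, Function.iterate_succ_apply, ih (hA.dt hΩ) η hη]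
    refine (iterate_lie_eventuallyEq ?_ a k).self_of_nhds
    filter_upwards [hΩ.eventually_zero hη] with ζ hζ
    rw [(hA _ hζ).2, DiffietyFlow.lie_lift (hA _ hζ).1]

/-- Solutions of the transport equation are determined by their values at time `0`. -/
theorem Transport.eqOn (hΩ : IsFlowBox a Ω) (hA : Transport a Ω A) (hB : Transport a Ω B)
    (h : ∀ η, cons 0 η ∈ Ω → A (cons 0 η) = B (cons 0 η)) : EqOn A B Ω := by
  refine hΩ.eqOn_of_iterate (fun e he => (hA e he).1) (fun e he => (hB e he).1) fun η hη k => ?_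
  rw [hA.iterate_dt hΩ k η hη, hB.iterate_dt hΩ k η hη]
  refine (iterate_lie_eventuallyEq ?_ a k).self_of_nhds
  filter_upwards [hΩ.eventually_zero hη] with ζ hζ using h ζ hζ

/-- A function whose time derivatives at time `0` are the iterates of `a` on its value at time `0`
is transported. -/
theorem transport_of_iterate (hΩ : IsFlowBox a Ω) (hA : ∀ e ∈ Ω, FinAnalyticAt A e)
    (h : ∀ η, cons 0 η ∈ Ω → ∀ k,
      (lie DiffietyFlow.dt)^[k] A (cons 0 η) = (lie a)^[k] (fun ζ => A (cons 0 ζ)) η) :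
    Transport a Ω A := by
  have hdt := fun (e : Option ι → ℝ) (o : Option ι) => finAnalyticAt_dt o e
  have hcomm : ∀ k, EqOn ((lie DiffietyFlow.dt)^[k] (lie (lift a) A))
      (lie (lift a) ((lie DiffietyFlow.dt)^[k] A)) Ω := by
    intro k
    induction k with
    | zero => exact fun _ _ => rfl
    | succ k ih =>
      intro e he
      rw [Function.iterate_succ_apply', Function.iterate_succ_apply',
        ← lie_dt_lift_comm ((hA e he).iterate_lie (hdt e) k) (hΩ.analytic e he)]
      exact lie_congr (ih.eventuallyEq_of_mem (hΩ.isOpen.mem_nhds he)) _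
  -- Both sides are analytic in time, with the same Taylor coefficients at `0`: `dt` commutes with
  -- the lift of `a`, so the `k`-th coefficient is `a^(k+1)` applied to the initial value in either
  -- case.
  have : EqOn (lie DiffietyFlow.dt A) (lie (lift a) A) Ω := by
    refine hΩ.eqOn_of_iterate (fun e he => (hA e he).lie (hdt e))
      (fun e he => (hA e he).lie (finAnalyticAt_lift (hΩ.analytic e he))) fun η hη k => ?_
    rw [← Function.iterate_succ_apply, h η hη, hcomm k hη,
      DiffietyFlow.lie_lift ((hA _ hη).iterate_lie (hdt _) k), Function.iterate_succ_apply']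
    refine lie_congr ?_ _
    filter_upwards [hΩ.eventually_zero hη] with ζ hζ using (h ζ hζ k).symm
  exact fun e he => ⟨hA e he, this he⟩

end Time

end DiffietyFlow

namespace DiffietyFlow

/-! ### Analytic dependence of the flow of a finite-dimensional analytic field. -/

section AnalyticODE

open unitInterval ContDiff

variable {E : Type*} [NormedAddCommGroup E] [NormedSpace ℝ E]

/-- The primitive vanishing at `0` of a curve parametrized by the unit interval. -/
noncomputable def volterra : C(I, E) →L[ℝ] C(I, E) :=
  LinearMap.mkContinuous
    { toFun := fun γ =>
        { toFun := fun t => ∫ u in (0 : ℝ)..t, γ (projIcc 0 1 zero_le_one u)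
          continuous_toFun :=
            (intervalIntegral.continuous_primitive
              (fun a b => (γ.continuous.comp continuous_projIcc).intervalIntegrable a b) 0).comp
              continuous_subtype_val }
      map_add' := fun γ γ' => by
        ext t
        exact intervalIntegral.integral_add
          ((γ.continuous.comp continuous_projIcc).intervalIntegrable _ _)
          ((γ'.continuous.comp continuous_projIcc).intervalIntegrable _ _)
      map_smul' := fun r γ => by
        ext t
        exact intervalIntegral.integral_smul _ _ } 1 fun γ => by
    rw [one_mul]
    refine (ContinuousMap.norm_le _ (norm_nonneg _)).2 fun t => ?_
    refine (intervalIntegral.norm_integral_le_of_norm_le_const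
      (C := ‖γ‖) fun u _ => γ.norm_coe_le_norm _).trans ?_
    have := t.2
    rw [sub_zero, abs_of_nonneg this.1]
    exact mul_le_of_le_one_right (norm_nonneg _) this.2

theorem volterra_apply (γ : C(I, E)) (t : I) :
    volterra γ t = ∫ u in (0 : ℝ)..t, γ (projIcc 0 1 zero_le_one u) := rfl

/-- The power series of the superposition operator `γ ↦ Φ ∘ γ`. -/
noncomputable def superpositionSeries (P : FormalMultilinearSeries ℝ E E) :
    FormalMultilinearSeries ℝ C(I, E) C(I, E) := fun n =>
  MultilinearMap.mkContinuous
    { toFun := fun m =>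
        { toFun := fun t => P n fun i => m i t
          continuous_toFun := (P n).cont.comp (continuous_pi fun i => (m i).continuous) }
      map_update_add' := by
        intro hd m i x y
        ext t
        have : ∀ z : C(I, E), (fun j => Function.update m i z j t) =
            Function.update (fun j => m j t) i (z t) := by
          intro z; ext j
          by_cases h : j = i
          · subst h; simp
          · simp [h]
        simp [this]
      map_update_smul' := by
        intro hd m i c x
        ext t
        have : ∀ z : C(I, E), (fun j => Function.update m i z j t) =
            Function.update (fun j => m j t) i (z t) := by
          intro z; ext j
          by_cases h : j = i
          · subst h; simp
          · simp [h]
        simp [this] } ‖P n‖ fun m => by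
    refine (ContinuousMap.norm_le _ (by positivity)).2 fun t => ?_
    refine ((P n).le_opNorm _).trans ?_
    gcongr with i
    exact (m i).norm_coe_le_norm t

theorem norm_superpositionSeries_le (P : FormalMultilinearSeries ℝ E E) (n : ℕ) :
    ‖superpositionSeries P n‖ ≤ ‖P n‖ :=
  MultilinearMap.mkContinuous_norm_le _ (norm_nonneg _) _

/-- The coefficients act pointwise in the supremum norm, so their norms do not grow. -/
theorem radius_le_superpositionSeries (P : FormalMultilinearSeries ℝ E E) :
    P.radius ≤ (superpositionSeries P).radius := by
  refine ENNReal.le_of_forall_nnreal_lt fun r hr => ?_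
  obtain ⟨C, _, hC⟩ := P.norm_mul_pow_le_of_lt_radius hr
  refine FormalMultilinearSeries.le_radius_of_bound _ C fun n => le_trans ?_ (hC n)
  gcongr
  exact norm_superpositionSeries_le P n

/-- The superposition operator of an analytic function is analytic. -/
theorem exists_superposition [CompleteSpace E] {Φ : E → E} {p : E} (hΦ : AnalyticAt ℝ Φ p) :
    ∃ N : C(I, E) → C(I, E), AnalyticAt ℝ N (ContinuousMap.const I p) ∧
      ∀ᶠ γ in 𝓝 (ContinuousMap.const I p), ∀ t, N γ t = Φ (γ t) := by
  obtain ⟨P, r, hP⟩ := hΦ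
  set Q := superpositionSeries P
  have hr : r ≤ Q.radius := hP.r_le.trans (radius_le_superpositionSeries P)
  have hQ : HasFPowerSeriesOnBall Q.sum Q 0 Q.radius :=
    Q.hasFPowerSeriesOnBall (hP.r_pos.trans_le hr)
  refine ⟨fun γ => Q.sum (γ - ContinuousMap.const I p), ?_, ?_⟩
  · refine AnalyticAt.fun_comp (g := Q.sum) ?_ (analyticAt_id.sub analyticAt_const)
    simpa using hQ.analyticAt
  · filter_upwards [Metric.eball_mem_nhds _ hP.r_pos] with γ hγ t
    have hγ' : γ - ContinuousMap.const I p ∈ Metric.eball 0 r := by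
      simpa [edist_eq_enorm_sub] using hγ
    have h1 := hQ.hasSum (Metric.eball_subset_eball hr hγ')
    rw [zero_add] at h1
    -- Evaluation at `t` is linear and continuous, so it turns the series on curves into the series
    -- of `Φ` at `γ t - p`.
    have h2 := (ContinuousMap.evalCLM ℝ t).hasSum h1
    have h3 : γ t - p ∈ Metric.eball (0 : E) r := by
      rw [Metric.mem_eball, edist_zero_right] at hγ' ⊢
      refine lt_of_le_of_lt ?_ hγ'
      rw [enorm_le_iff_norm_le]
      exact (γ - ContinuousMap.const I p).norm_coe_le_norm t
    have h4 := hP.hasSum h3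
    rw [add_sub_cancel] at h4
    exact h2.unique h4

/-- The local flow of an analytic vector field is analytic. -/
theorem exists_analytic_flow [CompleteSpace E] {Φ : E → E} {p : E} (hΦ : AnalyticAt ℝ Φ p) :
    ∃ Γ : ℝ × E → E, AnalyticAt ℝ Γ (0, p) ∧ ∀ᶠ x in 𝓝 ((0 : ℝ), p),
      Γ (0, x.2) = x.2 ∧ HasDerivAt (fun s => Γ (s, x.2)) (Φ (Γ x)) x.1 := by
  obtain ⟨N, hN, hNΦ⟩ := exists_superposition hΦ
  obtain ⟨ε, hε, a, r, L, K, hr, hPL⟩ :=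
    IsPicardLindelof.of_contDiffAt_one (hΦ.contDiffAt (n := 1))
  obtain ⟨α, hα, hαc⟩ := (hPL 0).exists_forall_mem_closedBall_eq_hasDerivWithinAt_continuousOn
  simp only [zero_sub, zero_add] at hα hαc
  have hαd : ∀ x ∈ Metric.closedBall p r, ∀ t ∈ Ioo (-ε) ε,
      HasDerivAt (fun t => α (x, t)) (Φ (α (x, t))) t := fun x hx t ht =>
    ((hα x hx).2 t (Ioo_subset_Icc_self ht)).hasDerivAt (Icc_mem_nhds ht.1 ht.2)
  -- The integral equation.
  let f : (ℝ × E) × C(I, E) → C(I, E) := fun v =>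
    v.2 - ContinuousMap.const I v.1.2 - v.1.1 • volterra (N v.2)
  let c : E →L[ℝ] C(I, E) := ContinuousLinearMap.const ℝ I
  have hc : ∀ x, c x = ContinuousMap.const I x := fun _ => rfl
  let u : (ℝ × E) × C(I, E) := ((0, p), ContinuousMap.const I p)
  have hf : AnalyticAt ℝ f u := by
    have h1 : AnalyticAt ℝ (fun v : (ℝ × E) × C(I, E) => N v.2) u :=
      AnalyticAt.fun_comp (g := N) hN analyticAt_snd
    have h2 : AnalyticAt ℝ (fun v : (ℝ × E) × C(I, E) => volterra (N v.2)) u :=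
      AnalyticAt.fun_comp (g := volterra) ((volterra (E := E)).analyticAt _) h1
    have h3 : AnalyticAt ℝ (fun v : (ℝ × E) × C(I, E) => c v.1.2) u :=
      AnalyticAt.fun_comp (g := c) (c.analyticAt _) (analyticAt_snd.fun_comp analyticAt_fst)
    exact (analyticAt_snd.sub h3).sub ((analyticAt_fst.fun_comp analyticAt_fst).smul h2)
  have hfω : ContDiffAt ℝ ω f u := hf.contDiffAt
  have hfu : f u = 0 := by simp [f, u]
  -- At `s = 0` the integral term vanishes, so the partial derivative in the curve variable is the
  -- identity. This makes the implicit function theorem applicable.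
  have hinv : (fderiv ℝ f u ∘L .inr ℝ (ℝ × E) C(I, E)).IsInvertible := by
    have : fderiv ℝ f u ∘L .inr ℝ (ℝ × E) C(I, E) = ContinuousLinearMap.id ℝ _ := by
      have h1 : HasFDerivAt (fun γ : C(I, E) => f ((0, p), γ))
          (fderiv ℝ f u ∘L .inr ℝ (ℝ × E) C(I, E)) (ContinuousMap.const I p) :=
        HasFDerivAt.comp (g := f) (ContinuousMap.const I p) hf.differentiableAt.hasFDerivAt
          (hasFDerivAt_prodMk_right _ _)
      have h2 : HasFDerivAt (fun γ : C(I, E) => f ((0, p), γ))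
          (ContinuousLinearMap.id ℝ _) (ContinuousMap.const I p) := by
        simpa [f] using (hasFDerivAt_id (𝕜 := ℝ) (ContinuousMap.const I p)).sub_const
          (ContinuousMap.const I p)
      exact h1.unique h2
    rw [this]
    exact ⟨ContinuousLinearEquiv.refl ℝ _, rfl⟩
  have hψ := hfω.contDiffAt_implicitFunction (by simp) hinv
  have hiff := hfω.eventually_apply_eq_iff_implicitFunction (by simp) hinv
  set ψ := hfω.implicitFunction (by simp) hinv
  -- The flow gives the solutions of the integral equation.
  obtain ⟨ρ, hρ, hρ'⟩ := Metric.eventually_nhds_iff_ball.1 hiff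
  obtain ⟨ρN, hρN, hρN'⟩ := Metric.eventually_nhds_iff_ball.1 hNΦ
  have hαp : α (p, 0) = p := (hα p (Metric.mem_closedBall_self r.2)).1
  have hcont : ContinuousAt α (p, 0) :=
    hαc.continuousAt (prod_mem_nhds (Metric.closedBall_mem_nhds _ hr)
      (Icc_mem_nhds (by linarith) (by linarith)))
  -- A pointwise strict bound gives only a weak bound on the supremum; the half keeps the distance
  -- between curves strictly below `min ρ ρN`.
  obtain ⟨ρc, hρc, hρc'⟩ := Metric.eventually_nhds_iff_ball.1
    (hcont.eventually (Metric.ball_mem_nhds _ (half_pos (lt_min hρ hρN))))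
  rw [hαp] at hρc'
  have hsmall : ∀ᶠ x in 𝓝 ((0 : ℝ), p), |x.1| < ε ∧ |x.1| < ρc ∧ |x.1| < ρ ∧
      dist x.2 p < r ∧ dist x.2 p < ρc ∧ dist x.2 p < ρ := by
    have h1 : Tendsto (fun x : ℝ × E => |x.1|) (𝓝 (0, p)) (𝓝 0) := by
      have := (continuous_fst (X := ℝ) (Y := E)).abs.tendsto (0, p)
      simpa using this
    have h2 : Tendsto (fun x : ℝ × E => dist x.2 p) (𝓝 (0, p)) (𝓝 0) := by
      have := ((continuous_snd (X := ℝ) (Y := E)).dist (continuous_const (y := p))).tendsto (0, p)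
      simpa using this
    filter_upwards [h1.eventually (gt_mem_nhds hε), h1.eventually (gt_mem_nhds hρc),
      h1.eventually (gt_mem_nhds hρ), h2.eventually (gt_mem_nhds (show (0 : ℝ) < r from hr)),
      h2.eventually (gt_mem_nhds hρc), h2.eventually (gt_mem_nhds hρ)] with x a b c d e f
    exact ⟨a, b, c, d, e, f⟩
  -- Rescaled to the unit interval, the solution `γ t = α (y, s * t)` satisfies `γ = y + s ∫ Φ(γ)`,
  -- with the time `s` now a parameter. Near the constant curve it must be the implicit function,
  -- and its value at `1` is `α (y, s)`. Analyticity in `(s, y)` follows.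
  have hψα : ∀ᶠ x in 𝓝 ((0 : ℝ), p), ψ x 1 = α (x.2, x.1) := by
    filter_upwards [hsmall] with x ⟨h1, h2, h3, h4, h5, h6⟩
    obtain ⟨s, y⟩ := x
    simp only at h1 h2 h3 h4 h5 h6 ⊢
    have hst : ∀ t ∈ Icc (0 : ℝ) 1, |s * t| ≤ |s| := fun t ht => by
      rw [abs_mul, abs_of_nonneg ht.1]
      exact mul_le_of_le_one_right (abs_nonneg _) ht.2
    have hyr : y ∈ Metric.closedBall p r := h4.le
    have hd : ∀ t ∈ Icc (0 : ℝ) 1, HasDerivAt (fun t => α (y, s * t)) (s • Φ (α (y, s * t))) t := by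
      intro t ht
      have := hαd y hyr (s * t) (abs_lt.1 ((hst t ht).trans_lt h1))
      simpa [Function.comp_def] using
        HasDerivAt.scomp (h := fun t => s * t) t this ((hasDerivAt_id t).const_mul s)
    let γ : C(I, E) :=
      { toFun := fun t => α (y, s * t)
        continuous_toFun := by
          have : ContinuousOn (fun t : ℝ => α (y, s * t)) (Icc 0 1) :=
            fun t ht => (hd t ht).continuousAt.continuousWithinAt
          exact this.domRestrict }
    have hγ : dist γ (ContinuousMap.const I p) < min ρ ρN := by
      refine lt_of_le_of_lt ?_ (half_lt_self (lt_min hρ hρN))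
      refine (ContinuousMap.dist_le (half_pos (lt_min hρ hρN)).le).2 fun t => ?_
      refine le_of_lt (hρc' (y, s * t) ?_)
      rw [Metric.mem_ball, Prod.dist_eq]
      refine max_lt h5 ?_
      rw [Real.dist_eq, sub_zero]
      exact (hst t t.2).trans_lt h2
    have hNγ := hρN' γ (hγ.trans_le (min_le_right _ _))
    have hfγ : f ((s, y), γ) = f u := by
      rw [hfu]
      ext t
      have hint : ∫ w in (0 : ℝ)..t, s • N γ (projIcc 0 1 zero_le_one w) =
          α (y, s * t) - α (y, s * 0) := by
        have ht := t.2
        have hsub : uIcc (0 : ℝ) t ⊆ Icc 0 1 := by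
          rw [uIcc_of_le ht.1]; exact Icc_subset_Icc_right ht.2
        refine intervalIntegral.integral_eq_sub_of_hasDerivAt (f := fun w => α (y, s * w))
          (f' := fun w => s • N γ (projIcc 0 1 zero_le_one w)) (fun w hw => ?_)
          (((N γ).continuous.comp continuous_projIcc).const_smul s |>.intervalIntegrable _ _)
        have := hd w (hsub hw)
        rwa [hNγ, projIcc_of_mem _ (hsub hw)]
      rw [intervalIntegral.integral_smul, mul_zero, (hα y hyr).1] at hint
      change α (y, s * t) - y - s • volterra (N γ) t = 0
      rw [volterra_apply, hint, sub_self]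
    have := (hρ' ((s, y), γ) ?_).1 hfγ
    · have h7 : ψ (s, y) = γ := this
      rw [h7]
      change α (y, s * (1 : ℝ)) = _
      rw [mul_one]
    · rw [Metric.mem_ball, Prod.dist_eq, Prod.dist_eq]
      refine max_lt (max_lt ?_ h6) (hγ.trans_le (min_le_left _ _))
      simpa [u, Real.dist_eq] using h3
  refine ⟨fun x => α (x.2, x.1), ?_, ?_⟩
  · have : AnalyticAt ℝ (fun x => ψ x 1) (0, p) :=
      AnalyticAt.fun_comp (g := ContinuousMap.evalCLM (M := E) ℝ (1 : I))
        ((ContinuousMap.evalCLM (M := E) ℝ (1 : I)).analyticAt _) hψ.analyticAt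
    exact this.congr hψα
  · filter_upwards [hsmall] with x ⟨h1, _, _, h4, _⟩
    exact ⟨(hα x.2 h4.le).1, hαd x.2 h4.le x.1 (abs_lt.1 h1)⟩

end AnalyticODE

end DiffietyFlow

namespace DiffietyFlow

/-! ### Iterates of related and of lifted fields. -/

section Related

variable {ι κ : Type*} [DecidableEq ι] [DecidableEq κ]

/-- Iterates of fields `a`, `b` related by a map `Ψ`. -/
theorem iterate_lie_comp_of_related {a : ι → (ι → ℝ) → ℝ} {b : κ → (κ → ℝ) → ℝ}
    {Ψ : (ι → ℝ) → κ → ℝ} {W : Set (ι → ℝ)} {D : Set (κ → ℝ)} (hW : IsOpen W) (hWD : MapsTo Ψ W D)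
    (hb : ∀ y ∈ D, ∀ p, FinAnalyticAt (b p) y)
    (hΨ : ∀ η ∈ W, ∀ p, FinAnalyticAt (fun ζ => Ψ ζ p) η)
    (hab : ∀ η ∈ W, ∀ p, lie a (fun ζ => Ψ ζ p) η = b p (Ψ η)) {P : (κ → ℝ) → ℝ}
    (hP : ∀ y ∈ D, FinAnalyticAt P y) (k : ℕ) :
    EqOn ((lie a)^[k] fun ζ => P (Ψ ζ)) (fun ζ => (lie b)^[k] P (Ψ ζ)) W := by
  induction k generalizing P with
  | zero => exact fun _ _ => rfl
  | succ k ih =>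
    intro η hη
    rw [Function.iterate_succ_apply]
    have h1 : lie a (fun ζ => P (Ψ ζ)) =ᶠ[𝓝 η] fun ζ => lie b P (Ψ ζ) := by
      filter_upwards [hW.mem_nhds hη] with ζ hζ
      rw [lie_eq_dir, dir_comp (hP _ (hWD hζ)) (hΨ ζ hζ), lie_eq_dir]
      congr 1
      ext p
      exact hab ζ hζ p
    rw [(iterate_lie_eventuallyEq h1 a k).self_of_nhds,
      ih (fun y hy => (hP y hy).lie (hb y hy)) hη, Function.iterate_succ_apply]

theorem iterate_lie_lift {a : ι → (ι → ℝ) → ℝ} {A : (Option ι → ℝ) → ℝ} {Ω : Set (Option ι → ℝ)}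
    (hΩ : IsOpen Ω) (ha : ∀ e ∈ Ω, ∀ v, FinAnalyticAt (a v) fun v => e (some v))
    (hA : ∀ e ∈ Ω, FinAnalyticAt A e) (k : ℕ) {s : ℝ} {η : ι → ℝ} (he : cons s η ∈ Ω) :
    (lie (lift a))^[k] A (cons s η) = (lie a)^[k] (fun ζ => A (cons s ζ)) η := by
  induction k generalizing A with
  | zero => rfl
  | succ k ih =>
    rw [Function.iterate_succ_apply, ih fun e he => (hA e he).lie (finAnalyticAt_lift (ha e he)),
      Function.iterate_succ_apply]
    refine (iterate_lie_eventuallyEq ?_ a k).self_of_nhds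
    filter_upwards [(continuous_cons.comp (Continuous.prodMk_right s)).continuousAt.eventually
      (hΩ.mem_nhds he)] with ζ hζ using lie_lift (hA _ hζ) a

end Related

/-! ### Boxes in the product of time and space. -/

section Box

variable {ι : Type*}

/-- The product of a symmetric interval and a set of positions. -/
def box (ε : ℝ) (N : Set (ι → ℝ)) : Set (Option ι → ℝ) :=
  {e | |e none| < ε ∧ (fun v => e (some v)) ∈ N}

theorem cons_mem_box {ε : ℝ} {N : Set (ι → ℝ)} {s : ℝ} {η : ι → ℝ} :
    cons s η ∈ box ε N ↔ |s| < ε ∧ η ∈ N := Iff.rfl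

theorem isFlowBox_box {ε : ℝ} {N : Set (ι → ℝ)} {a : ι → (ι → ℝ) → ℝ} (hN : IsOpen N)
    (ha : ∀ η ∈ N, ∀ v, FinAnalyticAt (a v) η) : IsFlowBox a (box ε N) where
  isOpen := (isOpen_lt (continuous_apply none).abs continuous_const).inter
    (hN.preimage continuous_tail)
  analytic e he := ha _ he.2
  preconnected η := by
    by_cases hη : η ∈ N
    · have : {s | cons s η ∈ box ε N} = Ioo (-ε) ε := by
        ext s; simp [cons_mem_box, hη, abs_lt]
      rw [this]; exact isPreconnected_Ioo
    · have : {s | cons s η ∈ box ε N} = ∅ := by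
        ext s; simp [cons_mem_box, hη]
      rw [this]; exact isPreconnected_empty
  zero_mem s η h := ⟨by simpa using (abs_nonneg s).trans_lt h.1, h.2⟩

/-- Neighbourhoods of `(0, η)` contain boxes. -/
theorem exists_box_subset {Ω : Set (Option ι → ℝ)} {η : ι → ℝ} (h : Ω ∈ 𝓝 (cons 0 η)) :
    ∃ ε > 0, ∃ N, IsOpen N ∧ η ∈ N ∧ box ε N ⊆ Ω := by
  have h1 : ∀ᶠ p in 𝓝 ((0 : ℝ), η), cons p.1 p.2 ∈ Ω :=
    continuous_cons.continuousAt.eventually h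
  rw [nhds_prod_eq] at h1
  obtain ⟨A, hA, B, hB, hAB⟩ := Filter.eventually_prod_iff.1 h1
  obtain ⟨ε, hε, hεA⟩ := Metric.eventually_nhds_iff_ball.1 hA
  obtain ⟨N, hN, hNo, hηN⟩ := eventually_nhds_iff.1 hB
  refine ⟨ε, hε, N, hNo, hηN, fun e he => ?_⟩
  rw [← cons_eta e]
  exact hAB (hεA _ (by simpa [Real.dist_eq] using he.1)) (hN _ he.2)

end Box

/-! ### The local flow of a symmetry, built from the reduced system. -/

section Symmetry

variable {m q : ℕ}

theorem lieD_eq_lie (a : VectorField m q) (F : Space m q → ℝ) : lieD a F = lie a F := rfl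

theorem iter_eq (δ : VectorField m q) (z : Var m q) (k : ℕ) :
    iter δ z k = (lie δ)^[k] fun η => η (varCoord z) := rfl

theorem IsAnalyticFun.finAnalyticAt {W : Set (Space m q)} {F : Space m q → ℝ}
    (hF : IsAnalyticFun W F) (hW : IsOpen W) {η : Space m q} (hη : η ∈ W) : FinAnalyticAt F η := by
  obtain ⟨S, h, hh, hFh⟩ := hF
  exact ⟨S, h, hh _ ⟨η, hη, rfl⟩, EqOn.eventuallyEq_of_mem hFh (hW.mem_nhds hη)⟩

theorem isAnalyticFun_coord (W : Set (Space m q)) (v : Coord m q) :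
    IsAnalyticFun W fun η => η v :=
  ⟨{v}, fun p => p ⟨v, by simp⟩, fun _ _ =>
    (ContinuousLinearMap.proj (R := ℝ) (φ := fun _ : ({v} : Finset (Coord m q)) => ℝ)
      ⟨v, by simp⟩).analyticAt _, fun _ _ => rfl⟩

theorem lie_coord {ι : Type*} [DecidableEq ι] (a : ι → (ι → ℝ) → ℝ) (v : ι) :
    lie a (fun ζ => ζ v) = a v :=
  funext fun η => dir_coord _ v η

theorem Diffiety.cartan_finAnalyticAt (X : Diffiety m q) {η : Space m q} (hη : η ∈ X.carrier)
    (v : Coord m q) : FinAnalyticAt (X.cartan v) η := by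
  cases v with
  | inl p => exact finAnalyticAt_coord _ _
  | inr j => exact (X.f_analytic j).finAnalyticAt X.isOpen_carrier hη

theorem Diffiety.iterate_cartan (X : Diffiety m q) (i : Fin m) (k : ℕ) :
    (lie X.cartan)^[k] (fun η => η (Sum.inl (i, 0))) = fun η => η (Sum.inl (i, k)) := by
  induction k with
  | zero => rfl
  | succ k ih =>
    rw [Function.iterate_succ_apply', ih, lie_coord]; rfl

variable {X : Diffiety m q} {δ : VectorField m q}

theorem Diffiety.IsSymmetry.finAnalyticAt (h : X.IsSymmetry δ) {η : Space m q}
    (hη : η ∈ X.carrier) (v : Coord m q) : FinAnalyticAt (δ v) η :=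
  (h.1 v).finAnalyticAt X.isOpen_carrier hη

theorem Diffiety.IsSymmetry.comm (h : X.IsSymmetry δ) {η : Space m q}
    (hη : η ∈ X.carrier) (v : Coord m q) : lie δ (X.cartan v) η = lie X.cartan (δ v) η := by
  have := h.2 _ (isAnalyticFun_coord X.carrier v) η hη
  simp only [lieD_eq_lie, lie_coord] at this
  exact this

theorem iterTuple_finAnalyticAt (h : X.IsSymmetry δ) (r : Var m q → ℕ) {η : Space m q}
    (hη : η ∈ X.carrier) (p : Σ z : Var m q, Fin (r z)) :
    FinAnalyticAt (fun ζ => iterTuple δ r ζ p) η :=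
  (finAnalyticAt_coord _ η).iterate_lie (fun v => h.finAnalyticAt hη v) _

/-- The vector field of the reduced system. -/
def reducedField (r : Var m q → ℕ) (φ : Var m q → ((Σ z : Var m q, Fin (r z)) → ℝ) → ℝ)
    (p : Σ z : Var m q, Fin (r z)) (y : (Σ z : Var m q, Fin (r z)) → ℝ) : ℝ :=
  if h : (p.2 : ℕ) + 1 < r p.1 then y ⟨p.1, ⟨p.2 + 1, h⟩⟩ else φ p.1 y

/-- The expression of the unknown `z` in terms of the variables of the reduced system. -/
def reducedVar (r : Var m q → ℕ) (φ : Var m q → ((Σ z : Var m q, Fin (r z)) → ℝ) → ℝ)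
    (z : Var m q) (y : (Σ z : Var m q, Fin (r z)) → ℝ) : ℝ :=
  if h : 0 < r z then y ⟨z, ⟨0, h⟩⟩ else φ z y

variable {r : Var m q → ℕ} {φ : Var m q → ((Σ z : Var m q, Fin (r z)) → ℝ) → ℝ}

theorem analyticAt_reducedField {y : (Σ z : Var m q, Fin (r z)) → ℝ}
    (hφ : ∀ z, AnalyticAt ℝ (φ z) y) (p : Σ z : Var m q, Fin (r z)) :
    AnalyticAt ℝ (reducedField r φ p) y := by
  by_cases h : (p.2 : ℕ) + 1 < r p.1
  · have : reducedField r φ p = fun y => y ⟨p.1, ⟨p.2 + 1, h⟩⟩ := by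
      ext y; simp [reducedField, h]
    rw [this]
    exact (finAnalyticAt_coord _ _).analyticAt
  · have : reducedField r φ p = φ p.1 := by
      ext y; simp [reducedField, h]
    rw [this]
    exact hφ _

theorem analyticAt_reducedVar {y : (Σ z : Var m q, Fin (r z)) → ℝ}
    (hφ : ∀ z, AnalyticAt ℝ (φ z) y) (z : Var m q) : AnalyticAt ℝ (reducedVar r φ z) y := by
  by_cases h : 0 < r z
  · have : reducedVar r φ z = fun y => y ⟨z, ⟨0, h⟩⟩ := by
      ext y; simp [reducedVar, h]
    rw [this]
    exact (finAnalyticAt_coord _ _).analyticAt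
  · have : reducedVar r φ z = φ z := by
      ext y; simp [reducedVar, h]
    rw [this]
    exact hφ _

/-- Applying `δ` raises the exponent by one. Only at `k = r z - 1` does this leave the tuple, and
there the reduction relation closes the system. -/
theorem lie_iterTuple {η : Space m q}
    (hη : ∀ z, iter δ z (r z) η = φ z (iterTuple δ r η)) (p : Σ z : Var m q, Fin (r z)) :
    lie δ (fun ζ => iterTuple δ r ζ p) η = reducedField r φ p (iterTuple δ r η) := by
  have h1 : lie δ (fun ζ => iterTuple δ r ζ p) η = iter δ p.1 (p.2 + 1) η := by
    rw [iter_eq, Function.iterate_succ_apply']; rfl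
  rw [h1, reducedField]
  split_ifs with h
  · rfl
  · have : (p.2 : ℕ) + 1 = r p.1 := by have := p.2.2; omega
    rw [this, hη]

/-- When `r z = 0` the unknown `z` is not among the variables, but the reduction relation itself
then reads `z = φ_z(Y)`. -/
theorem reducedVar_iterTuple {η : Space m q}
    (hη : ∀ z, iter δ z (r z) η = φ z (iterTuple δ r η)) (z : Var m q) :
    reducedVar r φ z (iterTuple δ r η) = η (varCoord z) := by
  rw [reducedVar]
  split_ifs with h
  · rfl
  · rw [← hη, show r z = 0 by omega]; rfl

/-- The transport by the flow of the unknowns, near a point where the iterates of the symmetry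
satisfy a reduced system. -/
theorem exists_transport_var (h : X.IsSymmetry δ) {η₀ : Space m q} (hη₀ : η₀ ∈ X.carrier)
    (hφ : IsReduction δ r η₀ φ) :
    ∃ ε > 0, ∃ N ⊆ X.carrier, IsOpen N ∧ η₀ ∈ N ∧
      ∃ H : Var m q → (Option (Coord m q) → ℝ) → ℝ, ∀ z, Transport δ (box ε N) (H z) ∧
        ∀ η ∈ N, H z (cons 0 η) = η (varCoord z) := by
  classical
  have hφa : ∀ z, AnalyticAt ℝ (φ z) (iterTuple δ r η₀) := fun z => (hφ z).1
  set y₀ := iterTuple δ r η₀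
  obtain ⟨Γ, hΓ, hΓ'⟩ := exists_analytic_flow
    (Φ := fun y p => reducedField r φ p y) (AnalyticAt.pi fun p => analyticAt_reducedField hφa p)
  have hΓ0 : Γ (0, y₀) = y₀ := hΓ'.self_of_nhds.1
  have hD : ∀ᶠ y in 𝓝 y₀, ∀ z, AnalyticAt ℝ (φ z) y :=
    eventually_all.2 fun z => (hφa z).eventually_analyticAt
  have hgood : ∀ᶠ x in 𝓝 ((0 : ℝ), y₀), AnalyticAt ℝ Γ x ∧ (∀ z, AnalyticAt ℝ (φ z) x.2) ∧
      (∀ z, AnalyticAt ℝ (φ z) (Γ x)) ∧ Γ (0, x.2) = x.2 ∧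
      HasDerivAt (fun s => Γ (s, x.2)) (fun p => reducedField r φ p (Γ x)) x.1 := by
    have h1 : Tendsto Γ (𝓝 (0, y₀)) (𝓝 y₀) := by
      have := hΓ.continuousAt.tendsto
      rwa [hΓ0] at this
    filter_upwards [hΓ.eventually_analyticAt, hΓ', h1.eventually hD,
      (continuous_snd (X := ℝ)).continuousAt.eventually hD] with x a b c d
    exact ⟨a, d, c, b⟩
  rw [nhds_prod_eq] at hgood
  obtain ⟨A, hA, B, hB, hAB⟩ := Filter.eventually_prod_iff.1 hgood
  obtain ⟨ε, hε, hεA⟩ := Metric.eventually_nhds_iff_ball.1 hA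
  have hY : ContinuousAt (iterTuple δ r) η₀ :=
    continuousAt_pi.2 fun p => (iterTuple_finAnalyticAt h r hη₀ p).continuousAt
  have hN : ∀ᶠ ζ in 𝓝 η₀, ζ ∈ X.carrier ∧ B (iterTuple δ r ζ) ∧
      ∀ z, iter δ z (r z) ζ = φ z (iterTuple δ r ζ) := by
    filter_upwards [X.isOpen_carrier.mem_nhds hη₀, hY.eventually hB,
      eventually_all.2 fun z => (hφ z).2] with ζ a b c
    exact ⟨a, b, c⟩
  obtain ⟨N, hNp, hNo, hηN⟩ := eventually_nhds_iff.1 hN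
  have hgood' : ∀ e ∈ box ε N, _ := fun e (he : e ∈ box ε N) =>
    hAB (x := e none) (hεA _ (by simpa [Real.dist_eq] using he.1)) (hNp _ he.2).2.1
  have hbox : IsFlowBox δ (box ε N) :=
    isFlowBox_box hNo fun η hη v => h.finAnalyticAt (hNp η hη).1 v
  -- The flow of the reduced system, as a function of time and position.
  let R : (Option (Coord m q) → ℝ) → (Σ z : Var m q, Fin (r z)) → ℝ :=
    fun e => Γ (e none, iterTuple δ r fun v => e (some v))
  have hR : ∀ e ∈ box ε N, ∀ p, FinAnalyticAt (fun e => R e p) e := by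
    intro e he p
    let L : (Option (Σ z : Var m q, Fin (r z)) → ℝ) →L[ℝ] ℝ × ((Σ z : Var m q, Fin (r z)) → ℝ) :=
      (ContinuousLinearMap.proj none).prod
        (ContinuousLinearMap.pi fun p => ContinuousLinearMap.proj (some p))
    let T : (Option (Coord m q) → ℝ) → Option (Σ z : Var m q, Fin (r z)) → ℝ :=
      fun e => cons (e none) (iterTuple δ r fun v => e (some v))
    have h1 : AnalyticAt ℝ (fun t => Γ (L t) p) (T e) := by
      have h2 : AnalyticAt ℝ Γ (L (T e)) := (hgood' e he).1
      have h3 := AnalyticAt.fun_comp (g := Γ) (f := L) h2 (L.analyticAt _)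
      exact AnalyticAt.fun_comp
        (g := ContinuousLinearMap.proj (R := ℝ) (φ := fun _ : Σ z : Var m q, Fin (r z) => ℝ) p)
        ((ContinuousLinearMap.proj (R := ℝ)
          (φ := fun _ : Σ z : Var m q, Fin (r z) => ℝ) p).analyticAt _) h3
    refine FinAnalyticAt.comp (F := fun t => Γ (L t) p) (Φ := T) (finAnalyticAt_of_analyticAt h1)
      fun o => ?_
    cases o with
    | none => exact finAnalyticAt_coord none e
    | some p => exact (iterTuple_finAnalyticAt h r (hNp _ he.2).1 p).tail
  let D : Set ((Σ z : Var m q, Fin (r z)) → ℝ) := {y | ∀ z, AnalyticAt ℝ (φ z) y}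
  have hDf : ∀ y ∈ D, ∀ p, FinAnalyticAt (reducedField r φ p) y := fun y hy p =>
    finAnalyticAt_of_analyticAt (analyticAt_reducedField hy p)
  have hDv : ∀ z, ∀ y ∈ D, FinAnalyticAt (reducedVar r φ z) y := fun z y hy =>
    finAnalyticAt_of_analyticAt (analyticAt_reducedVar hy z)
  have hRdt : ∀ e ∈ box ε N, ∀ p, lie dt (fun e => R e p) e = reducedField r φ p (R e) := by
    intro e he p
    have h1 := hR e he p
    have h2 := (hasDerivAt_pi.1 (hgood' e he).2.2.2.2) p
    rw [← cons_eta e] at h1 ⊢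
    exact (hasDerivAt_time h1).unique h2
  have hR0 : ∀ η ∈ N, R (cons 0 η) = iterTuple δ r η := fun η hη =>
    (hgood' (cons 0 η) ⟨by simpa using hε, hη⟩).2.2.2.1
  have hYD : MapsTo (iterTuple δ r) N D := fun η hη =>
    (hgood' (cons 0 η) ⟨by simpa using hε, hη⟩).2.1
  have hRA : ∀ z, ∀ e ∈ box ε N, FinAnalyticAt (fun e => reducedVar r φ z (R e)) e :=
    fun z e he => (hDv z _ (hgood' e he).2.2.1).comp (hR e he)
  refine ⟨ε, hε, N, fun ζ hζ => (hNp ζ hζ).1, hNo, hηN, fun z e => reducedVar r φ z (R e),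
    fun z => ⟨transport_of_iterate hbox (hRA z) fun η hη k => ?_, fun η hη => ?_⟩⟩
  -- In time, `R` intertwines `dt` with the reduced field; in position, so does `Y` with `δ`. At
  -- time `0` both `k`-th iterates become the `k`-th iterate of the reduced field on `reducedVar`,
  -- evaluated at `Y η`.
  · rw [iterate_lie_comp_of_related (D := D) hbox.isOpen (fun e he => (hgood' e he).2.2.1) hDf hR
      hRdt (hDv z) k hη]
    change (lie (reducedField r φ))^[k] (reducedVar r φ z) (R (cons 0 η)) = _
    rw [hR0 η hη.2]
    refine (iterate_lie_comp_of_related (a := δ) hNo hYD hDf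
      (fun ζ hζ p => iterTuple_finAnalyticAt h r (hNp ζ hζ).1 p)
      (fun ζ hζ p => lie_iterTuple (hNp ζ hζ).2.2 p) (hDv z) k hη.2).symm.trans ?_
    refine (iterate_lie_eventuallyEq ?_ δ k).self_of_nhds
    filter_upwards [hNo.mem_nhds hη.2] with ζ hζ
    rw [hR0 ζ hζ]
  · simp only [hR0 η hη]
    exact reducedVar_iterTuple (hNp η hη).2.2 z

/-- Commutation of `δ` with the Cartan field lets each application of the latter preserve the
transport equation. -/
theorem Transport.iterate_lift_cartan (h : X.IsSymmetry δ) {Ω : Set (Option (Coord m q) → ℝ)}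
    (hΩ : IsFlowBox δ Ω) (hX : ∀ e ∈ Ω, (fun v => e (some v)) ∈ X.carrier)
    {A : (Option (Coord m q) → ℝ) → ℝ} (hA : Transport δ Ω A) (k : ℕ) :
    Transport δ Ω ((lie (lift X.cartan))^[k] A) := by
  induction k generalizing A with
  | zero => exact hA
  | succ k ih =>
    exact ih (hA.lie_lift hΩ (fun e he v => X.cartan_finAnalyticAt (hX e he) v)
      fun e he v => h.comm (hX e he) v)

/-- A local flow of a symmetry, near a point where its iterates satisfy a reduced system. -/
theorem exists_local_flow (h : X.IsSymmetry δ) {η₀ : Space m q} (hη₀ : η₀ ∈ X.carrier)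
    (hφ : IsReduction δ r η₀ φ) {M : Set (Space m q)} (hM : IsOpen M) (hη₀M : η₀ ∈ M)
    (hMX : M ⊆ X.carrier) :
    ∃ ε > 0, ∃ N ⊆ M, IsOpen N ∧ η₀ ∈ N ∧
      ∃ G : (Option (Coord m q) → ℝ) → Space m q, (∀ v, Transport δ (box ε N) fun e => G e v) ∧
        (∀ e ∈ box ε N, G e ∈ M) ∧ (∀ η ∈ N, G (cons 0 η) = η) ∧
        ∀ e ∈ box ε N, ∀ v, lie dt (fun e => G e v) e = δ v (G e) := by
  obtain ⟨ε, hε, N, hNX, hN, hηN, H, hH⟩ := exists_transport_var h hη₀ hφ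
  have hbox : IsFlowBox δ (box ε N) := isFlowBox_box hN fun η hη v => h.finAnalyticAt (hNX hη) v
  -- The reduced system transports only the unknowns. A flow commuting with `τ` must send `x_i^{(k)}
  -- = τ^k x_i` to `τ^k` of the transported `x_i`, which dictates the other components.
  let G : (Option (Coord m q) → ℝ) → Space m q := fun e v =>
    match v with
    | Sum.inl p => (lie (lift X.cartan))^[p.2] (H (Sum.inl p.1)) e
    | Sum.inr j => H (Sum.inr j) e
  have hG : ∀ v, Transport δ (box ε N) fun e => G e v := by
    intro v
    cases v with
    | inl p => exact (hH _).1.iterate_lift_cartan h hbox (fun e he => hNX he.2) p.2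
    | inr j => exact (hH _).1
  have hG0 : ∀ η ∈ N, G (cons 0 η) = η := by
    intro η hη
    have hη' : cons 0 η ∈ box ε N := ⟨by simpa using hε, hη⟩
    ext v
    cases v with
    | inl p =>
      change (lie (lift X.cartan))^[p.2] (H (Sum.inl p.1)) (cons 0 η) = _
      rw [iterate_lie_lift hbox.isOpen (fun e he v => X.cartan_finAnalyticAt (hNX he.2) v)
        (fun e he => ((hH _).1 e he).1) _ hη']
      have : (fun ζ => H (Sum.inl p.1) (cons 0 ζ)) =ᶠ[𝓝 η] fun ζ => ζ (Sum.inl (p.1, 0)) := by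
        filter_upwards [hN.mem_nhds hη] with ζ hζ using (hH _).2 ζ hζ
      rw [(iterate_lie_eventuallyEq this X.cartan p.2).self_of_nhds, X.iterate_cartan]
    | inr j => exact (hH _).2 η hη
  have hη₀' : cons 0 η₀ ∈ box ε N := ⟨by simpa using hε, hηN⟩
  have hGc : ContinuousAt G (cons 0 η₀) :=
    continuousAt_pi.2 fun v => (hG v _ hη₀').1.continuousAt
  have hGM : ∀ᶠ e in 𝓝 (cons 0 η₀), G e ∈ M :=
    hGc.eventually (hM.mem_nhds (by rwa [hG0 η₀ hηN]))
  -- The smaller box keeps the values of `G` in `M`, where the coefficients of `δ` are analytic and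
  -- may be composed with `G`.
  obtain ⟨ε', hε', N', hN', hηN', hsub⟩ := exists_box_subset
    (Filter.inter_mem (Filter.inter_mem hGM (hbox.isOpen.mem_nhds hη₀'))
      ((hM.preimage continuous_tail).mem_nhds (show cons 0 η₀ ∈ _ from hη₀M)))
  have hNM : N' ⊆ M ∩ N := fun ζ hζ => by
    have := hsub (show cons 0 ζ ∈ box ε' N' from ⟨by simpa using hε', hζ⟩)
    exact ⟨this.2, this.1.2.2⟩
  have hbox' : IsFlowBox δ (box ε' N') :=
    isFlowBox_box hN' fun η hη v => h.finAnalyticAt (hNX (hNM hη).2) v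
  have hG' : ∀ v, Transport δ (box ε' N') fun e => G e v := fun v e he => hG v e (hsub he).1.2
  refine ⟨ε', hε', N', fun ζ hζ => (hNM hζ).1, hN', hηN', G, hG', fun e he => (hsub he).1.1,
    fun ζ hζ => hG0 ζ (hNM hζ).2, fun e he v => ?_⟩
  -- Both sides of the integral curve equation are transported, so it suffices to compare them at
  -- time `0`, where each equals `δ v`.
  refine Transport.eqOn hbox' ((hG' v).dt hbox') (Transport.comp (F := δ v) hG' fun e he =>
    h.finAnalyticAt (hMX (hsub he).1.1) v) (fun η hη => ?_) he
  rw [(hG' v _ hη).2, lie_lift (hG' v _ hη).1]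
  have : (fun ζ => G (cons 0 ζ) v) =ᶠ[𝓝 η] fun ζ => ζ v := by
    filter_upwards [hN'.mem_nhds hη.2] with ζ hζ
    rw [hG0 ζ (hNM hζ).2]
  rw [lie_congr this, lie_coord, hG0 η (hNM hη.2).2]

end Symmetry

end DiffietyFlow

namespace DiffietyFlow

/-! ### Maximal integral curves, the group law and analyticity of the flow. -/

section Flow

variable {m q : ℕ}

/-- On the open set `M`, the analytic vector field `δ` has local flows that depend analytically on
time and on the initial point. -/
structure HasLocalFlows (M : Set (Space m q)) (δ : VectorField m q) : Prop where
  isOpen : IsOpen M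
  analytic : ∀ η ∈ M, ∀ v, FinAnalyticAt (δ v) η
  local_flow : ∀ η₀ ∈ M, ∃ ε > 0, ∃ N ⊆ M, IsOpen N ∧ η₀ ∈ N ∧
    ∃ G : (Option (Coord m q) → ℝ) → Space m q, (∀ v, Transport δ (box ε N) fun e => G e v) ∧
      (∀ e ∈ box ε N, G e ∈ M) ∧ (∀ η ∈ N, G (cons 0 η) = η) ∧
      ∀ e ∈ box ε N, ∀ v, lie dt (fun e => G e v) e = δ v (G e)

variable {M : Set (Space m q)} {δ : VectorField m q}

/-- Integral curves are given by the local flow. -/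
theorem eventually_eq_local_flow {ε : ℝ} {N : Set (Space m q)} (hε : 0 < ε) (hN : IsOpen N)
    {G : (Option (Coord m q) → ℝ) → Space m q} (hG : ∀ v, Transport δ (box ε N) fun e => G e v)
    (hG0 : ∀ η ∈ N, G (cons 0 η) = η) {c : ℝ → Space m q} {t₀ : ℝ} (h0 : c t₀ ∈ N)
    (hc : ∀ᶠ t in 𝓝 t₀, ∀ v, HasDerivAt (fun t => c t v) (δ v (c t)) t) :
    ∀ᶠ t in 𝓝 t₀, c t = G (cons (t - t₀) (c t₀)) := by
  have hcc : ContinuousAt c t₀ := continuousAt_pi.2 fun v => (hc.self_of_nhds v).continuousAt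
  obtain ⟨ρ, hρ, hρ'⟩ := Metric.eventually_nhds_iff_ball.1
    (hc.and (hcc.eventually (hN.mem_nhds h0)))
  filter_upwards [Metric.ball_mem_nhds t₀ (lt_min hρ hε)] with t ht
  rw [Metric.mem_ball, lt_min_iff] at ht
  ext v
  let K : Set ℝ := Metric.ball t₀ ρ ∩ Metric.ball t ε
  have hKp : IsPreconnected K := by
    simp only [K, Real.ball_eq_Ioo]
    exact (ordConnected_Ioo.inter ordConnected_Ioo).isPreconnected
  -- Along an integral curve, `s ↦ G (t - s, c s)` has derivative `-∂G/∂t + δ G = 0`. Its values at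
  -- `s = t` and `s = t₀` are the two sides of the claim; `K` is an interval containing both.
  have hd : ∀ s ∈ K, HasDerivAt (fun s => G (cons (t - s) (c s)) v) 0 s := by
    intro s hs
    have hmem : cons (t - s) (c s) ∈ box ε N := by
      refine ⟨?_, (hρ' s hs.1).2⟩
      have := hs.2
      rwa [Metric.mem_ball, dist_comm, Real.dist_eq] at this
    have hT := hG v _ hmem
    have h1 := FinAnalyticAt.hasDerivAt_comp (F := fun e => G e v)
      (c := fun s => cons (t - s) (c s)) hT.1 (w := (-1 : ℝ) • (fun o => dt o (cons (t - s) (c s))) +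
        fun o => lift δ o (cons (t - s) (c s))) fun o => by
      cases o with
      | none => simpa [dt, lift] using (hasDerivAt_id s).const_sub t
      | some v => simpa [dt, lift] using (hρ' s hs.1).1 v
    rw [dir_add hT.1, dir_smul hT.1, ← lie_eq_dir, ← lie_eq_dir, hT.2] at h1
    simpa using h1
  have hconst := IsOpen.is_const_of_deriv_eq_zero (Metric.isOpen_ball.inter Metric.isOpen_ball) hKp
    (fun s hs => (hd s hs).differentiableAt.differentiableWithinAt) (fun s hs => (hd s hs).deriv)
    (x := t) (y := t₀) ⟨ht.1, Metric.mem_ball_self hε⟩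
    ⟨Metric.mem_ball_self hρ, by rw [Metric.mem_ball, dist_comm]; exact ht.2⟩
  rw [sub_self, hG0 _ (hρ' t ht.1).2] at hconst
  exact hconst

namespace HasLocalFlows

variable (h : HasLocalFlows M δ)
include h

theorem eventuallyEq_curve {c c' : ℝ → Space m q} {t₀ : ℝ} (h0 : c t₀ ∈ M) (heq : c t₀ = c' t₀)
    (hc : ∀ᶠ t in 𝓝 t₀, ∀ v, HasDerivAt (fun t => c t v) (δ v (c t)) t)
    (hc' : ∀ᶠ t in 𝓝 t₀, ∀ v, HasDerivAt (fun t => c' t v) (δ v (c' t)) t) : c =ᶠ[𝓝 t₀] c' := by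
  obtain ⟨ε, hε, N, -, hN, hηN, G, hG, -, hG0, -⟩ := h.local_flow _ h0
  filter_upwards [eventually_eq_local_flow hε hN hG hG0 hηN hc,
    eventually_eq_local_flow hε hN hG hG0 (heq ▸ hηN) hc'] with t h1 h2
  rw [h1, h2, heq]

/-- The set where the germs coincide is open. At a limit point the values coincide, the curves being
continuous in a Hausdorff space, and local uniqueness then identifies the germs. -/
theorem eqOn_of_isFlowCurve {η : Space m q} {J J' : Set ℝ} {c c' : ℝ → Space m q}
    (hc : IsFlowCurve M δ η J c) (hc' : IsFlowCurve M δ η J' c') : EqOn c c' (J ∩ J') := by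
  have hev : ∀ {J c}, IsFlowCurve M δ η J c → ∀ s ∈ J,
      ∀ᶠ t in 𝓝 s, ∀ v, HasDerivAt (fun t => c t v) (δ v (c t)) t := fun hc s hs =>
    mem_of_superset (hc.isOpen.mem_nhds hs) fun t ht => hc.hasDerivAt t ht
  have hcont : ∀ {J c}, IsFlowCurve M δ η J c → ∀ s ∈ J, ContinuousAt c s := fun hc s hs =>
    continuousAt_pi.2 fun v => (hc.hasDerivAt s hs v).continuousAt
  have hK : IsPreconnected (J ∩ J') := (hc.ordConnected.inter hc'.ordConnected).isPreconnected
  have hsub : J ∩ J' ⊆ {s | c =ᶠ[𝓝 s] c'} := by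
    refine hK.subset_of_closure_inter_subset ?_ ⟨0, ⟨hc.zero_mem, hc'.zero_mem⟩, ?_⟩ ?_
    · exact isOpen_setOfPred_eventually_nhds
    · exact h.eventuallyEq_curve (hc.mem 0 hc.zero_mem) (hc.start.trans hc'.start.symm)
        (hev hc 0 hc.zero_mem) (hev hc' 0 hc'.zero_mem)
    · rintro s ⟨hs, hsJ, hsJ'⟩
      refine h.eventuallyEq_curve (hc.mem s hsJ) ?_ (hev hc s hsJ) (hev hc' s hsJ')
      have := mem_closure_iff_frequently.1 hs
      have hfr : ∃ᶠ t in 𝓝 s, c t = c' t := this.mono fun t ht => ht.self_of_nhds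
      by_contra hne
      obtain ⟨t, h1, h2⟩ := (hfr.and_eventually
        (((hcont hc s hsJ).prodMk (hcont hc' s hsJ')).eventually
          (isOpen_compl_iff.2 isClosed_diagonal |>.mem_nhds
            (show (c s, c' s) ∈ (diagonal (Space m q))ᶜ from hne)))).exists
      exact h2 h1
  exact fun s hs => (hsub hs).self_of_nhds

/-- By uniqueness, the value does not depend on the curve chosen in the definition of `flowMap`. -/
theorem eq_flowMap {η : Space m q} {J : Set ℝ} {c : ℝ → Space m q} (hc : IsFlowCurve M δ η J c)
    {s : ℝ} (hs : s ∈ J) : c s = flowMap M δ s η := by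
  have hex : ∃ (x : Space m q) (J : Set ℝ) (c : ℝ → Space m q),
      IsFlowCurve M δ η J c ∧ s ∈ J ∧ c s = x := ⟨c s, J, c, hc, hs, rfl⟩
  rw [flowMap, dif_pos hex]
  obtain ⟨J', c', hc', hs', heq⟩ := hex.choose_spec
  rw [← heq]
  exact h.eqOn_of_isFlowCurve hc hc' ⟨hs, hs'⟩

/-- The local flow coincides with the flow. -/
theorem exists_box {η₀ : Space m q} (hη₀ : η₀ ∈ M) :
    ∃ ε > 0, ∃ N ⊆ M, IsOpen N ∧ η₀ ∈ N ∧
      ∃ G : (Option (Coord m q) → ℝ) → Space m q, (∀ e ∈ box ε N, ∀ v,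
        FinAnalyticAt (fun e => G e v) e) ∧
      ∀ s η, |s| < ε → η ∈ N → s ∈ maxInterval M δ η ∧ flowMap M δ s η = G (cons s η) := by
  obtain ⟨ε, hε, N, hNM, hN, hηN, G, hG, hGM, hG0, hGd⟩ := h.local_flow _ hη₀
  refine ⟨ε, hε, N, hNM, hN, hηN, G, fun e he v => (hG v e he).1, fun s η hs hη => ?_⟩
  have hc : IsFlowCurve M δ η (Ioo (-ε) ε) fun t => G (cons t η) := by
    refine ⟨isOpen_Ioo, ordConnected_Ioo, ⟨by linarith, hε⟩, hG0 η hη,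
      fun t ht => hGM _ ⟨abs_lt.2 ht, hη⟩, fun t ht v => ?_⟩
    have hmem : cons t η ∈ box ε N := ⟨abs_lt.2 ht, hη⟩
    rw [← hGd _ hmem]
    exact hasDerivAt_time (F := fun e => G e v) (hG v _ hmem).1
  exact ⟨⟨_, _, hc, abs_lt.1 hs⟩, (h.eq_flowMap hc (abs_lt.1 hs)).symm⟩

/-- The maximal integral curve. -/
theorem isFlowCurve {η : Space m q} (hη : η ∈ M) :
    IsFlowCurve M δ η (maxInterval M δ η) fun s => flowMap M δ s η := by
  obtain ⟨ε, hε, N, -, -, hηN, G, -, hG⟩ := h.exists_box hη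
  have h0 : (0 : ℝ) ∈ maxInterval M δ η := (hG 0 η (by simpa using hε) hηN).1
  have heq : ∀ {J c}, IsFlowCurve M δ η J c → ∀ s ∈ J, c s = flowMap M δ s η :=
    fun hc s hs => h.eq_flowMap hc hs
  refine ⟨?_, ⟨?_⟩, h0, ?_, ?_, ?_⟩
  · rw [isOpen_iff_mem_nhds]
    rintro s ⟨J, c, hc, hs⟩
    exact mem_of_superset (hc.isOpen.mem_nhds hs) fun t ht => ⟨J, c, hc, ht⟩
  · rintro x ⟨J, c, hc, hx⟩ y ⟨J', c', hc', hy⟩ z hz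
    -- Every interval of existence contains `0`, so a time between `x` and `y` lies in the interval
    -- of whichever endpoint is on its side of `0`.
    rcases le_total 0 z with h | h
    · exact ⟨J', c', hc', hc'.ordConnected.out hc'.zero_mem hy ⟨h, hz.2⟩⟩
    · exact ⟨J, c, hc, hc.ordConnected.out hx hc.zero_mem ⟨hz.1, h⟩⟩
  · obtain ⟨J, c, hc, h0⟩ := h0
    rw [← heq hc 0 h0, hc.start]
  · rintro s ⟨J, c, hc, hs⟩
    rw [← heq hc s hs]; exact hc.mem s hs
  · rintro s ⟨J, c, hc, hs⟩ v
    rw [← heq hc s hs]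
    refine (hc.hasDerivAt s hs v).congr_of_eventuallyEq ?_
    filter_upwards [hc.isOpen.mem_nhds hs] with t ht
    rw [heq hc t ht]

theorem flowMap_zero {η : Space m q} (hη : η ∈ M) : flowMap M δ 0 η = η := (h.isFlowCurve hη).start

theorem flowMap_mem {η : Space m q} (hη : η ∈ M) {s : ℝ} (hs : s ∈ maxInterval M δ η) :
    flowMap M δ s η ∈ M := (h.isFlowCurve hη).mem s hs

theorem zero_mem {η : Space m q} (hη : η ∈ M) : (0 : ℝ) ∈ maxInterval M δ η :=
  (h.isFlowCurve hη).zero_mem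

theorem ordConnected {η : Space m q} (hη : η ∈ M) : (maxInterval M δ η).OrdConnected :=
  (h.isFlowCurve hη).ordConnected

theorem isOpen_maxInterval {η : Space m q} (hη : η ∈ M) : IsOpen (maxInterval M δ η) :=
  (h.isFlowCurve hη).isOpen

theorem continuousAt_curve {η : Space m q} (hη : η ∈ M) {s : ℝ} (hs : s ∈ maxInterval M δ η) :
    ContinuousAt (fun s => flowMap M δ s η) s :=
  continuousAt_pi.2 fun v => ((h.isFlowCurve hη).hasDerivAt s hs v).continuousAt

theorem isFlowCurve_shift {η : Space m q} (hη : η ∈ M) {s : ℝ} (hs : s ∈ maxInterval M δ η) :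
    IsFlowCurve M δ (flowMap M δ s η) {t | s + t ∈ maxInterval M δ η}
      fun t => flowMap M δ (s + t) η := by
  have hc := h.isFlowCurve hη
  refine ⟨hc.isOpen.preimage (continuous_const.add continuous_id), ⟨fun x hx y hy z hz => ?_⟩, ?_,
    by simp, fun t ht => hc.mem _ ht, fun t ht v => ?_⟩
  · exact hc.ordConnected.out hx hy ⟨by linarith [hz.1], by linarith [hz.2]⟩
  · simpa using hs
  · simpa using (hc.hasDerivAt (s + t) ht v).comp_const_add s t

/-- The translated maximal curve gives one inclusion. Translating back by `-s` from the image point,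
which returns to `η`, gives the other. -/
theorem maxInterval_flowMap {η : Space m q} (hη : η ∈ M) {s : ℝ} (hs : s ∈ maxInterval M δ η) :
    maxInterval M δ (flowMap M δ s η) = {t | s + t ∈ maxInterval M δ η} := by
  have hc := h.isFlowCurve_shift hη hs
  refine Subset.antisymm ?_ fun t ht => ⟨_, _, hc, ht⟩
  have hs' : -s ∈ {t | s + t ∈ maxInterval M δ η} := by simpa using h.zero_mem hη
  have hback : flowMap M δ (-s) (flowMap M δ s η) = η := by
    rw [← h.eq_flowMap hc hs']
    simpa using h.flowMap_zero hη
  have hc' := h.isFlowCurve_shift (h.flowMap_mem hη hs) ⟨_, _, hc, hs'⟩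
  rw [hback] at hc'
  intro t ht
  exact ⟨_, _, hc', by simpa using ht⟩

theorem flowMap_flowMap {η : Space m q} (hη : η ∈ M) {s t : ℝ} (hs : s ∈ maxInterval M δ η)
    (ht : s + t ∈ maxInterval M δ η) :
    flowMap M δ t (flowMap M δ s η) = flowMap M δ (s + t) η :=
  (h.eq_flowMap (h.isFlowCurve_shift hη hs) ht).symm

theorem mem_maxInterval_flowMap {η : Space m q} (hη : η ∈ M) {s t : ℝ}
    (hs : s ∈ maxInterval M δ η) :
    t ∈ maxInterval M δ (flowMap M δ s η) ↔ s + t ∈ maxInterval M δ η := by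
  rw [h.maxInterval_flowMap hη hs]; rfl

theorem neg_mem_maxInterval_flowMap {η : Space m q} (hη : η ∈ M) {s : ℝ}
    (hs : s ∈ maxInterval M δ η) : -s ∈ maxInterval M δ (flowMap M δ s η) := by
  rw [h.mem_maxInterval_flowMap hη hs, add_neg_cancel]
  exact h.zero_mem hη

theorem flowMap_neg_flowMap {η : Space m q} (hη : η ∈ M) {s : ℝ} (hs : s ∈ maxInterval M δ η) :
    flowMap M δ (-s) (flowMap M δ s η) = η := by
  rw [h.flowMap_flowMap hη hs, add_neg_cancel, h.flowMap_zero hη]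
  rw [add_neg_cancel]
  exact h.zero_mem hη

end HasLocalFlows

/-- The domain of the flow, in the product of the time axis and the space. -/
def flowDomain (M : Set (Space m q)) (δ : VectorField m q) : Set (Option (Coord m q) → ℝ) :=
  {e | (fun v => e (some v)) ∈ M ∧ e none ∈ maxInterval M δ fun v => e (some v)}

/-- The flow, as a map on the product of the time axis and the space. -/
noncomputable def timeFlow (M : Set (Space m q)) (δ : VectorField m q)
    (e : Option (Coord m q) → ℝ) : Space m q :=
  flowMap M δ (e none) fun v => e (some v)

/-- The flow is defined and analytic near the point `e`. -/
def FlowAnalyticAt (M : Set (Space m q)) (δ : VectorField m q)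
    (e : Option (Coord m q) → ℝ) : Prop :=
  flowDomain M δ ∈ 𝓝 e ∧ ∀ v, FinAnalyticAt (fun e => timeFlow M δ e v) e

namespace HasLocalFlows

variable (h : HasLocalFlows M δ)
include h

theorem flowAnalyticAt_zero {η : Space m q} (hη : η ∈ M) : FlowAnalyticAt M δ (cons 0 η) := by
  obtain ⟨ε, hε, N, hNM, hN, hηN, G, hGa, hG⟩ := h.exists_box hη
  have hbox : box ε N ∈ 𝓝 (cons 0 η) :=
    (isFlowBox_box hN fun η hη v => h.analytic η (hNM hη) v).isOpen.mem_nhds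
      ⟨by simpa using hε, hηN⟩
  refine ⟨mem_of_superset hbox fun e he => ⟨hNM he.2, (hG _ _ he.1 he.2).1⟩, fun v => ?_⟩
  refine (hGa _ (mem_of_mem_nhds hbox) v).congr ?_
  filter_upwards [hbox] with e he
  rw [timeFlow, (hG _ _ he.1 he.2).2, cons_eta]

/-- Nearby the flow factors as the flow at the fixed time `s₁` followed by the local flow for the
time difference. Either order of `s` and `s₁` is allowed, so analyticity propagates in both
directions along the curve. -/
theorem flowAnalyticAt_of_near {η : Space m q} {ε : ℝ} {N : Set (Space m q)}
    {G : (Option (Coord m q) → ℝ) → Space m q} (hN : IsOpen N)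
    (hGa : ∀ e ∈ box ε N, ∀ v, FinAnalyticAt (fun e => G e v) e)
    (hG : ∀ s η, |s| < ε → η ∈ N → s ∈ maxInterval M δ η ∧ flowMap M δ s η = G (cons s η))
    {s s₁ : ℝ} (hs : |s - s₁| < ε) (hs₁ : flowMap M δ s₁ η ∈ N)
    (hgood : FlowAnalyticAt M δ (cons s₁ η)) : FlowAnalyticAt M δ (cons s η) := by
  let T : (Option (Coord m q) → ℝ) → Option (Coord m q) → ℝ := fun e => cons s₁ fun v => e (some v)
  have hT : ContinuousAt T (cons s η) :=
    ((continuous_cons.comp (Continuous.prodMk_right s₁)).comp continuous_tail).continuousAt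
  have hTa : ∀ v, FinAnalyticAt (fun e => timeFlow M δ (T e) v) (cons s η) := fun v =>
    FinAnalyticAt.comp (Φ := T) (η := cons s η) (hgood.2 v) fun o => by
      cases o with
      | none => exact finAnalyticAt_const _ _
      | some v => exact finAnalyticAt_coord (some v) _
  have hTc : ContinuousAt (fun e => timeFlow M δ (T e)) (cons s η) :=
    continuousAt_pi.2 fun v => (hTa v).continuousAt
  have hev : ∀ᶠ e in 𝓝 (cons s η), |e none - s₁| < ε ∧ T e ∈ flowDomain M δ ∧
      timeFlow M δ (T e) ∈ N := by
    filter_upwards [((continuous_apply (none : Option (Coord m q))).sub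
        continuous_const).abs.continuousAt.eventually (gt_mem_nhds hs),
      hT.eventually hgood.1, hTc.eventually (hN.mem_nhds hs₁)] with e a b c
    exact ⟨a, b, c⟩
  have hkey : ∀ᶠ e in 𝓝 (cons s η), e ∈ flowDomain M δ ∧
      timeFlow M δ e = G (cons (e none - s₁) (timeFlow M δ (T e))) := by
    filter_upwards [hev] with e ⟨h1, h2, h3⟩
    have h4 := hG _ _ h1 h3
    have h5 : e none ∈ maxInterval M δ fun v => e (some v) := by
      have := (h.mem_maxInterval_flowMap h2.1 h2.2).1 h4.1
      simpa [T] using this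
    refine ⟨⟨h2.1, h5⟩, ?_⟩
    rw [← h4.2]
    have := h.flowMap_flowMap (t := e none - s₁) h2.1 h2.2 (by simpa [T] using h5)
    change flowMap M δ _ _ = flowMap M δ _ (flowMap M δ _ _)
    rw [this]
    simp [T]
  refine ⟨hkey.mono fun e he => he.1, fun v => ?_⟩
  have h1 : FinAnalyticAt (fun e => G (cons (e none - s₁) (timeFlow M δ (T e))) v) (cons s η) := by
    refine FinAnalyticAt.comp (F := fun e => G e v)
      (Φ := fun e => cons (e none - s₁) (timeFlow M δ (T e))) (hGa _ ⟨hs, hs₁⟩ v) fun o => ?_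
    cases o with
    | none =>
      simpa [sub_eq_add_neg] using
        (finAnalyticAt_coord none (cons s η)).add (finAnalyticAt_const (-s₁) _)
    | some v => exact hTa v
  exact h1.congr (hkey.mono fun e he => (congrFun he.2 v).symm)

/-- The flow is analytic on its domain, which is open. -/
theorem flowAnalyticAt {e : Option (Coord m q) → ℝ} (he : e ∈ flowDomain M δ) :
    FlowAnalyticAt M δ e := by
  rw [← cons_eta e]
  obtain ⟨hη, hs⟩ := he
  set η : Space m q := fun v => e (some v)
  have key : ∀ s ∈ maxInterval M δ η, ∀ᶠ t in 𝓝 s,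
      (FlowAnalyticAt M δ (cons s η) ↔ FlowAnalyticAt M δ (cons t η)) := by
    intro s hs
    obtain ⟨ε, hε, N, -, hN, hηN, G, hGa, hG⟩ := h.exists_box (h.flowMap_mem hη hs)
    filter_upwards [Metric.ball_mem_nhds s hε,
      (h.continuousAt_curve hη hs).eventually (hN.mem_nhds hηN)] with t ht htN
    rw [Metric.mem_ball, Real.dist_eq] at ht
    exact ⟨h.flowAnalyticAt_of_near hN hGa hG ht hηN,
      h.flowAnalyticAt_of_near hN hGa hG (by rwa [abs_sub_comm]) htN⟩
  -- Analyticity at `(s, η)` is locally constant in `s`, hence constant on the maximal interval; it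
  -- holds at `s = 0`.
  have := (h.ordConnected hη).isPreconnected.induction₂
    (fun s t => (FlowAnalyticAt M δ (cons s η) ↔ FlowAnalyticAt M δ (cons t η)))
    (fun s hs => nhdsWithin_le_nhds (key s hs)) (fun _ _ _ _ _ _ a b => a.trans b)
    (fun _ _ _ _ a => a.symm) (h.zero_mem hη) hs
  exact this.1 (h.flowAnalyticAt_zero hη)

theorem isFlowBox : IsFlowBox δ (flowDomain M δ) where
  isOpen := isOpen_iff_mem_nhds.2 fun _ he => (h.flowAnalyticAt he).1
  analytic _ he := h.analytic _ he.1
  preconnected η := by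
    by_cases hη : η ∈ M
    · have : {s | cons s η ∈ flowDomain M δ} = maxInterval M δ η := by
        ext s; exact ⟨fun h => h.2, fun h => ⟨hη, h⟩⟩
      rw [this]
      exact (h.ordConnected hη).isPreconnected
    · have : {s | cons s η ∈ flowDomain M δ} = ∅ := by
        ext s; exact ⟨fun h => hη h.1, fun h => h.elim⟩
      rw [this]
      exact isPreconnected_empty
  zero_mem s η hs := ⟨hs.1, h.zero_mem hs.1⟩

theorem lie_dt_timeFlow {e : Option (Coord m q) → ℝ} (he : e ∈ flowDomain M δ) (v : Coord m q) :
    lie dt (fun e => timeFlow M δ e v) e = δ v (timeFlow M δ e) := by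
  have h1 := (h.flowAnalyticAt he).2 v
  have h2 := (h.isFlowCurve he.1).hasDerivAt _ he.2 v
  rw [← cons_eta e] at h1 ⊢
  exact (hasDerivAt_time (F := fun e => timeFlow M δ e v) h1).unique h2

theorem iterate_dt_timeFlow {e : Option (Coord m q) → ℝ} (he : e ∈ flowDomain M δ)
    (v : Coord m q) (k : ℕ) :
    (lie dt)^[k] (fun e => timeFlow M δ e v) e = (lie δ)^[k] (fun ζ => ζ v) (timeFlow M δ e) :=
  iterate_lie_comp_of_related (D := M) (P := fun ζ => ζ v) (Ψ := timeFlow M δ) h.isFlowBox.isOpen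
    (fun _ he => h.flowMap_mem he.1 he.2) h.analytic (fun _ he => (h.flowAnalyticAt he).2)
    (fun _ he p => h.lie_dt_timeFlow he p) (fun y _ => finAnalyticAt_coord v y) k he

theorem eventuallyEq_timeFlow_zero {η : Space m q} (hη : η ∈ M) (v : Coord m q) :
    (fun ζ => timeFlow M δ (cons 0 ζ) v) =ᶠ[𝓝 η] fun ζ => ζ v := by
  filter_upwards [h.isOpen.mem_nhds hη] with ζ hζ
  exact congrFun (h.flowMap_zero hζ) v

/-- The integral curve equation differentiates the endpoint, the transport equation the starting
point. They are reconciled because all time derivatives at time `0` are the iterates of `δ` on the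
coordinate. -/
theorem transport_timeFlow (v : Coord m q) :
    Transport δ (flowDomain M δ) fun e => timeFlow M δ e v := by
  refine transport_of_iterate h.isFlowBox (fun e he => (h.flowAnalyticAt he).2 v) fun η hη k => ?_
  rw [h.iterate_dt_timeFlow hη,
    (iterate_lie_eventuallyEq (h.eventuallyEq_timeFlow_zero (η := η) hη.1 v) δ k).self_of_nhds]
  exact congrArg _ (h.flowMap_zero (η := η) hη.1)

theorem finAnalyticAt_flowMap {η : Space m q} (hη : η ∈ M) {s : ℝ} (hs : s ∈ maxInterval M δ η)
    (v : Coord m q) : FinAnalyticAt (fun ζ => flowMap M δ s ζ v) η :=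
  ((h.flowAnalyticAt (e := cons s η) ⟨hη, hs⟩).2 v).slice

theorem continuousAt_flowMap {η : Space m q} (hη : η ∈ M) {s : ℝ} (hs : s ∈ maxInterval M δ η) :
    ContinuousAt (flowMap M δ s) η :=
  continuousAt_pi.2 fun v => (h.finAnalyticAt_flowMap hη hs v).continuousAt

theorem eventually_mem_maxInterval {η : Space m q} (hη : η ∈ M) {s : ℝ}
    (hs : s ∈ maxInterval M δ η) : ∀ᶠ ζ in 𝓝 η, s ∈ maxInterval M δ ζ :=
  ((continuous_cons.comp (Continuous.prodMk_right s)).continuousAt.eventually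
    (h.flowAnalyticAt (e := cons s η) ⟨hη, hs⟩).1).mono fun _ h => h.2

/-- The flow commutes with the Cartan field. -/
theorem lie_cartan_flowMap {X : Diffiety m q} (hδ : X.IsSymmetry δ) (hM : M ⊆ X.carrier)
    {η : Space m q} (hη : η ∈ M) {s : ℝ} (hs : s ∈ maxInterval M δ η) (v : Coord m q) :
    lie X.cartan (fun ζ => flowMap M δ s ζ v) η = X.cartan v (flowMap M δ s η) := by
  have hΘ := h.transport_timeFlow
  have he : cons s η ∈ flowDomain M δ := ⟨hη, hs⟩
  have h1 : Transport δ (flowDomain M δ) (lie (lift X.cartan) fun e => timeFlow M δ e v) :=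
    (hΘ v).lie_lift h.isFlowBox (fun e he v => X.cartan_finAnalyticAt (hM he.1) v)
      fun e he v => hδ.comm (hM he.1) v
  have h2 : Transport δ (flowDomain M δ) fun e => X.cartan v (timeFlow M δ e) :=
    Transport.comp hΘ fun e he => X.cartan_finAnalyticAt (hM (h.flowMap_mem he.1 he.2)) v
  -- Both `τ(Θ_v)` and `τ_v(Θ)` are transported, where `Θ` denotes the flow, and at time `0` both
  -- are the coefficient `τ_v`.
  have h3 := Transport.eqOn h.isFlowBox h1 h2 (fun ζ hζ => by
    rw [lie_lift (hΘ v _ hζ).1, lie_congr (h.eventuallyEq_timeFlow_zero (η := ζ) hζ.1 v), lie_coord]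
    exact congrArg _ (h.flowMap_zero hζ.1).symm) he
  rw [lie_lift (hΘ v _ he).1] at h3
  exact h3

end HasLocalFlows

end Flow

end DiffietyFlow

namespace DiffietyFlow

/-! ### Global dependence on finitely many coordinates, and the morphism property. -/

section Global

variable {m q : ℕ} {X : Diffiety m q} {δ : VectorField m q}

/-- The restriction to finitely many coordinates has continuous sections through each point. -/
theorem exists_section {ι : Type*} (S : Finset ι) (η : ι → ℝ) :
    ∃ σ : (S → ℝ) → ι → ℝ, (∀ p v, FinAnalyticAt (fun p => σ p v) p) ∧ Continuous σ ∧
      (∀ p, S.restrict (σ p) = p) ∧ σ (S.restrict η) = η := by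
  classical
  let σ : (S → ℝ) → ι → ℝ := fun p v => if hv : v ∈ S then p ⟨v, hv⟩ else η v
  have hσa : ∀ p v, FinAnalyticAt (fun p => σ p v) p := by
    intro p v
    by_cases hv : v ∈ S
    · simpa [σ, hv] using finAnalyticAt_coord (⟨v, hv⟩ : S) p
    · simpa [σ, hv] using finAnalyticAt_const (η v) p
  refine ⟨σ, hσa, continuous_pi fun v => continuous_iff_continuousAt.2 fun p =>
    (hσa p v).continuousAt, fun p => ?_, ?_⟩
  · ext v; simp [σ]
  · ext v; by_cases hv : v ∈ S <;> simp [σ, hv]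

/-- A locally analytic function on an open set that depends on finitely many coordinates is an
analytic function of these coordinates. -/
theorem exists_analytic_expression {U : Set (Space m q)} (hU : IsOpen U)
    {F : Space m q → ℝ} (hF : ∀ η ∈ U, FinAnalyticAt F η) (S : Finset (Coord m q))
    (hS : ∀ η ∈ U, ∀ ζ ∈ U, (∀ v ∈ S, η v = ζ v) → F η = F ζ) :
    ∃ h : (S → ℝ) → ℝ, AnalyticOnNhd ℝ h (S.restrict '' U) ∧ ∀ η ∈ U, F η = h (S.restrict η) := by
  classical
  let h : (S → ℝ) → ℝ := fun p =>
    if hp : ∃ η ∈ U, S.restrict η = p then F hp.choose else 0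
  have hh : ∀ η ∈ U, F η = h (S.restrict η) := by
    intro η hη
    have hp : ∃ ζ ∈ U, S.restrict ζ = S.restrict η := ⟨η, hη, rfl⟩
    simp only [h, dif_pos hp]
    obtain ⟨h1, h2⟩ := hp.choose_spec
    exact hS η hη _ h1 fun v hv => (congrFun h2 ⟨v, hv⟩).symm
  refine ⟨h, ?_, hh⟩
  rintro _ ⟨η, hη, rfl⟩
  -- Freezing the coordinates outside `S` at those of `η` exhibits `h` near `S.restrict η` as the
  -- analytic function `F ∘ σ`. The value of `h` off the image plays no role, since nearby points
  -- lift to `U`.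
  obtain ⟨σ, hσa, hσc, hσ, hση⟩ := exists_section S η
  have h1 : FinAnalyticAt (fun p => F (σ p)) (S.restrict η) :=
    FinAnalyticAt.comp (Φ := σ) (by rw [hση]; exact hF η hη) fun v => hσa _ v
  refine (FinAnalyticAt.congr h1 ?_).analyticAt
  filter_upwards [hσc.continuousAt.eventually (hU.mem_nhds (by rwa [hση]))] with p hp
  rw [hh _ hp, hσ]

theorem isAnalyticFun_of_finAnalyticAt {U : Set (Space m q)} (hU : IsOpen U)
    {F : Space m q → ℝ} (hF : ∀ η ∈ U, FinAnalyticAt F η) (S : Finset (Coord m q))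
    (hS : ∀ η ∈ U, ∀ ζ ∈ U, (∀ v ∈ S, η v = ζ v) → F η = F ζ) : IsAnalyticFun U F :=
  ⟨S, exists_analytic_expression hU hF S hS⟩

theorem IsAnalyticFun.exists_dependence {W : Set (Space m q)} {F : Space m q → ℝ}
    (hF : IsAnalyticFun W F) :
    ∃ S : Finset (Coord m q), ∀ η ∈ W, ∀ ζ ∈ W, (∀ v ∈ S, η v = ζ v) → F η = F ζ := by
  obtain ⟨S, h, -, hFh⟩ := hF
  refine ⟨S, fun η hη ζ hζ hv => ?_⟩
  rw [hFh η hη, hFh ζ hζ]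
  congr 1
  ext v
  exact hv v v.2

/-- Pullback of analytic functions by a map with analytic components. -/
theorem IsAnalyticFun.comp {U V : Set (Space m q)} (hU : IsOpen U) (hV : IsOpen V)
    {Φ : Space m q → Space m q} (hUV : MapsTo Φ U V) (hΦ : ∀ v, IsAnalyticFun U fun η => Φ η v)
    {F : Space m q → ℝ} (hF : IsAnalyticFun V F) : IsAnalyticFun U (F ∘ Φ) := by
  obtain ⟨S, hS⟩ := hF.exists_dependence
  choose T hT using fun v => (hΦ v).exists_dependence
  refine isAnalyticFun_of_finAnalyticAt hU (fun η hη => FinAnalyticAt.comp (Φ := Φ)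
    (hF.finAnalyticAt hV (hUV hη)) fun v => (hΦ v).finAnalyticAt hU hη) (S.biUnion T) ?_
  intro η hη ζ hζ h
  refine hS _ (hUV hη) _ (hUV hζ) fun v hv => hT v η hη ζ hζ fun u hu => h u ?_
  exact Finset.mem_biUnion.2 ⟨v, hv, hu⟩

/-- The coordinates of order at most `e`. -/
def coordsOfOrderLE (m q e : ℕ) : Finset (Coord m q) :=
  ((Finset.univ : Finset (Fin m)) ×ˢ Finset.range (e + 1)).disjSum Finset.univ

theorem mem_coordsOfOrderLE {e : ℕ} {v : Coord m q} :
    v ∈ coordsOfOrderLE m q e ↔ coordOrder v ≤ e := by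
  cases v with
  | inl p => simp [coordsOfOrderLE, coordOrder]
  | inr j => simp [coordsOfOrderLE, coordOrder]

theorem pderiv_eq_of_agree {W : Set (Space m q)} (hW : IsOpen W) {e : ℕ} {F : Space m q → ℝ}
    (hF : HasOrderLE W e F) {η ζ : Space m q} (hη : η ∈ W) (hζ : ζ ∈ W)
    (h : ∀ v, coordOrder v ≤ e → η v = ζ v) {v : Coord m q} (hv : coordOrder v ≤ e) :
    pderiv v F η = pderiv v F ζ := by
  rw [pderiv, pderiv, h v hv]
  apply Filter.EventuallyEq.deriv_eq
  have hup : ∀ ξ ∈ W, ξ v = ζ v → ∀ᶠ t in 𝓝 (ζ v), Function.update ξ v t ∈ W := by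
    intro ξ hξ hξv
    have hc : Continuous fun t : ℝ => Function.update ξ v t :=
      continuous_const.update v continuous_id
    refine hc.continuousAt.eventually (hW.mem_nhds ?_)
    rw [← hξv]
    simpa using hξ
  filter_upwards [hup η hη (h v hv), hup ζ hζ rfl] with t h1 h2
  refine hF _ h1 _ h2 fun u hu => ?_
  by_cases huv : u = v
  · subst huv; simp
  · simp [huv, h u hu]

theorem pderiv_eq_zero_of_lt_order {W : Set (Space m q)} (hW : IsOpen W) {e : ℕ}
    {F : Space m q → ℝ} (hF : HasOrderLE W e F) {η : Space m q} (hη : η ∈ W) {v : Coord m q}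
    (hv : e < coordOrder v) : pderiv v F η = 0 := by
  have hc : Continuous fun t : ℝ => Function.update η v t :=
    continuous_const.update v continuous_id
  have : (fun t : ℝ => F (Function.update η v t)) =ᶠ[𝓝 (η v)] fun _ => F η := by
    filter_upwards [hc.continuousAt.eventually (hW.mem_nhds
      (show Function.update η v (η v) ∈ W by rwa [Function.update_eq_self]))] with t ht
    refine hF _ ht _ hη fun u hu => ?_
    have : u ≠ v := by rintro rfl; omega
    simp [this]
  rw [pderiv, this.deriv_eq, deriv_const]

/-- The partial derivatives of `F` keep order `e` and vanish along coordinates of order above `e`.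
The remaining coefficients are some `x^{(k+1)}` with `k ≤ e`, or an `f_j` of order at most `1 ≤ e +
1`. -/
theorem HasOrderLE.lie_cartan {e : ℕ} {F : Space m q → ℝ} (hF : HasOrderLE X.carrier e F) :
    HasOrderLE X.carrier (e + 1) (lie X.cartan F) := by
  intro η hη ζ hζ h
  refine finsum_congr fun v => ?_
  have h' : ∀ v, coordOrder v ≤ e → η v = ζ v := fun v hv => h v (by omega)
  rcases le_or_gt (coordOrder v) e with hv | hv
  · rw [pderiv_eq_of_agree X.isOpen_carrier hF hη hζ h' hv]
    congr 1
    cases v with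
    | inl p => exact h (Sum.inl (p.1, p.2 + 1)) (Nat.succ_le_succ hv)
    | inr j => exact X.f_order j η hη ζ hζ fun v hv => h v (by omega)
  · rw [pderiv_eq_zero_of_lt_order X.isOpen_carrier hF hη hv,
      pderiv_eq_zero_of_lt_order X.isOpen_carrier hF hζ hv, mul_zero, mul_zero]

theorem HasOrderLE.congr {W : Set (Space m q)} {e : ℕ} {F G : Space m q → ℝ}
    (hF : HasOrderLE W e F) (h : EqOn F G W) : HasOrderLE W e G := by
  intro η hη ζ hζ h'
  rw [← h hη, ← h hζ]
  exact hF η hη ζ hζ h'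

theorem HasOrderLE.iterate_lie_cartan {e : ℕ} {F : Space m q → ℝ}
    (hF : HasOrderLE X.carrier e F) (k : ℕ) :
    HasOrderLE X.carrier (e + k) ((lie X.cartan)^[k] F) := by
  induction k with
  | zero => exact hF
  | succ k ih =>
    rw [Function.iterate_succ_apply']
    exact ih.lie_cartan

theorem Diffiety.IsSymmetry.iterate_comm (h : X.IsSymmetry δ) {F : Space m q → ℝ}
    (hF : ∀ η ∈ X.carrier, FinAnalyticAt F η) (j k : ℕ) :
    EqOn ((lie δ)^[j] ((lie X.cartan)^[k] F)) ((lie X.cartan)^[k] ((lie δ)^[j] F)) X.carrier := by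
  have hcong : ∀ {A B : Space m q → ℝ} (a : VectorField m q) (k : ℕ), EqOn A B X.carrier →
      EqOn ((lie a)^[k] A) ((lie a)^[k] B) X.carrier := fun a k h η hη =>
    (iterate_lie_eventuallyEq (h.eventuallyEq_of_mem (X.isOpen_carrier.mem_nhds hη))
      a k).self_of_nhds
  have h1 : ∀ (k : ℕ) {F : Space m q → ℝ}, (∀ η ∈ X.carrier, FinAnalyticAt F η) →
      EqOn (lie δ ((lie X.cartan)^[k] F)) ((lie X.cartan)^[k] (lie δ F)) X.carrier := by
    intro k
    induction k with
    | zero => exact fun _ _ _ => rfl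
    | succ k ih =>
      intro F hF η hη
      rw [Function.iterate_succ_apply, Function.iterate_succ_apply,
        ih (fun η hη => (hF η hη).lie fun v => X.cartan_finAnalyticAt hη v) hη]
      exact hcong _ k (fun ζ hζ => lie_comm (hF ζ hζ) (fun v => h.finAnalyticAt hζ v)
        (fun v => X.cartan_finAnalyticAt hζ v) fun v => h.comm hζ v) hη
  induction j generalizing F with
  | zero => exact fun _ _ => rfl
  | succ j ih =>
    intro η hη
    rw [Function.iterate_succ_apply, Function.iterate_succ_apply, hcong δ j (h1 k hF) hη]
    exact ih (fun η hη => (hF η hη).lie fun v => h.finAnalyticAt hη v) hη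

/-- The iterates of an integrable symmetry on a coordinate have bounded order. -/
theorem hasOrderLE_iterate_coord (h : X.IsSymmetry δ) {e : ℕ}
    (he : ∀ z k, HasOrderLE X.carrier e (iter δ z k)) (v : Coord m q) (j : ℕ) :
    HasOrderLE X.carrier (e + coordOrder v) ((lie δ)^[j] fun η => η v) := by
  cases v with
  | inl p =>
    -- Since `δ^j x^{(k)} = τ^k (δ^j x)`, a bound for the unknowns costs only `k` more for their
    -- derivatives, uniformly in `j`.
    have h1 : HasOrderLE X.carrier (e + p.2) ((lie X.cartan)^[p.2] (iter δ (Sum.inl p.1) j)) :=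
      (he (Sum.inl p.1) j).iterate_lie_cartan p.2
    refine h1.congr ?_
    have h2 := h.iterate_comm (F := fun η => η (Sum.inl (p.1, 0)))
      (fun η _ => finAnalyticAt_coord _ η) j p.2
    rw [X.iterate_cartan] at h2
    exact h2.symm
  | inr j' => exact he (Sum.inr j') j

variable {M : Set (Space m q)}

/-- The coordinates of the flow depend globally on finitely many coordinates. -/
theorem HasLocalFlows.flowMap_eq_of_agree (hM : HasLocalFlows M δ) (hMX : M ⊆ X.carrier)
    {v : Coord m q} {E : ℕ} (hE : ∀ j, HasOrderLE X.carrier E ((lie δ)^[j] fun η => η v))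
    {η ζ : Space m q} (hη : η ∈ M) (hζ : ζ ∈ M) {s : ℝ} (hsη : s ∈ maxInterval M δ η)
    (hsζ : s ∈ maxInterval M δ ζ) (h : ∀ v, coordOrder v ≤ E → η v = ζ v) :
    flowMap M δ s η v = flowMap M δ s ζ v := by
  -- The Taylor coefficients in time are the `δ^k v`, so points with the same coordinates of order
  -- at most `E` have the same series. Analyticity in time carries equality over the common
  -- interval, with no connectedness of `M` needed.
  have key : ∀ ξ ∈ M, ∀ k, iteratedDeriv k (fun t => timeFlow M δ (cons t ξ) v) 0 =
      (lie δ)^[k] (fun η => η v) ξ := by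
    intro ξ hξ k
    have h0 : cons 0 ξ ∈ flowDomain M δ := ⟨hξ, hM.zero_mem hξ⟩
    rw [iteratedDeriv_time (F := fun e => timeFlow M δ e v) (hM.isOpen_maxInterval hξ)
      (fun t ht => (hM.flowAnalyticAt (e := cons t ξ) ⟨hξ, ht⟩).2 v) k 0 (hM.zero_mem hξ),
      hM.iterate_dt_timeFlow h0]
    exact congrArg _ (hM.flowMap_zero (η := ξ) hξ)
  exact eqOn_of_iteratedDeriv_eq (u := fun t => timeFlow M δ (cons t η) v)
    (w := fun t => timeFlow M δ (cons t ζ) v) (t := 0)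
    ((hM.ordConnected hη).inter (hM.ordConnected hζ)).isPreconnected
    ⟨hM.zero_mem hη, hM.zero_mem hζ⟩
    (fun t ht => ((hM.flowAnalyticAt (e := cons t η) ⟨hη, ht.1⟩).2 v).analyticAt_time)
    (fun t ht => ((hM.flowAnalyticAt (e := cons t ζ) ⟨hζ, ht.2⟩).2 v).analyticAt_time)
    (fun k => by rw [key η hη, key ζ hζ]; exact hE k η (hMX hη) ζ (hMX hζ) h) ⟨hsη, hsζ⟩

/-- The flow of an integrable symmetry consists of morphisms. -/
theorem HasLocalFlows.isMorphism (hM : HasLocalFlows M δ) (hMX : M ⊆ X.carrier)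
    (hδ : X.IsIntegrable δ) {U V : Set (Space m q)} (hU : IsOpen U) (hUM : U ⊆ M) (hV : IsOpen V)
    {s : ℝ} (hs : s ∈ flowDom M δ U) {φ : Space m q → Space m q}
    (hφ : EqOn φ (flowMap M δ s) U) (hUV : MapsTo φ U V) : X.IsMorphism U V φ := by
  obtain ⟨hsym, e, he⟩ := hδ
  have hφ' : ∀ η ∈ U, ∀ v, (fun ζ => φ ζ v) =ᶠ[𝓝 η] fun ζ => flowMap M δ s ζ v := fun η hη v => by
    filter_upwards [hU.mem_nhds hη] with ζ hζ
    rw [hφ hζ]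
  have ha : ∀ η ∈ U, ∀ v, FinAnalyticAt (fun ζ => φ ζ v) η := fun η hη v =>
    (hM.finAnalyticAt_flowMap (hUM hη) (hs η hη) v).congr (hφ' η hη v).symm
  -- Local analyticity is not enough: one finite set of coordinates must serve all of `U`.
  -- Integrability supplies it.
  have hc : ∀ v, IsAnalyticFun U fun η => φ η v := fun v => by
    refine isAnalyticFun_of_finAnalyticAt hU (fun η hη => ha η hη v)
      (coordsOfOrderLE m q (e + coordOrder v)) fun η hη ζ hζ h => ?_
    simp only [hφ hη, hφ hζ]
    exact hM.flowMap_eq_of_agree hMX (hasOrderLE_iterate_coord hsym he v) (hUM hη) (hUM hζ)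
      (hs η hη) (hs ζ hζ) fun u hu => h u (mem_coordsOfOrderLE.2 hu)
  refine ⟨hUV, fun F hF => hF.comp hU hV hUV hc, fun F hF η hη => ?_⟩
  have hFa := hF.finAnalyticAt hV (hUV hη)
  rw [lieD_eq_lie, lieD_eq_lie, lie_eq_dir, lie_eq_dir]
  change dir _ (fun ζ => F (φ ζ)) η = _
  rw [dir_comp hFa (ha η hη)]
  congr 1
  ext v
  rw [dir_congr (hφ' η hη v), hφ hη]
  exact hM.lie_cartan_flowMap hsym hMX (hUM hη) (hs η hη) v

end Global

end DiffietyFlow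

namespace DiffietyFlow

/-! ### Factorization through a submersion. -/

section ConstantRank

open ContDiff

/-- Near a point where `Y` is a submersion, a function whose differential vanishes on the kernel
of that of `Y` factors through `Y`. -/
theorem exists_analytic_factorization {E F : Type*} [NormedAddCommGroup E] [NormedSpace ℝ E]
    [FiniteDimensional ℝ E] [NormedAddCommGroup F] [NormedSpace ℝ F] [FiniteDimensional ℝ F]
    {Y : E → F} {w : E → ℝ} {p₀ : E} (hY : AnalyticAt ℝ Y p₀) (hw : AnalyticAt ℝ w p₀)
    (hsurj : Function.Surjective (fderiv ℝ Y p₀))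
    (hker : ∀ᶠ p in 𝓝 p₀, ∀ u, fderiv ℝ Y p u = 0 → fderiv ℝ w p u = 0) :
    ∃ φ : F → ℝ, AnalyticAt ℝ φ (Y p₀) ∧ ∀ᶠ p in 𝓝 p₀, w p = φ (Y p) := by
  have : CompleteSpace E := FiniteDimensional.complete ℝ E
  have : CompleteSpace F := FiniteDimensional.complete ℝ F
  let K : Submodule ℝ E := (fderiv ℝ Y p₀).ker
  obtain ⟨P, hP⟩ := Submodule.ClosedComplemented.of_finiteDimensional K
  let A : E →L[ℝ] F × K := (fderiv ℝ Y p₀).prod P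
  have hinj : A.ker = ⊥ := by
    rw [LinearMap.ker_eq_bot']
    intro u hu
    have h1 : fderiv ℝ Y p₀ u = 0 := congrArg Prod.fst hu
    have h2 : P u = 0 := congrArg Prod.snd hu
    have h3 := hP ⟨u, h1⟩
    rw [h2] at h3
    exact (congrArg Subtype.val h3).symm
  have hsur : A.range = ⊤ := by
    rw [LinearMap.range_eq_top]
    rintro ⟨y, k⟩
    obtain ⟨u, rfl⟩ := hsurj y
    refine ⟨u + ((k - P u : K) : E), ?_⟩
    have h1 : fderiv ℝ Y p₀ ((k - P u : K) : E) = 0 := (k - P u).2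
    have h2 := hP (k - P u)
    refine Prod.ext ?_ ?_
    · change fderiv ℝ Y p₀ (u + _) = _
      rw [map_add, h1, add_zero]
    · change P (u + _) = _
      rw [map_add, h2, add_sub_cancel]
  let e := ContinuousLinearEquiv.ofBijective A hinj hsur
  -- Completing `Y` by a projection onto the kernel of its differential gives local coordinates. In
  -- them the kernel hypothesis says that `w` has zero derivative in the variable of `K`.
  let Ψ : E → F × K := fun p => (Y p, P p)
  have hΨ : AnalyticAt ℝ Ψ p₀ := hY.prod (P.analyticAt p₀)
  have hΨd : HasFDerivAt Ψ (e : E →L[ℝ] F × K) p₀ :=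
    hY.differentiableAt.hasFDerivAt.prodMk P.hasFDerivAt
  have hΨω : ContDiffAt ℝ ω Ψ p₀ := hΨ.contDiffAt
  have hst := hΨω.hasStrictFDerivAt' hΨd (by simp)
  have hg : AnalyticAt ℝ (hΨω.localInverse hΨd (by simp)) (Ψ p₀) :=
    (hΨω.to_localInverse hΨd (by simp)).analyticAt
  have hleft : ∀ᶠ p in 𝓝 p₀, hΨω.localInverse hΨd (by simp) (Ψ p) = p := hst.eventually_left_inverse
  have hright : ∀ᶠ x in 𝓝 (Ψ p₀), Ψ (hΨω.localInverse hΨd (by simp) x) = x :=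
    hst.eventually_right_inverse
  have hg0 : hΨω.localInverse hΨd (by simp) (Ψ p₀) = p₀ := hleft.self_of_nhds
  set g := hΨω.localInverse hΨd (by simp)
  have hgt : Tendsto g (𝓝 (Ψ p₀)) (𝓝 p₀) := by
    have := hg.continuousAt.tendsto
    rwa [hg0] at this
  have hgood : ∀ᶠ x in 𝓝 (Ψ p₀), DifferentiableAt ℝ (fun x => w (g x)) x ∧
      ∀ k : K, fderiv ℝ (fun x => w (g x)) x (0, k) = 0 := by
    filter_upwards [hgt.eventually hY.eventually_analyticAt,
      hgt.eventually hw.eventually_analyticAt, hg.eventually_analyticAt,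
      hright.eventually_nhds, hgt.eventually hker] with x h1 h2 h3 h4 h5
    have hgd := h3.differentiableAt.hasFDerivAt
    have hwd := h2.differentiableAt.hasFDerivAt.comp x hgd
    refine ⟨hwd.differentiableAt, fun k => ?_⟩
    have e1 : fderiv ℝ (fun x => w (g x)) x = (fderiv ℝ w (g x)).comp (fderiv ℝ g x) := hwd.fderiv
    rw [e1]
    refine h5 _ ?_
    have hYd := h1.differentiableAt.hasFDerivAt.comp x hgd
    have hfst : HasFDerivAt (Y ∘ g) (ContinuousLinearMap.fst ℝ F K) x :=
      hasFDerivAt_fst.congr_of_eventuallyEq (h4.mono fun z hz => congrArg Prod.fst hz)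
    have := DFunLike.congr_fun (hYd.unique hfst) ((0, k) : F × K)
    exact this
  rw [show Ψ p₀ = (Y p₀, P p₀) from rfl, nhds_prod_eq] at hgood
  obtain ⟨B, hB, C, hC, hBC⟩ := Filter.eventually_prod_iff.1 hgood
  obtain ⟨ρ, hρ, hρC⟩ := Metric.eventually_nhds_iff_ball.1 hC
  refine ⟨fun y => w (g (y, P p₀)), ?_, ?_⟩
  · have h1 : AnalyticAt ℝ (fun x => w (g x)) (Y p₀, P p₀) :=
      AnalyticAt.fun_comp (g := w) (by change AnalyticAt ℝ w (g (Ψ p₀)); rwa [hg0]) hg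
    exact AnalyticAt.fun_comp (g := fun x => w (g x)) (f := fun y => (y, P p₀)) h1
      (analyticAt_id.prod analyticAt_const)
  · filter_upwards [hleft, hY.continuousAt.eventually hB,
      P.continuous.continuousAt.eventually (Metric.ball_mem_nhds (P p₀) hρ)] with p h1 h2 h3
    have hd : ∀ k ∈ Metric.ball (P p₀) ρ,
        HasFDerivAt (fun k => w (g (Y p, k))) (0 : K →L[ℝ] ℝ) k := by
      intro k hk
      obtain ⟨h4, h5⟩ := hBC h2 (hρC k hk)
      have := HasFDerivAt.comp (g := fun x => w (g x)) k h4.hasFDerivAt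
        (hasFDerivAt_prodMk_right (Y p) k)
      have h0 : (0 : K →L[ℝ] ℝ) = (fderiv ℝ (fun x => w (g x)) (Y p, k)).comp
          (ContinuousLinearMap.inr ℝ F K) := ContinuousLinearMap.ext fun k' => (h5 k').symm
      rw [h0]
      exact this
    have := Metric.isOpen_ball.is_const_of_fderiv_eq_zero
      (convex_ball (P p₀) ρ).isPreconnected
      (fun k hk => (hd k hk).differentiableAt.differentiableWithinAt)
      (fun k hk => (hd k hk).fderiv) h3 (Metric.mem_ball_self hρ)
    calc w p = w (g (Y p, P p)) := by rw [show (Y p, P p) = Ψ p from rfl, h1]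
      _ = _ := this

end ConstantRank

/-! ### Independence of rows through the Gram determinant. -/

section Gram

open Matrix

/-- The rows of a real matrix are independent when their Gram determinant does not vanish. -/
theorem linearIndependent_row_iff_gram {κ α : Type*} [Fintype κ] [DecidableEq κ] [Fintype α]
    (J : Matrix κ α ℝ) : LinearIndependent ℝ J.row ↔ (J * Jᵀ).det ≠ 0 := by
  rw [← vecMul_injective_iff]
  constructor
  · intro h
    have := (PosDef.mul_conjTranspose_self J h).det_pos.ne'
    rwa [conjTranspose_eq_transpose_of_trivial] at this
  · intro h
    have hu : IsUnit (J * Jᵀ) := (isUnit_iff_isUnit_det _).2 (isUnit_iff_ne_zero.2 h)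
    have h1 := vecMul_injective_of_isUnit hu
    intro a b hab
    apply h1
    change a ᵥ* (J * Jᵀ) = b ᵥ* (J * Jᵀ)
    rw [← vecMul_vecMul, ← vecMul_vecMul]
    exact congrArg (· ᵥ* Jᵀ) hab

theorem mulVec_surjective_of_gram {κ α : Type*} [Fintype κ] [DecidableEq κ] [Fintype α]
    (J : Matrix κ α ℝ) (h : (J * Jᵀ).det ≠ 0) (y : κ → ℝ) : ∃ u, J *ᵥ u = y :=
  ⟨Jᵀ *ᵥ ((J * Jᵀ)⁻¹ *ᵥ y), by
    rw [mulVec_mulVec, mulVec_mulVec,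
      mul_nonsing_inv _ (isUnit_iff_ne_zero.2 h), one_mulVec]⟩

theorem analyticAt_det {κ E : Type*} [Fintype κ] [DecidableEq κ] [NormedAddCommGroup E]
    [NormedSpace ℝ E] {A : E → Matrix κ κ ℝ} {p : E} (hA : ∀ i j, AnalyticAt ℝ (fun p => A p i j) p) :
    AnalyticAt ℝ (fun p => (A p).det) p := by
  simp only [det_apply, zsmul_eq_mul, Units.smul_def]
  exact Finset.analyticAt_fun_sum _ fun τ _ => analyticAt_const.mul
    (Finset.analyticAt_fun_prod _ fun i _ => hA _ _)

end Gram

/-! ### Existence of a regular domain. -/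

section RegularDomain

open Matrix

variable {m q : ℕ} {X : Diffiety m q} {δ : VectorField m q}

/-- The differentials of the iterates `δ^k z`, `k < r z`, at the point `η`. -/
noncomputable def iterDifferentials (δ : VectorField m q) (r : Var m q → ℕ) (η : Space m q)
    (p : Σ z : Var m q, Fin (r z)) (v : Coord m q) : ℝ :=
  partialDeriv v (iter δ p.1 p.2) η

/-- The only index not already present is `(z, r z)`. Sending it to `none` embeds the enlarged
family in the independent family indexed by `Option`. -/
theorem linearIndependent_update {r : Var m q → ℕ} {η : Space m q} {z : Var m q}
    (hr : LinearIndependent ℝ (iterDifferentials δ r η))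
    (hz : (fun v => partialDeriv v (iter δ z (r z)) η) ∉
      Submodule.span ℝ (range (iterDifferentials δ r η))) :
    LinearIndependent ℝ (iterDifferentials δ (Function.update r z (r z + 1)) η) := by
  have h1 := linearIndependent_option'.2 ⟨hr, hz⟩
  have hlt : ∀ p : (Σ z' : Var m q, Fin (Function.update r z (r z + 1) z')),
      ¬ (p.2 : ℕ) < r p.1 → p.1 = z ∧ (p.2 : ℕ) = r z := by
    rintro ⟨z', k⟩ hk
    have hk2 : (k : ℕ) < Function.update r z (r z + 1) z' := k.2
    have hk1 : ¬ (k : ℕ) < r z' := hk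
    by_cases hz' : z' = z
    · have e1 : Function.update r z (r z + 1) z' = r z + 1 := by rw [hz', Function.update_self]
      have e2 : r z' = r z := by rw [hz']
      exact ⟨hz', show (k : ℕ) = r z by omega⟩
    · exact absurd (hk2.trans_eq (Function.update_of_ne hz' _ _)) hk1
  let f : (Σ z' : Var m q, Fin (Function.update r z (r z + 1) z')) →
      Option (Σ z' : Var m q, Fin (r z')) := fun p =>
    if h : (p.2 : ℕ) < r p.1 then some ⟨p.1, ⟨p.2, h⟩⟩ else none
  have hf : Function.Injective f := by
    rintro ⟨z₁, k₁⟩ ⟨z₂, k₂⟩ h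
    have key : z₁ = z₂ ∧ (k₁ : ℕ) = k₂ := by
      simp only [f] at h
      split_ifs at h with ha hb hb
      · simp only [Option.some.injEq, Sigma.mk.injEq] at h
        obtain ⟨rfl, h⟩ := h
        exact ⟨rfl, by simpa using h⟩
      · have a := hlt ⟨z₁, k₁⟩ ha
        have b := hlt ⟨z₂, k₂⟩ hb
        exact ⟨a.1.trans b.1.symm, a.2.trans b.2.symm⟩
    obtain ⟨rfl, h⟩ := key
    rw [Fin.ext h]
  have hcomp : iterDifferentials δ (Function.update r z (r z + 1)) η =
      (fun o => Option.casesOn' o (fun v => partialDeriv v (iter δ z (r z)) η)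
        (iterDifferentials δ r η)) ∘ f := by
    ext ⟨z', k⟩ v
    by_cases h : (k : ℕ) < r z'
    · simp [f, h, iterDifferentials]
    · have h2 : z' = z := (hlt ⟨z', k⟩ h).1
      have h3 : (k : ℕ) = r z := (hlt ⟨z', k⟩ h).2
      simp [f, iterDifferentials, h2, h3]
  rw [hcomp]
  exact h1.comp f hf

variable {S : Finset (Coord m q)} {H : Var m q → ℕ → (S → ℝ) → ℝ}

/-- The Jacobian matrix of the iterates, in terms of finitely many coordinates. -/
noncomputable def jacobian (H : Var m q → ℕ → (S → ℝ) → ℝ) (r : Var m q → ℕ) (p : S → ℝ) :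
    Matrix (Σ z : Var m q, Fin (r z)) S ℝ :=
  fun i v => fderiv ℝ (H i.1 i.2) p fun u => if (u : Coord m q) = v then 1 else 0

theorem iterDifferentials_eq (hH : ∀ z k, AnalyticOnNhd ℝ (H z k) (S.restrict '' X.carrier))
    (hHi : ∀ z k, ∀ η ∈ X.carrier, iter δ z k η = H z k (S.restrict η)) {η : Space m q}
    (hη : η ∈ X.carrier) (z : Var m q) (k : ℕ) (v : Coord m q) :
    partialDeriv v (iter δ z k) η = fderiv ℝ (H z k) (S.restrict η) fun u => if (u : Coord m q) = v
      then 1 else 0 :=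
  pderiv_eq (hH z k _ ⟨η, hη, rfl⟩).differentiableAt
    (EqOn.eventuallyEq_of_mem (hHi z k) (X.isOpen_carrier.mem_nhds hη)) v

/-- The differentials vanish along coordinates outside `S`, so they are the rows of the finite
Jacobian extended by zero, an injective linear operation. -/
theorem linearIndependent_iff_gram
    (hH : ∀ z k, AnalyticOnNhd ℝ (H z k) (S.restrict '' X.carrier))
    (hHi : ∀ z k, ∀ η ∈ X.carrier, iter δ z k η = H z k (S.restrict η)) {η : Space m q}
    (hη : η ∈ X.carrier) (r : Var m q → ℕ) :
    LinearIndependent ℝ (iterDifferentials δ r η) ↔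
      (jacobian H r (S.restrict η) * (jacobian H r (S.restrict η))ᵀ).det ≠ 0 := by
  classical
  rw [← linearIndependent_row_iff_gram]
  let T : (S → ℝ) →ₗ[ℝ] (Coord m q → ℝ) :=
    LinearMap.pi fun v => if hv : v ∈ S then LinearMap.proj ⟨v, hv⟩ else 0
  have hT : LinearMap.ker T = ⊥ := by
    rw [LinearMap.ker_eq_bot']
    intro u hu
    ext v
    have := congrFun hu v
    simpa [T] using this
  have : iterDifferentials δ r η = T ∘ (jacobian H r (S.restrict η)).row := by
    ext p v
    simp only [iterDifferentials, iterDifferentials_eq hH hHi hη, Function.comp_apply]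
    by_cases hv : v ∈ S
    · simp [T, hv, jacobian, Matrix.row]
    · have h0 : (fun u : S => if (u : Coord m q) = v then (1 : ℝ) else 0) = 0 := by
        ext u
        have : (u : Coord m q) ≠ v := fun h => hv (h ▸ u.2)
        simp [this]
      simp [T, hv, h0]
  rw [this, T.linearIndependent_iff hT]

theorem jacobian_mulVec (r : Var m q → ℕ) (p : S → ℝ) (u : S → ℝ) (i : Σ z : Var m q, Fin (r z)) :
    (jacobian H r p *ᵥ u) i = fderiv ℝ (H i.1 i.2) p u := by
  classical
  have : u = ∑ v : S, u v • fun x : S => if (x : Coord m q) = v then (1 : ℝ) else 0 := by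
    ext x
    simp [Finset.sum_apply]
  conv_rhs => rw [this, map_sum]
  simp only [mulVec, dotProduct, jacobian, map_smul, smul_eq_mul]
  exact Finset.sum_congr rfl fun v _ => mul_comm _ _

/-- Maximal orders `r` such that the iterates of order less than `r` are generically
independent. -/
theorem exists_maximal_orders
    (hH : ∀ z k, AnalyticOnNhd ℝ (H z k) (S.restrict '' X.carrier))
    (hHi : ∀ z k, ∀ η ∈ X.carrier, iter δ z k η = H z k (S.restrict η)) :
    ∃ r : Var m q → ℕ, (∃ η ∈ X.carrier, LinearIndependent ℝ (iterDifferentials δ r η)) ∧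
      ∀ r' : Var m q → ℕ, (∃ η ∈ X.carrier, LinearIndependent ℝ (iterDifferentials δ r' η)) →
        ∑ z, r' z ≤ ∑ z, r z := by
  let N : Set ℕ := {n | ∃ r : Var m q → ℕ,
    (∃ η ∈ X.carrier, LinearIndependent ℝ (iterDifferentials δ r η)) ∧ ∑ z, r z = n}
  have hne : N.Nonempty := by
    obtain ⟨η, hη⟩ := X.isConnected_carrier.nonempty
    refine ⟨0, 0, ⟨η, hη, ?_⟩, by simp⟩
    have : IsEmpty (Σ z : Var m q, Fin ((0 : Var m q → ℕ) z)) :=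
      ⟨fun p => Fin.elim0 (show Fin 0 from p.2)⟩
    exact linearIndependent_empty_type
  have hbdd : BddAbove N := by
    -- Independent differentials are independent vectors of `ℝ^S`, whatever the orders `r`.
    refine ⟨S.card, ?_⟩
    rintro _ ⟨r, ⟨η, hη, hli⟩, rfl⟩
    rw [linearIndependent_iff_gram hH hHi hη, ← linearIndependent_row_iff_gram] at hli
    have := hli.fintype_card_le_finrank
    simpa using this
  obtain ⟨r, hr, hsum⟩ := Nat.sSup_mem hne hbdd
  exact ⟨r, hr, fun r' hr' => hsum ▸ le_csSup hbdd ⟨r', hr', rfl⟩⟩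

theorem analyticAt_gram (r : Var m q → ℕ) {p : S → ℝ} (hH : ∀ z k, AnalyticAt ℝ (H z k) p) :
    AnalyticAt ℝ (fun p => (jacobian H r p * (jacobian H r p)ᵀ).det) p := by
  refine analyticAt_det fun i j => ?_
  simp only [mul_apply, transpose_apply]
  exact Finset.analyticAt_fun_sum _ fun v _ =>
    (analyticAt_fderiv_apply (hH _ _) _).mul (analyticAt_fderiv_apply (hH _ _) _)

/-- Where the iterates of order less than `r` are independent, and the next ones are dependent on
them, the latter are analytic functions of the former. -/
theorem exists_isReduction
    (hH : ∀ z k, AnalyticOnNhd ℝ (H z k) (S.restrict '' X.carrier))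
    (hHi : ∀ z k, ∀ η ∈ X.carrier, iter δ z k η = H z k (S.restrict η)) {r : Var m q → ℕ}
    (hr : ∀ η ∈ X.carrier, LinearIndependent ℝ (iterDifferentials δ r η) → ∀ z,
      (fun v => partialDeriv v (iter δ z (r z)) η) ∈
        Submodule.span ℝ (range (iterDifferentials δ r η))) {η₀ : Space m q}
    (hη₀ : η₀ ∈ X.carrier) (hli : LinearIndependent ℝ (iterDifferentials δ r η₀))
    (hopen : ∀ᶠ η in 𝓝 η₀, LinearIndependent ℝ (iterDifferentials δ r η)) :
    ∃ φ, IsReduction δ r η₀ φ := by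
  classical
  let Y : (S → ℝ) → (Σ z : Var m q, Fin (r z)) → ℝ := fun p i => H i.1 i.2 p
  have hmem : ∀ η ∈ X.carrier, S.restrict η ∈ S.restrict '' X.carrier := fun η hη => ⟨η, hη, rfl⟩
  have hYH : ∀ η ∈ X.carrier, iterTuple δ r η = Y (S.restrict η) := fun η hη =>
    funext fun i => hHi _ _ η hη
  have hYa : AnalyticAt ℝ Y (S.restrict η₀) :=
    AnalyticAt.pi fun i => hH _ _ _ (hmem η₀ hη₀)
  have hYd : ∀ p ∈ S.restrict '' X.carrier, ∀ u,
      fderiv ℝ Y p u = jacobian H r p *ᵥ u := by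
    intro p hp u
    ext i
    rw [jacobian_mulVec, fderiv_pi fun i => (hH _ _ _ hp).differentiableAt]
    rfl
  obtain ⟨σ, -, hσc, hσ, hση⟩ := exists_section S η₀
  have key : ∀ z, ∃ φ : ((Σ z : Var m q, Fin (r z)) → ℝ) → ℝ, AnalyticAt ℝ φ (Y (S.restrict η₀)) ∧
      ∀ᶠ p in 𝓝 (S.restrict η₀), H z (r z) p = φ (Y p) := by
    intro z
    refine exists_analytic_factorization hYa (hH _ _ _ (hmem η₀ hη₀)) (fun y => ?_) ?_
    · obtain ⟨u, hu⟩ := mulVec_surjective_of_gram _ ((linearIndependent_iff_gram hH hHi hη₀ r).1 hli) y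
      exact ⟨u, by rw [hYd _ (hmem η₀ hη₀), hu]⟩
    · have hσt : Tendsto σ (𝓝 (S.restrict η₀)) (𝓝 η₀) := by
        have := hσc.tendsto (S.restrict η₀)
        rwa [hση] at this
      filter_upwards [hσt.eventually hopen,
        hσt.eventually (X.isOpen_carrier.mem_nhds hη₀)] with p h1 h2 u hu
      have hp := hmem _ h2
      rw [hσ] at hp
      rw [hYd p hp] at hu
      -- `L` contracts a differential with the vector `u`. It kills the differentials of the tuple
      -- because `u` is in the kernel, hence their span, which contains the differential of `δ^{r z}
      -- z`.
      let L : (Coord m q → ℝ) →ₗ[ℝ] ℝ := ∑ v : S, u v • LinearMap.proj (v : Coord m q)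
      have hL : ∀ z k, L (fun v => partialDeriv v (iter δ z k) (σ p)) = fderiv ℝ (H z k) p u := by
        intro z k
        have hu' : u = ∑ v : S, u v • fun x : S => if (x : Coord m q) = v then (1 : ℝ) else 0 := by
          ext x
          simp [Finset.sum_apply]
        conv_rhs => rw [hu', map_sum]
        simp only [L, LinearMap.sum_apply, LinearMap.smul_apply, LinearMap.proj_apply,
          iterDifferentials_eq hH hHi h2, hσ, map_smul]
      have hspan : Submodule.span ℝ (range (iterDifferentials δ r (σ p))) ≤ LinearMap.ker L := by
        rw [Submodule.span_le]
        rintro _ ⟨i, rfl⟩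
        refine (hL i.1 i.2).trans ?_
        rw [← jacobian_mulVec, hu]; rfl
      rw [← hL]
      exact hspan (hr _ h2 h1 z)
  choose φ hφ hφ' using key
  refine ⟨φ, fun z => ⟨by rw [hYH η₀ hη₀]; exact hφ z, ?_⟩⟩
  filter_upwards [(continuous_restrict S).continuousAt.eventually (hφ' z),
    X.isOpen_carrier.mem_nhds hη₀] with η h1 h2
  rw [hHi _ _ η h2, hYH η h2]
  exact h1

/-- An integrable symmetry has a regular domain. -/
theorem exists_isRegularDomain (hδ : X.IsIntegrable δ) : ∃ 𝔘 r, X.IsRegularDomain δ 𝔘 r := by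
  classical
  obtain ⟨hsym, e, he⟩ := hδ
  obtain ⟨S, hS⟩ : ∃ S : Finset (Coord m q), ∀ v, v ∈ S ↔ coordOrder v ≤ e :=
    ⟨_, fun v => mem_coordsOfOrderLE⟩
  have hex := fun (z : Var m q) (k : ℕ) =>
    exists_analytic_expression (F := iter δ z k) X.isOpen_carrier
      (fun η hη => (finAnalyticAt_coord _ η).iterate_lie (fun v => hsym.finAnalyticAt hη v) k)
      S fun η hη ζ hζ h => he z k η hη ζ hζ fun v hv => h v ((hS v).2 hv)
  choose H hH hHi using hex
  obtain ⟨r, ⟨η₁, hη₁, hli₁⟩, hmax⟩ := exists_maximal_orders hH hHi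
  let Δ : (S → ℝ) → ℝ := fun p => (jacobian H r p * (jacobian H r p)ᵀ).det
  have hΔ : AnalyticOnNhd ℝ Δ (S.restrict '' X.carrier) := fun p hp =>
    analyticAt_gram r fun z k => hH z k p hp
  have hiff : ∀ η ∈ X.carrier, (LinearIndependent ℝ (iterDifferentials δ r η) ↔
      Δ (S.restrict η) ≠ 0) := fun η hη => linearIndependent_iff_gram hH hHi hη r
  let 𝔘 : Set (Space m q) := {η | η ∈ X.carrier ∧ LinearIndependent ℝ (iterDifferentials δ r η)}
  have hev : ∀ η ∈ 𝔘, ∀ᶠ ζ in 𝓝 η, ζ ∈ 𝔘 := by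
    rintro η ⟨hη, hli⟩
    have hc : ContinuousAt (fun ζ => Δ (S.restrict ζ)) η :=
      ContinuousAt.comp (f := fun ζ : Space m q => S.restrict ζ)
        (hΔ _ ⟨η, hη, rfl⟩).continuousAt (continuous_restrict S).continuousAt
    filter_upwards [X.isOpen_carrier.mem_nhds hη,
      hc.eventually_ne ((hiff η hη).1 hli)] with ζ h1 h2
    exact ⟨h1, (hiff ζ h1).2 h2⟩
  refine ⟨𝔘, r, isOpen_iff_mem_nhds.2 hev, fun η hη => hη.1, ?_, fun η hη => hη.2,
    fun η hη => exists_isReduction hH hHi ?_ hη.1 hη.2 ((hev η hη).mono fun ζ hζ => hζ.2)⟩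
  · intro η hη
    by_contra hcl
    rw [mem_closure_iff_frequently, not_frequently] at hcl
    -- If no point of `𝔘` is close to `η`, the Gram determinant vanishes near `S.restrict η`, then
    -- on the whole connected image by the identity theorem. This contradicts independence at `η₁`.
    have hzero : ∀ᶠ p in 𝓝 (S.restrict η), Δ p = 0 := by
      obtain ⟨σ, -, hσc, hσ, hση⟩ := exists_section S η
      have hσt : Tendsto σ (𝓝 (S.restrict η)) (𝓝 η) := by
        have := hσc.tendsto (S.restrict η)
        rwa [hση] at this
      filter_upwards [hσt.eventually hcl, hσt.eventually (X.isOpen_carrier.mem_nhds hη)] with p h1 h2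
      by_contra h3
      rw [← hσ p] at h3
      exact h1 ⟨h2, (hiff _ h2).2 h3⟩
    have hconn : IsPreconnected (S.restrict '' X.carrier) :=
      X.isConnected_carrier.isPreconnected.image _ (continuous_restrict S).continuousOn
    exact (hiff η₁ hη₁).1 hli₁ (hΔ.eqOn_zero_of_preconnected_of_eventuallyEq_zero hconn
      ⟨η, hη, rfl⟩ hzero ⟨η₁, hη₁, rfl⟩)
  · intro ζ hζ hli z
    by_contra hz
    -- A differential outside the span would allow `r z` to grow by one, against the maximality of
    -- the sum.
    have := hmax _ ⟨ζ, hζ, linearIndependent_update hli hz⟩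
    rw [Finset.sum_update_of_mem (Finset.mem_univ z),
      ← Finset.add_sum_erase Finset.univ r (Finset.mem_univ z), Finset.sdiff_singleton_eq_erase] at this
    omega

end RegularDomain

end DiffietyFlow

namespace DiffietyFlow

/-! ### The identity theorem in infinitely many coordinates. -/

section Identity

variable {ι : Type*}

/-- Two analytic germs that coincide at points arbitrarily close to `η` coincide at `η`. -/
theorem FinAnalyticAt.eventuallyEq_of_frequently {F G : (ι → ℝ) → ℝ} {η : ι → ℝ}
    (hF : FinAnalyticAt F η) (hG : FinAnalyticAt G η) (h : ∃ᶠ ζ in 𝓝 η, F =ᶠ[𝓝 ζ] G) :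
    F =ᶠ[𝓝 η] G := by
  obtain ⟨S, f, hf⟩ := FinAnalyticAt.exists_common (κ := Bool) (F := fun b => bif b then F else G)
    (η := η) (by rintro (_ | _) <;> assumption)
  have hFf := hf true
  have hGf := hf false
  simp only [cond_true, cond_false] at hFf hGf
  obtain ⟨ρ, hρ, hρ'⟩ := Metric.eventually_nhds_iff_ball.1
    (hFf.1.eventually_analyticAt.and hGf.1.eventually_analyticAt)
  have hball : ∀ᶠ ζ in 𝓝 η, (S.restrict ζ : S → ℝ) ∈ Metric.ball (S.restrict η : S → ℝ) ρ :=
    (continuous_restrict S).continuousAt.eventually (Metric.ball_mem_nhds _ hρ)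
  obtain ⟨ζ, h1, h2, h3, h4⟩ := (h.and_eventually
    (hball.and (hFf.2.eventuallyEq_nhds.and hGf.2.eventuallyEq_nhds))).exists
  obtain ⟨σ, -, hσc, hσ, hσζ⟩ := exists_section S ζ
  have hσt : Tendsto σ (𝓝 (S.restrict ζ)) (𝓝 ζ) := by
    have := hσc.tendsto (S.restrict ζ)
    rwa [hσζ] at this
  have hfg : f true =ᶠ[𝓝 (S.restrict ζ)] f false := by
    filter_upwards [hσt.eventually ((h3.symm.trans h1).trans h4)] with p hp
    rwa [hσ] at hp
  -- In common finite coordinates both germs are analytic on one ball around the limit point.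
  -- Equality near a point of that ball extends to all of it.
  have key := AnalyticOnNhd.eqOn_of_preconnected_of_eventuallyEq (fun p hp => (hρ' p hp).1)
    (fun p hp => (hρ' p hp).2) (convex_ball (S.restrict η) ρ).isPreconnected h2 hfg
  filter_upwards [hFf.2, hGf.2, hball] with ξ a b c
  rw [a, b, key c]

/-- The identity theorem on preconnected sets. -/
theorem eventuallyEq_of_isPreconnected {F G : (ι → ℝ) → ℝ} {W : Set (ι → ℝ)}
    (hW : IsPreconnected W) (hF : ∀ η ∈ W, FinAnalyticAt F η) (hG : ∀ η ∈ W, FinAnalyticAt G η)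
    {ζ : ι → ℝ} (hζ : ζ ∈ W) (h : F =ᶠ[𝓝 ζ] G) {η : ι → ℝ} (hη : η ∈ W) : F =ᶠ[𝓝 η] G :=
  hW.subset_of_closure_inter_subset (u := {η | F =ᶠ[𝓝 η] G}) isOpen_setOfPred_eventually_nhds
    ⟨ζ, hζ, h⟩ (fun η hη => (hF η hη.2).eventuallyEq_of_frequently (hG η hη.2)
      (mem_closure_iff_frequently.1 hη.1)) hη

end Identity

/-! ### The pseudogroup of flow mappings and gluing. -/

section Pseudogroup

variable {m q : ℕ} {X : Diffiety m q} {δ : VectorField m q} {M : Set (Space m q)}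

theorem Diffiety.IsRegularDomain.hasLocalFlows {r : Var m q → ℕ} (hM : X.IsRegularDomain δ M r)
    (hδ : X.IsSymmetry δ) : HasLocalFlows M δ where
  isOpen := hM.isOpen
  analytic _ hη v := hδ.finAnalyticAt (hM.subset hη) v
  local_flow η₀ hη₀ := by
    obtain ⟨φ, hφ⟩ := hM.reduction η₀ hη₀
    exact exists_local_flow hδ (hM.subset hη₀) hφ hM.isOpen hη₀ hM.subset

/-- A symmetry that does not vanish identically vanishes on no nonempty open set. -/
theorem Diffiety.IsSymmetry.exists_ne_zero (hδ : X.IsSymmetry δ)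
    (hne : ∃ η ∈ X.carrier, ∃ v, δ v η ≠ 0) {U : Set (Space m q)} (hU : IsOpen U)
    (hUX : U ⊆ X.carrier) (hUne : U.Nonempty) : ∃ ζ ∈ U, ∃ v, δ v ζ ≠ 0 := by
  obtain ⟨η, hη, v, hv⟩ := hne
  obtain ⟨ζ, hζ⟩ := hUne
  by_contra! hcon
  refine hv (eventuallyEq_of_isPreconnected (G := fun _ => 0) X.isConnected_carrier.isPreconnected
    (fun η hη => hδ.finAnalyticAt hη v) (fun η _ => finAnalyticAt_const _ η) (hUX hζ) ?_
    hη).self_of_nhds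
  filter_upwards [hU.mem_nhds hζ] with ξ hξ using hcon ξ hξ v

/-- Near `η`, the map `φ` is the flow mapping with parameter `s`. -/
def IsFlowGerm (M : Set (Space m q)) (δ : VectorField m q) (φ : Space m q → Space m q)
    (s : ℝ) (η : Space m q) : Prop :=
  s ∈ maxInterval M δ η ∧ φ =ᶠ[𝓝 η] flowMap M δ s

namespace HasLocalFlows

variable (h : HasLocalFlows M δ)
include h

/-- Describing the image as a preimage under the backward flow makes its openness a matter of
continuity. -/
theorem image_flowMap {U : Set (Space m q)} (hUM : U ⊆ M) {s : ℝ} (hs : s ∈ flowDom M δ U) :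
    flowMap M δ s '' U = {ζ ∈ M | -s ∈ maxInterval M δ ζ ∧ flowMap M δ (-s) ζ ∈ U} := by
  ext ζ
  constructor
  · rintro ⟨η, hη, rfl⟩
    refine ⟨h.flowMap_mem (hUM hη) (hs η hη), h.neg_mem_maxInterval_flowMap (hUM hη) (hs η hη), ?_⟩
    rwa [h.flowMap_neg_flowMap (hUM hη) (hs η hη)]
  · rintro ⟨hζ, hsζ, hmem⟩
    refine ⟨_, hmem, ?_⟩
    have := h.flowMap_neg_flowMap hζ hsζ
    rwa [neg_neg] at this

theorem isOpen_image_flowMap {U : Set (Space m q)} (hU : IsOpen U) (hUM : U ⊆ M) {s : ℝ}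
    (hs : s ∈ flowDom M δ U) : IsOpen (flowMap M δ s '' U) := by
  rw [h.image_flowMap hUM hs, isOpen_iff_mem_nhds]
  rintro ζ ⟨hζ, hsζ, hmem⟩
  filter_upwards [h.isOpen.mem_nhds hζ, h.eventually_mem_maxInterval hζ hsζ,
    (h.continuousAt_flowMap hζ hsζ).eventually (hU.mem_nhds hmem)] with ξ a b c
  exact ⟨a, b, c⟩

theorem mapsTo_flowMap {U : Set (Space m q)} (hUM : U ⊆ M) {s : ℝ} (hs : s ∈ flowDom M δ U) :
    MapsTo (flowMap M δ s) U M := fun η hη => h.flowMap_mem (hUM hη) (hs η hη)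

theorem zero_mem_flowDom {U : Set (Space m q)} (hUM : U ⊆ M) : (0 : ℝ) ∈ flowDom M δ U :=
  fun _ hη => h.zero_mem (hUM hη)

theorem flowDom_image {U : Set (Space m q)} (hUM : U ⊆ M) {s : ℝ} (hs : s ∈ flowDom M δ U) :
    flowDom M δ (flowMap M δ s '' U) = {t | s + t ∈ flowDom M δ U} := by
  ext t
  constructor
  · exact fun ht η hη =>
      (h.mem_maxInterval_flowMap (hUM hη) (hs η hη)).1 (ht _ (mem_image_of_mem _ hη))
  · rintro ht _ ⟨η, hη, rfl⟩
    exact (h.mem_maxInterval_flowMap (hUM hη) (hs η hη)).2 (ht η hη)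

theorem neg_mem_flowDom_image {U : Set (Space m q)} (hUM : U ⊆ M) {s : ℝ}
    (hs : s ∈ flowDom M δ U) : -s ∈ flowDom M δ (flowMap M δ s '' U) := by
  rw [h.flowDom_image hUM hs]
  change s + -s ∈ flowDom M δ U
  rw [add_neg_cancel]
  exact h.zero_mem_flowDom hUM

theorem isConnected_flowDom {U : Set (Space m q)} (hUM : U ⊆ M) :
    IsConnected (flowDom M δ U) := by
  have : (flowDom M δ U).OrdConnected := ⟨fun _ hx _ hy _ hz η hη =>
    (h.ordConnected (hUM hη)).out (hx η hη) (hy η hη) hz⟩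
  exact ⟨⟨0, h.zero_mem_flowDom hUM⟩, this.isPreconnected⟩

theorem isIso (hMX : M ⊆ X.carrier) (hδ : X.IsIntegrable δ) {U : Set (Space m q)} (hU : IsOpen U)
    (hUM : U ⊆ M) {s : ℝ} (hs : s ∈ flowDom M δ U) {φ : Space m q → Space m q}
    (hφ : EqOn φ (flowMap M δ s) U) : X.IsIso U (φ '' U) φ := by
  have himg : φ '' U = flowMap M δ s '' U := hφ.image_eq
  have hV : IsOpen (φ '' U) := himg ▸ h.isOpen_image_flowMap hU hUM hs
  have hVM : φ '' U ⊆ M := himg ▸ (h.mapsTo_flowMap hUM hs).image_subset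
  have hs' : -s ∈ flowDom M δ (φ '' U) := himg ▸ h.neg_mem_flowDom_image hUM hs
  have hinv : LeftInvOn (flowMap M δ (-s)) φ U := fun η hη => by
    rw [hφ hη, h.flowMap_neg_flowMap (hUM hη) (hs η hη)]
  refine ⟨hU, hV, h.isMorphism hMX hδ hU hUM hV hs hφ (mapsTo_image φ U), flowMap M δ (-s),
    h.isMorphism hMX hδ hV hVM hU hs' (fun _ _ => rfl) ?_, hinv, ?_⟩
  · rintro _ ⟨η, hη, rfl⟩
    rwa [hinv hη]
  · rintro _ ⟨η, hη, rfl⟩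
    rw [hinv hη]

theorem isPseudogroup (hMX : M ⊆ X.carrier) (hδ : X.IsIntegrable δ) :
    X.IsPseudogroup M (flowPseudogroup M δ) where
  congr U φ ψ := by
    rintro ⟨hU, hUM, s, hs, hφ⟩ heq
    exact ⟨hU, hUM, s, hs, heq.symm.trans hφ⟩
  iso U φ := by
    rintro ⟨hU, hUM, s, hs, hφ⟩
    refine ⟨hUM, ?_, h.isIso hMX hδ hU hUM hs hφ⟩
    rw [hφ.image_eq]
    exact (h.mapsTo_flowMap hUM hs).image_subset
  cover η hη := ⟨M, id, hη, h.isOpen, Subset.rfl, 0, h.zero_mem_flowDom Subset.rfl,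
    fun _ hζ => (h.flowMap_zero hζ).symm⟩
  restriction U φ W := by
    rintro ⟨-, hUM, s, hs, hφ⟩ hW hWU
    exact ⟨hW, hWU.trans hUM, s, fun η hη => hs η (hWU hη), hφ.mono hWU⟩
  composition U φ V ψ := by
    rintro ⟨hU, hUM, s, hs, hφ⟩ ⟨hV, -, t, ht, hψ⟩ -
    have hst : ∀ η ∈ U ∩ φ ⁻¹' V, s + t ∈ maxInterval M δ η := by
      rintro η ⟨hη, hηV⟩
      have := ht _ hηV
      rwa [hφ hη, h.mem_maxInterval_flowMap (hUM hη) (hs η hη)] at this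
    refine ⟨?_, inter_subset_left.trans hUM, s + t, hst, ?_⟩
    · have hc : ContinuousOn φ U := fun η hη =>
        (h.continuousAt_flowMap (hUM hη) (hs η hη)).continuousWithinAt.congr
          (fun ζ hζ => hφ hζ) (hφ hη)
      exact hc.isOpen_inter_preimage hU hV
    · intro η hη
      rw [Function.comp_apply, hψ hη.2, hφ hη.1,
        h.flowMap_flowMap (hUM hη.1) (hs η hη.1) (hst η hη)]
  identity U hU hUM := ⟨hU, hUM, 0, h.zero_mem_flowDom hUM,
    fun _ hζ => (h.flowMap_zero (hUM hζ)).symm⟩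
  inverse U φ ψ := by
    rintro ⟨hU, hUM, s, hs, hφ⟩ hψ
    rw [hφ.image_eq]
    refine ⟨h.isOpen_image_flowMap hU hUM hs, (h.mapsTo_flowMap hUM hs).image_subset, -s,
      h.neg_mem_flowDom_image hUM hs, ?_⟩
    rintro _ ⟨η, hη, rfl⟩
    rw [h.flowMap_neg_flowMap (hUM hη) (hs η hη), ← hφ hη, hψ hη]

/-- The flow moves the points where the field does not vanish to such points. -/
theorem exists_ne_zero_flowMap {η : Space m q} (hη : η ∈ M) (hv : ∃ v, δ v η ≠ 0) {s : ℝ}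
    (hs : s ∈ maxInterval M δ η) : ∃ v, δ v (flowMap M δ s η) ≠ 0 := by
  by_contra! hcon
  -- At a zero of the field the constant curve is the integral curve. Flowing back by `-s` would
  -- then identify `η` with this zero.
  have hc : IsFlowCurve M δ (flowMap M δ s η) univ fun _ => flowMap M δ s η :=
    ⟨isOpen_univ, ordConnected_univ, mem_univ _, rfl, fun _ _ => h.flowMap_mem hη hs,
      fun t _ v => by rw [hcon v]; exact hasDerivAt_const t _⟩
  have h1 := h.eq_flowMap hc (mem_univ (-s))
  rw [h.flowMap_neg_flowMap hη hs] at h1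
  obtain ⟨v, hv⟩ := hv
  exact hv (h1 ▸ hcon v)

/-- The integral curves from the points where the field does not vanish are locally injective. -/
theorem exists_injOn_curve {η : Space m q} (hη : η ∈ M) (hv : ∃ v, δ v η ≠ 0) {s₀ : ℝ}
    (hs₀ : s₀ ∈ maxInterval M δ η) : ∃ N ∈ 𝓝 s₀, InjOn (fun s => flowMap M δ s η) N := by
  obtain ⟨v, hv⟩ := h.exists_ne_zero_flowMap hη hv hs₀
  have ha : AnalyticAt ℝ (fun s => flowMap M δ s η v) s₀ :=
    ((h.flowAnalyticAt (e := cons s₀ η) ⟨hη, hs₀⟩).2 v).analyticAt_time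
  have hd := ha.hasStrictDerivAt
  rw [((h.isFlowCurve hη).hasDerivAt s₀ hs₀ v).deriv] at hd
  refine ⟨_, (hd.hasStrictFDerivAt_equiv hv).eventually_left_inverse, fun s hs s' hs' heq => ?_⟩
  have hv' : flowMap M δ s η v = flowMap M δ s' η v := congrFun heq v
  rw [← show _ = s from hs, ← show _ = s' from hs', hv']

/-- By analytic continuation `δ` is nonzero at some point of `U`. Equality of flow mappings on `U`
can be tested on the integral curve from that point, which is locally injective. -/
theorem exists_locally_injective (hMX : M ⊆ X.carrier) (hδ : X.IsSymmetry δ)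
    (hne : ∃ η ∈ X.carrier, ∃ v, δ v η ≠ 0) {η : Space m q} (hη : η ∈ M) :
    ∃ U, IsOpen U ∧ U ⊆ M ∧ η ∈ U ∧ flowDom M δ U ∈ 𝓝 (0 : ℝ) ∧
      ∀ s₀ ∈ flowDom M δ U, ∃ N ∈ 𝓝 s₀, ∀ s ∈ N ∩ flowDom M δ U, ∀ s' ∈ N ∩ flowDom M δ U,
        EqOn (flowMap M δ s) (flowMap M δ s') U → s = s' := by
  obtain ⟨ε, hε, U, hUM, hU, hηU, G, -, hG⟩ := h.exists_box hη
  refine ⟨U, hU, hUM, hηU, ?_, fun s₀ hs₀ => ?_⟩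
  · filter_upwards [Metric.ball_mem_nhds 0 hε] with s hs ζ hζ
    rw [Metric.mem_ball, dist_zero_right, Real.norm_eq_abs] at hs
    exact (hG s ζ hs hζ).1
  · obtain ⟨ζ, hζ, hv⟩ := hδ.exists_ne_zero hne hU (hUM.trans hMX) ⟨η, hηU⟩
    obtain ⟨N, hN, hinj⟩ := h.exists_injOn_curve (hUM hζ) hv (hs₀ ζ hζ)
    exact ⟨N, hN, fun s hs s' hs' heq => hinj hs.1 hs'.1 (heq hζ)⟩

theorem isOpen_isFlowGerm (φ : Space m q → Space m q) (s : ℝ) :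
    IsOpen {η ∈ M | IsFlowGerm M δ φ s η} := by
  rw [isOpen_iff_mem_nhds]
  rintro η ⟨hη, hs, hφ⟩
  filter_upwards [h.isOpen.mem_nhds hη, h.eventually_mem_maxInterval hη hs,
    hφ.eventuallyEq_nhds] with ζ a b c
  exact ⟨a, b, c⟩

/-- On a preconnected set, two flow mappings with a common germ are equal. -/
theorem eqOn_flowMap {W : Set (Space m q)} (hW : IsPreconnected W) (hWM : W ⊆ M) {s t : ℝ}
    (hs : s ∈ flowDom M δ W) (ht : t ∈ flowDom M δ W) {ζ : Space m q} (hζ : ζ ∈ W)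
    (heq : flowMap M δ s =ᶠ[𝓝 ζ] flowMap M δ t) : EqOn (flowMap M δ s) (flowMap M δ t) W := by
  intro η hη
  ext v
  exact (eventuallyEq_of_isPreconnected hW
    (fun η hη => h.finAnalyticAt_flowMap (hWM hη) (hs η hη) v)
    (fun η hη => h.finAnalyticAt_flowMap (hWM hη) (ht η hη) v) hζ
    (heq.mono fun ξ hξ => congrFun hξ v) hη).self_of_nhds

/-- The factor `σ` treats both signs of the parameter at once; `σ * a` lies between `0` and `σ * s`.
-/
theorem mul_mem_maxInterval {η : Space m q} (hη : η ∈ M) {σ a s : ℝ} (ha : 0 ≤ a) (has : a ≤ s)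
    (hs : σ * s ∈ maxInterval M δ η) : σ * a ∈ maxInterval M δ η := by
  refine (h.ordConnected hη).uIcc_subset (h.zero_mem hη) hs ?_
  rw [mem_uIcc]
  rcases le_total 0 σ with hσ | hσ
  · exact Or.inl ⟨by positivity, mul_le_mul_of_nonneg_left has hσ⟩
  · exact Or.inr ⟨mul_le_mul_of_nonpos_left has hσ, mul_nonpos_of_nonpos_of_nonneg hσ ha⟩

/-- If a map on a preconnected open set is locally a flow mapping with a parameter of a given sign,
one can use everywhere parameters bounded by a given one of them. -/
theorem exists_isFlowGerm_le {U : Set (Space m q)} (hU : IsOpen U) (hUM : U ⊆ M)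
    (hUc : IsPreconnected U) {φ : Space m q → Space m q} {σ : ℝ}
    (hφ : ∀ η ∈ U, ∃ s ≥ 0, IsFlowGerm M δ φ (σ * s) η) {s : ℝ} (hs : 0 ≤ s) {ζ : Space m q}
    (hζ : ζ ∈ U) (hsζ : IsFlowGerm M δ φ (σ * s) ζ) {η : Space m q} (hη : η ∈ U) :
    ∃ a ∈ Icc 0 s, IsFlowGerm M δ φ (σ * a) η := by
  have key := hUc.subset_of_closure_inter_subset
    (u := {η | ∃ a ∈ Icc 0 s, η ∈ M ∧ IsFlowGerm M δ φ (σ * a) η}) ?_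
    ⟨ζ, hζ, s, ⟨hs, le_rfl⟩, hUM hζ, hsζ⟩ ?_
  · obtain ⟨a, ha, -, h1⟩ := key hη
    exact ⟨a, ha, h1⟩
  · have : {η | ∃ a ∈ Icc 0 s, η ∈ M ∧ IsFlowGerm M δ φ (σ * a) η} =
        ⋃ a ∈ Icc 0 s, {η ∈ M | IsFlowGerm M δ φ (σ * a) η} := by
      ext; simp only [mem_ofPred_eq, mem_iUnion, exists_prop]
    rw [this]
    exact isOpen_biUnion fun a _ => h.isOpen_isFlowGerm φ _
  · rintro ξ ⟨hcl, hξ⟩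
    obtain ⟨b, hb, hbξ⟩ := hφ ξ hξ
    rcases le_total b s with hbs | hbs
    · exact ⟨b, ⟨hb, hbs⟩, hUM hξ, hbξ⟩
    -- On a connected neighbourhood where the larger parameter `b` is available, so is `a`, which
    -- lies between `0` and `b`. This is where the common sign matters: the two flow mappings share
    -- a germ at a nearby point, hence agree throughout `W`.
    obtain ⟨W, hWsub, hW, hξW, hWc⟩ := locallyConnectedSpace_iff_subsets_isOpen_isConnected.1
      inferInstance ξ _ ((hU.eventually_mem hξ).and
        ((h.eventually_mem_maxInterval (hUM hξ) hbξ.1).and hbξ.2.eventuallyEq_nhds))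
    obtain ⟨ζ', hζ', a, ha, -, haζ⟩ := mem_closure_iff_nhds.1 hcl W (hW.mem_nhds hξW)
    have hWM : W ⊆ M := fun x hx => hUM (hWsub hx).1
    have haW : σ * a ∈ flowDom M δ W := fun x hx =>
      h.mul_mem_maxInterval (hWM hx) ha.1 (ha.2.trans hbs) (hWsub hx).2.1
    have heq := h.eqOn_flowMap hWc.isPreconnected hWM (fun x hx => (hWsub hx).2.1) haW hζ'
      ((hWsub hζ').2.2.symm.trans haζ.2)
    refine ⟨a, ha, hUM hξ, haW ξ hξW, ?_⟩
    filter_upwards [hbξ.2, hW.mem_nhds hξW] with x hx hxW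
    rw [hx, heq hxW]

/-- Gluing of local flow mappings whose parameters have a given sign. -/
theorem exists_eqOn_of_sign {U : Set (Space m q)} (hU : IsOpen U) (hUM : U ⊆ M)
    (hUc : IsPreconnected U) {φ : Space m q → Space m q} {σ : ℝ}
    (hφ : ∀ η ∈ U, ∃ s ≥ 0, IsFlowGerm M δ φ (σ * s) η) :
    ∃ s ∈ flowDom M δ U, EqOn φ (flowMap M δ s) U := by
  rcases U.eq_empty_or_nonempty with rfl | ⟨η₀, hη₀⟩
  · exact ⟨0, fun _ h => h.elim, fun _ h => h.elim⟩
  -- A single parameter for all of `U` is found as the infimum of those that occur. Every point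
  -- admits parameters arbitrarily close to this infimum, so continuity along the integral curve
  -- shows that the infimum itself works.
  let T : Set ℝ := {s | 0 ≤ s ∧ ∃ ζ ∈ U, IsFlowGerm M δ φ (σ * s) ζ}
  have hTne : T.Nonempty := by
    obtain ⟨s, hs, h1⟩ := hφ η₀ hη₀
    exact ⟨s, hs, η₀, hη₀, h1⟩
  have hTb : BddBelow T := ⟨0, fun s hs => hs.1⟩
  have hT0 : 0 ≤ sInf T := le_csInf hTne fun s hs => hs.1
  have hstep : ∀ s ∈ T, ∀ η ∈ U, ∃ a ∈ Icc (sInf T) s, IsFlowGerm M δ φ (σ * a) η := by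
    rintro s ⟨hs, ζ, hζ, hsζ⟩ η hη
    obtain ⟨a, ha, h1⟩ := h.exists_isFlowGerm_le hU hUM hUc hφ hs hζ hsζ hη
    exact ⟨a, ⟨csInf_le hTb ⟨ha.1, η, hη, h1⟩, ha.2⟩, h1⟩
  have hdom : σ * sInf T ∈ flowDom M δ U := fun η hη => by
    obtain ⟨s, hs⟩ := hTne
    obtain ⟨a, ha, h1⟩ := hstep s hs η hη
    exact h.mul_mem_maxInterval (hUM hη) hT0 ha.1 h1.1
  refine ⟨_, hdom, fun η hη => ?_⟩
  by_contra hcon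
  have hc : ContinuousAt (fun a : ℝ => flowMap M δ (σ * a) η) (sInf T) :=
    ContinuousAt.comp (f := fun a : ℝ => σ * a) (h.continuousAt_curve (hUM hη) (hdom η hη))
      (continuous_const.mul continuous_id).continuousAt
  obtain ⟨ρ, hρ, hρ'⟩ := Metric.eventually_nhds_iff_ball.1
    (hc.eventually (isOpen_ne.mem_nhds (Ne.symm hcon)))
  obtain ⟨s, hs, hsρ⟩ := exists_lt_of_csInf_lt hTne (lt_add_of_pos_right (sInf T) hρ)
  obtain ⟨a, ha, h1⟩ := hstep s hs η hη
  refine hρ' a ?_ h1.2.self_of_nhds.symm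
  rw [Metric.mem_ball, Real.dist_eq, abs_lt]
  exact ⟨by linarith [ha.1], by linarith [ha.2]⟩

/-- Gluing of local flow mappings in the absence of periods. -/
theorem exists_eqOn_of_no_period {U : Set (Space m q)} (hU : IsOpen U) (hUM : U ⊆ M)
    (hUc : IsPreconnected U) {φ : Space m q → Space m q}
    (hφ : ∀ η ∈ U, ∃ s, IsFlowGerm M δ φ s η)
    (hper : ∀ W ⊆ U, IsOpen W → W.Nonempty → ∀ t ∈ flowDom M δ W,
      EqOn (flowMap M δ t) id W → t = 0) :
    ∃ s ∈ flowDom M δ U, EqOn φ (flowMap M δ s) U := by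
  rcases U.eq_empty_or_nonempty with rfl | ⟨η₀, hη₀⟩
  · exact ⟨0, fun _ h => h.elim, fun _ h => h.elim⟩
  obtain ⟨s, hs⟩ := hφ η₀ hη₀
  have key := hUc.subset_of_closure_inter_subset (h.isOpen_isFlowGerm φ s)
    ⟨η₀, hη₀, hUM hη₀, hs⟩ ?_
  · exact ⟨s, fun η hη => (key hη).2.1, fun η hη => (key hη).2.2.self_of_nhds⟩
  rintro ξ ⟨hcl, hξ⟩
  obtain ⟨t, ht⟩ := hφ ξ hξ
  have hopen := ((h.isOpen_isFlowGerm φ s).inter (h.isOpen_isFlowGerm φ t)).inter hU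
  obtain ⟨ζ, ⟨⟨hζ1, hζ2⟩, hζ⟩, -, hζs⟩ := mem_closure_iff_nhds.1 hcl
    ({η ∈ M | IsFlowGerm M δ φ t η} ∩ U)
    (((h.isOpen_isFlowGerm φ t).inter hU).mem_nhds ⟨⟨hUM hξ, ht⟩, hξ⟩)
  -- Where `φ` is both flow mappings, flowing by `t` and then by `-s` is the identity, so `t - s` is
  -- a period on a nonempty open set.
  have hst : t - s = 0 := by
    have hmem : ∀ x ∈ ({η ∈ M | IsFlowGerm M δ φ s η} ∩ {η ∈ M | IsFlowGerm M δ φ t η}) ∩ U,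
        -s ∈ maxInterval M δ (flowMap M δ t x) := by
      rintro x ⟨⟨⟨hx, hxs⟩, -, hxt⟩, -⟩
      rw [← hxt.2.self_of_nhds, hxs.2.self_of_nhds]
      exact h.neg_mem_maxInterval_flowMap hx hxs.1
    refine hper _ inter_subset_right hopen ⟨ζ, ⟨⟨hζ1, hζs⟩, hζ1, hζ2⟩, hζ⟩ (t - s) ?_ ?_
    · intro x hx
      have := hmem x hx
      rwa [h.mem_maxInterval_flowMap hx.1.1.1 hx.1.2.2.1, ← sub_eq_add_neg] at this
    · intro x hx
      have h1 := hmem x hx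
      rw [h.mem_maxInterval_flowMap hx.1.1.1 hx.1.2.2.1] at h1
      have h2 := h.flowMap_flowMap hx.1.1.1 hx.1.2.2.1 h1
      rw [← hx.1.2.2.2.self_of_nhds, hx.1.1.2.2.self_of_nhds,
        h.flowMap_neg_flowMap hx.1.1.1 hx.1.1.2.1, ← sub_eq_add_neg] at h2
      exact h2.symm
  rw [sub_eq_zero] at hst
  exact ⟨hUM hξ, hst ▸ ht⟩

theorem isOneParameterPseudogroup (hMX : M ⊆ X.carrier) (hδ : X.IsIntegrable δ)
    (hne : ∃ η ∈ X.carrier, ∃ v, δ v η ≠ 0) :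
    X.IsOneParameterPseudogroup M (flowPseudogroup M δ) (flowDom M δ)
      (fun _ s => flowMap M δ s) where
  toIsPseudogroup := h.isPseudogroup hMX hδ
  dom_connected U _ hUM := ⟨h.zero_mem_flowDom hUM, h.isConnected_flowDom hUM⟩
  existence U hU hUM s hs := ⟨hU, hUM, s, hs, fun _ _ => rfl⟩
  existence_local η hη := h.exists_locally_injective hMX hδ.1 hne hη
  unicity U φ := by
    rintro ⟨-, hUM, s, hs, hφ⟩
    refine ⟨⟨s, hs, hφ⟩, fun hid hdom => hid fun η hη => ?_⟩
    -- If the parameter domain were `{0}`, the parameter would be `0` and the map the identity.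
    rw [hdom] at hs
    rw [hφ hη, mem_singleton_iff.1 hs, h.flowMap_zero (hUM hη), id]
  inverse_param U _ hUM s hs := ⟨h.flowDom_image hUM hs, h.neg_mem_flowDom_image hUM hs,
    fun _ hη => h.flowMap_neg_flowMap (hUM hη) (hs _ hη)⟩
  composition_param U _ hUM s₁ hs₁ s₂ hs₂ := by
    refine ⟨by rw [h.flowDom_image hUM hs₁]; exact hs₂, fun η hη => ?_⟩
    exact h.flowMap_flowMap (hUM hη) (hs₁ η hη) (hs₂ η hη)
  gluing U φ hU hUM hUc := by
    rintro (hφ | hφ | ⟨hφ, hper⟩)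
    · refine ⟨hU, hUM, h.exists_eqOn_of_sign (σ := 1) hU hUM hUc fun η hη => ?_⟩
      obtain ⟨W, -, hW, hηW, s, hs, hs0, heq⟩ := hφ η hη
      exact ⟨s, hs0, by rw [one_mul]; exact hs η hηW,
        by rw [one_mul]; exact heq.eventuallyEq_of_mem (hW.mem_nhds hηW)⟩
    · refine ⟨hU, hUM, h.exists_eqOn_of_sign (σ := -1) hU hUM hUc fun η hη => ?_⟩
      obtain ⟨W, -, hW, hηW, s, hs, hs0, heq⟩ := hφ η hη
      exact ⟨-s, neg_nonneg.2 hs0, by rw [neg_one_mul, neg_neg]; exact hs η hηW,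
        by rw [neg_one_mul, neg_neg]; exact heq.eventuallyEq_of_mem (hW.mem_nhds hηW)⟩
    · refine ⟨hU, hUM, h.exists_eqOn_of_no_period hU hUM hUc (fun η hη => ?_) hper⟩
      obtain ⟨W, -, hW, hηW, -, -, s, hs, heq⟩ := hφ η hη
      exact ⟨s, hs η hηW, heq.eventuallyEq_of_mem (hW.mem_nhds hηW)⟩

/-- The chain rule along the integral curve turns the relation between `δ` and the reduced field
into the differential system. -/
theorem solvesReducedSystem (hMX : M ⊆ X.carrier) (hδ : X.IsSymmetry δ) {η : Space m q}
    (hη : η ∈ M) {s₀ : ℝ} (hs₀ : s₀ ∈ maxInterval M δ η) {r : Var m q → ℕ}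
    {φ : Var m q → ((Σ z : Var m q, Fin (r z)) → ℝ) → ℝ}
    (hφ : IsReduction δ r (flowMap M δ s₀ η) φ) :
    SolvesReducedSystem δ r φ (fun s => flowMap M δ s η) s₀ := by
  filter_upwards [(h.isOpen_maxInterval hη).mem_nhds hs₀,
    (h.continuousAt_curve hη hs₀).eventually (eventually_all.2 fun z => (hφ z).2)] with s hs hred z k
  have h1 := FinAnalyticAt.hasDerivAt_comp (c := fun s => flowMap M δ s η)
    (iterTuple_finAnalyticAt hδ r (hMX (h.flowMap_mem hη hs)) ⟨z, k⟩)
    ((h.isFlowCurve hη).hasDerivAt s hs)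
  have h2 := lie_iterTuple hred ⟨z, k⟩
  rw [lie_eq_dir] at h2
  rw [h2] at h1
  exact h1

end HasLocalFlows

end Pseudogroup

end DiffietyFlow

/-! ### Assembly of the theorem. -/

theorem mainTheorem1 {m q : ℕ} (X : DiffietyFlow.Diffiety m q)
    (δ : DiffietyFlow.VectorField m q) (hδ : X.IsIntegrable δ)
    (hne : ∃ η ∈ X.carrier, ∃ v, δ v η ≠ 0) :
    (∃ (𝔘 : Set (DiffietyFlow.Space m q)) (r : DiffietyFlow.Var m q → ℕ),
      X.IsRegularDomain δ 𝔘 r) ∧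
    ∀ (𝔘 : Set (DiffietyFlow.Space m q)) (r : DiffietyFlow.Var m q → ℕ),
      X.IsRegularDomain δ 𝔘 r →
      (∀ η ∈ 𝔘,
        DiffietyFlow.IsFlowCurve 𝔘 δ η (DiffietyFlow.maxInterval 𝔘 δ η)
          (fun s => DiffietyFlow.flowMap 𝔘 δ s η) ∧
        (∀ J c, DiffietyFlow.IsFlowCurve 𝔘 δ η J c →
          ∀ s ∈ J, c s = DiffietyFlow.flowMap 𝔘 δ s η) ∧
        (∀ s₀ ∈ DiffietyFlow.maxInterval 𝔘 δ η, ∀ φ,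
          DiffietyFlow.IsReduction δ r (DiffietyFlow.flowMap 𝔘 δ s₀ η) φ →
          DiffietyFlow.SolvesReducedSystem δ r φ
            (fun s => DiffietyFlow.flowMap 𝔘 δ s η) s₀)) ∧
      (∀ U, IsOpen U → U ⊆ 𝔘 → ∀ s ∈ DiffietyFlow.flowDom 𝔘 δ U,
        X.IsMorphism U 𝔘 (DiffietyFlow.flowMap 𝔘 δ s)) ∧
      X.IsOneParameterPseudogroup 𝔘 (DiffietyFlow.flowPseudogroup 𝔘 δ)
        (DiffietyFlow.flowDom 𝔘 δ) (fun _ s => DiffietyFlow.flowMap 𝔘 δ s) := by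
  refine ⟨DiffietyFlow.exists_isRegularDomain hδ, fun 𝔘 r h𝔘 => ?_⟩
  have h := h𝔘.hasLocalFlows hδ.1
  refine ⟨fun η hη => ⟨h.isFlowCurve hη, fun J c hc s hs => h.eq_flowMap hc hs,
    fun s₀ hs₀ φ hφ => h.solvesReducedSystem h𝔘.subset hδ.1 hη hs₀ hφ⟩, fun U hU hU𝔘 s hs => ?_,
    h.isOneParameterPseudogroup h𝔘.subset hδ hne⟩
  exact h.isMorphism h𝔘.subset hδ hU hU𝔘 h𝔘.isOpen hs (fun _ _ => rfl) (h.mapsTo_flowMap hU𝔘 hs)
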